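/- **Setting.** Let $M$ be a compact Riemannian manifold (without boundary) with normalized Riemannian volume $m$, and put $\psi(\varphi)=\int_M\varphi\,dm$. Let $\|\cdot\|_{C^r}$ denote the usual $C^r$ norm, defined by a finite cover of $M$ by compact subsets of chart domains; $\|\cdot\|_{C^0}=\|\cdot\|_\infty$. Let $(\Omega,\mathcal F,\mathbb P)$ be a probability space, $\sigma:\Omega\to\Omega$ an invertible (bimeasurable), ergodic, $\mathbb P$-preserving map, and $I\subset(-1,1)$ an open interval with $0\in I$. For $\varepsilon\in I$ let $T_{\omega,\varepsilon}:M\to M$ be maps, jointly measurable in $(\omega,x)$, whose transfer operators $\mathcal L_{\omega,\varepsilon}$, given by $\int(\mathcal L_{\omega,\varepsilon}\varphi)\,u\,dm=\int\varphi\,(u\circ T_{\omega,\varepsilon})\,dm$ for all bounded measurable $u$, are bounded on $C^0(M)$, $C^1(M)$ and $C^3(M)$. Write $\mathcal L_\omega=\mathcal L_{\omega,0}$, $\mathcal L^n_{\omega,\varepsilon}=\mathcal L_{\sigma^{n-1}\omega,\varepsilon}\circ\dots\circ\mathcal L_{\omega,\varepsilon}$ and $T^n_{\omega,\varepsilon}=T_{\sigma^{n-1}\omega,\varepsilon}\circ\dots\circ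 T_{\omega,\varepsilon}$. **Assumptions.** Let $p_0>0$, $p_1,\dots,p_5\ge 30$, $p_6\ge 8$, $r>0$, $\beta-r>1$, $p_ir/3>1$ for $i=1,2,3,4$, $\delta>0$, $$\frac1s=\frac1{p_0}+\frac1{p_1}+\frac2{p_5}+\frac1{p_4}+\frac1{\min(p_2,p_3)},\qquad a=\frac{\beta-1-r}{\beta+1-r+1/s+\delta},\qquad \beta>4,\quad \beta>1+\frac1a .$$ Let $C_i\in L^{p_i}(\mathbb P)$ $(0\le i\le4)$ and $A,B\in L^{p_5}(\mathbb P)$. Suppose that for all $\omega$ in a set of full measure the following hold. 1. $\|\mathcal L^n_{\sigma^{-n}\omega,\varepsilon}\|_{C^0}\le C_0(\omega)$ for all $n\ge1$, $\varepsilon\in I$. 2. $\|\mathcal L^n_{\omega,\varepsilon}\varphi\|_\infty\le C_1(\omega)n^{-\beta}\|\varphi\|_{C^1}$ for all $n\ge1$, $\varepsilon\in I$ and $\varphi\in C^1$ with $\psi(\varphi)=0$. 3. $\|(\mathcal L_{\omega,\varepsilon}-\mathcal L_\omega)\varphi\|_\infty\le C_2(\omega)|\varepsilon|\,\|\varphi\|_{C^1}$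 for all $\varepsilon\in I$, $\varphi\in C^1$. 4. There is a linear operator $\hat{\mathcal L}_\omega:C^3\to\{\varphi\in C^1:\psi(\varphi)=0\}$ with $\|\varepsilon^{-1}(\mathcal L_{\omega,\varepsilon}-\mathcal L_\omega)\varphi-\hat{\mathcal L}_\omega\varphi\|_{C^1}\le C_3(\omega)|\varepsilon|\,\|\varphi\|_{C^3}$ and $\|\hat{\mathcal L}_\omega\varphi\|_{C^1}\le C_3(\omega)\|\varphi\|_{C^3}$ for all $\varepsilon\in I\setminus\{0\}$, $\varphi\in C^3$. 5. There are families $(h_{\omega,\varepsilon})_{\omega\in\Omega}\subset C^3$, measurable in $\omega$ for each $\varepsilon\in I$, with $\mathcal L_{\omega,\varepsilon}h_{\omega,\varepsilon}=h_{\sigma\omega,\varepsilon}$, $\psi(h_{\omega,\varepsilon})=1$ and $\|h_{\omega,\varepsilon}\|_{C^3}\le C_4(\omega)$ for all $\varepsilon\in I$. 6. $\|\mathcal L^j_{\sigma^{-n}\omega}\|_{C^1}\le A(\sigma^{-n}\omega)B(\sigma^{j-n}\omega)$ for all $n\ge1$, $0\le j\le n$. 7. For each $k\in\{0,1,2,3\}$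 there is $A_k\in L^8(\mathbb P)$, not depending on $j$ and $\varepsilon$, such that $\|\mathcal L^j_{\omega,\varepsilon}\|_{C^k}\le A_k(\sigma^j\omega)$ for all $j\ge1$, $\varepsilon\in I$ (in particular $\mathcal L^j_{\omega,\varepsilon}$ preserves $C^k$). 8. There is $C\in L^8(\mathbb P)$ such that $\|\hat{\mathcal L}_\omega\varphi\|_{C^1}\le C(\omega)\|\varphi\|_{C^2}$ for all $\varphi\in C^3$. Let $f:\Omega\times M\to\mathbb R$ be measurable, $f_\omega=f(\omega,\cdot)\in C^3$ for a.e. $\omega$, and $\omega\mapsto\|f_\omega\|_{C^3}\in L^{p_6}(\mathbb P)$. Put $d\mu_{\omega,\varepsilon}=h_{\omega,\varepsilon}\,dm$, $f_{\omega,\varepsilon}=f_\omega-\mu_{\omega,\varepsilon}(f_\omega)$, $S^\omega_{n,\varepsilon}f=\sum_{j=0}^{n-1}f_{\sigma^j\omega}\circ T^j_{\omega,\varepsilon}$, $h_\varepsilon(\omega,x)=h_{\omega,\varepsilon}(x)$, $f_\varepsilon(\omega,x)=f_{\omega,\varepsilon}(x)$, $\tau_\varepsilon(\omega,x)=(\sigma\omega,T_{\omega,\varepsilon}x)$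 and $$c_n(\varepsilon)=\int_\Omega\int_M f_{\omega,\varepsilon}\,(f_{\sigma^n\omega,\varepsilon}\circ T^n_{\omega,\varepsilon})\,h_{\omega,\varepsilon}\,dm\,d\mathbb P\qquad(n\ge0).$$ **Theorem.** For every $\varepsilon\in I$ the measure $\mu_{\omega,\varepsilon}$ is a probability measure for $\mathbb P$-a.e. $\omega$, and there is a number $\Sigma^2_\varepsilon\ge0$ such that $\Sigma^2_\varepsilon=\lim_{n\to\infty}\frac1n\mathrm{Var}_{\mu_{\omega,\varepsilon}}(S^\omega_{n,\varepsilon}f)$ for $\mathbb P$-a.e. $\omega$. Moreover, for every $\varepsilon\in I$, $$\Sigma^2_\varepsilon=c_0(\varepsilon)+2\sum_{n\ge1}c_n(\varepsilon)=\int_{\Omega\times M}f_\varepsilon^2h_\varepsilon\,d(\mathbb P\times m)+2\sum_{n\ge1}\int_{\Omega\times M}(h_\varepsilon f_\varepsilon)\cdot(f_\varepsilon\circ\tau_\varepsilon^n)\,d(\mathbb P\times m),$$ where the series converges absolutely and all integrands over $\Omega\times M$ are integrable. Finally, each $c_n$ is differentiable at $0$, the series $\sum_{n\ge1}c_n'(0)$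 converges absolutely, $\varepsilon\mapsto\Sigma^2_\varepsilon$ is differentiable at $0$, and $$\frac{d\Sigma^2_\varepsilon}{d\varepsilon}\Big|_{\varepsilon=0}=c_0'(0)+2\sum_{n\ge1}c_n'(0).$$ -/

import Mathlib

open MeasureTheory ProbabilityTheory Filter Topology
open scoped ENNReal Manifold

namespace RandomResponse

/-! ### Riemannian volume and `C^r` norms on a compact manifold -/

section Manifold

variable {d : ℕ} {M : Type*} [TopologicalSpace M] [ChartedSpace (EuclideanSpace ℝ (Fin d)) M]

/-- The `i`-th coordinate vector field of the chart at `x`, at the point with coordinates `y`. -/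
noncomputable def coordVector (x : M) (y : EuclideanSpace ℝ (Fin d)) (i : Fin d) :
    TangentSpace (𝓡 d) ((chartAt (EuclideanSpace ℝ (Fin d)) x).symm y) :=
  mfderiv 𝓘(ℝ, EuclideanSpace ℝ (Fin d)) (𝓡 d) (chartAt (EuclideanSpace ℝ (Fin d)) x).symm y
    (EuclideanSpace.single i (1 : ℝ))

/-- The Riemannian volume density `√det (g_ij)` in the chart at `x`, as a function of the
coordinates `y`. -/
noncomputable def volumeDensity [IsManifold (𝓡 d) (⊤ : ℕ∞) M]
    (g : Bundle.ContMDiffRiemannianMetric (𝓡 d) (⊤ : ℕ∞) (EuclideanSpace ℝ (Fin d))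
      (fun x : M => TangentSpace (𝓡 d) x))
    (x : M) (y : EuclideanSpace ℝ (Fin d)) : ℝ :=
  Real.sqrt (Matrix.det (Matrix.of fun i j : Fin d =>
    g.inner ((chartAt (EuclideanSpace ℝ (Fin d)) x).symm y)
      (coordVector x y i) (coordVector x y j)))

/-- `m` is the normalized Riemannian volume of `(M, g)`: a probability measure which, up to one
global normalizing constant `c`, is given in each chart by `√det (g_ij) dy`. -/
structure IsNormalizedVolume [IsManifold (𝓡 d) (⊤ : ℕ∞) M] [MeasurableSpace M]
    (g : Bundle.ContMDiffRiemannianMetric (𝓡 d) (⊤ : ℕ∞) (EuclideanSpace ℝ (Fin d))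
      (fun x : M => TangentSpace (𝓡 d) x))
    (m : Measure M) : Prop where
  isProbabilityMeasure : IsProbabilityMeasure m
  eq_in_charts : ∃ c : ℝ≥0∞, ∀ (x : M) (s : Set M), MeasurableSet s →
    s ⊆ (chartAt (EuclideanSpace ℝ (Fin d)) x).source →
    m s = c * ∫⁻ y in chartAt (EuclideanSpace ℝ (Fin d)) x '' s,
      ENNReal.ofReal (volumeDensity g x y)

variable (d M) in
/-- A finite cover of `M` by compact sets, each contained in the domain of a chart. Such a cover
is the datum from which the usual `C^r` norms of functions on a compact manifold are built;
different covers give equivalent norms. -/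
structure ChartCover where
  N : ℕ
  center : Fin N → M
  piece : Fin N → Set M
  isCompact_piece : ∀ i, IsCompact (piece i)
  piece_subset : ∀ i, piece i ⊆ (chartAt (EuclideanSpace ℝ (Fin d)) (center i)).source
  iUnion_piece : ⋃ i, piece i = Set.univ

/-- The supremum of the norms of all derivatives of order at most `r` of `u`, in the charts of
the cover. -/
noncomputable def crENorm (cov : ChartCover d M) (r : ℕ) (u : M → ℝ) : ℝ≥0∞ :=
  ⨆ i : Fin cov.N, ⨆ k : Fin (r + 1), ⨆ x ∈ cov.piece i,
    ‖iteratedFDeriv ℝ (k : ℕ)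
      (u ∘ (chartAt (EuclideanSpace ℝ (Fin d)) (cov.center i)).symm)
      (chartAt (EuclideanSpace ℝ (Fin d)) (cov.center i) x)‖ₑ

/-- The `C^r` norm (only used for functions `u` of class `C^r`, for which `crENorm` is finite). -/
noncomputable def crNorm (cov : ChartCover d M) (r : ℕ) (u : M → ℝ) : ℝ :=
  (crENorm cov r u).toReal

/-- The operator `L` on `C^0` maps `C^r` into itself, with norm at most `K` on `C^r`. -/
def CrBound [CompactSpace M] (cov : ChartCover d M) (r : ℕ)
    (L : C(M, ℝ) →L[ℝ] C(M, ℝ)) (K : ℝ) : Prop :=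
  ∀ φ : C(M, ℝ), ContMDiff (𝓡 d) 𝓘(ℝ, ℝ) r φ →
    ContMDiff (𝓡 d) 𝓘(ℝ, ℝ) r (L φ) ∧ crNorm cov r (L φ) ≤ K * crNorm cov r φ

/-- Chart covers exist on compact manifolds. -/
theorem nonempty_chartCover [CompactSpace M] : Nonempty (ChartCover d M) := by
  classical
  have : LocallyCompactSpace M :=
    ChartedSpace.locallyCompactSpace (EuclideanSpace ℝ (Fin d)) M
  choose K hKx hKs hKc using fun x : M =>
    local_compact_nhds ((chartAt (EuclideanSpace ℝ (Fin d)) x).open_source.mem_nhds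
      (mem_chart_source (EuclideanSpace ℝ (Fin d)) x))
  obtain ⟨t, -, ht⟩ := isCompact_univ.elim_nhds_subcover K (fun x _ => hKx x)
  refine ⟨⟨t.card, fun i => (t.equivFin.symm i : M), fun i => K (t.equivFin.symm i),
    fun i => hKc _, fun i => hKs _, ?_⟩⟩
  refine Set.eq_univ_of_univ_subset fun y hy => ?_
  obtain ⟨x, hx, hyx⟩ := Set.mem_iUnion₂.1 (ht hy)
  exact Set.mem_iUnion.2 ⟨t.equivFin ⟨x, hx⟩, by simpa using hyx⟩

/-- The `C^r` norm of a `C^r` function is finite. -/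
theorem crENorm_lt_top (cov : ChartCover d M) (r : ℕ) [IsManifold (𝓡 d) (⊤ : ℕ∞) M] {u : M → ℝ}
    (hu : ContMDiff (𝓡 d) 𝓘(ℝ, ℝ) r u) : crENorm cov r u < ⊤ := by
  have key : ∀ (i : Fin cov.N) (k : Fin (r + 1)), ∃ C : ENNReal, C < ⊤ ∧
      ∀ x ∈ cov.piece i, ‖iteratedFDeriv ℝ (k : ℕ)
        (u ∘ (chartAt (EuclideanSpace ℝ (Fin d)) (cov.center i)).symm)
        (chartAt (EuclideanSpace ℝ (Fin d)) (cov.center i) x)‖ₑ ≤ C := by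
    intro i k
    set e := chartAt (EuclideanSpace ℝ (Fin d)) (cov.center i) with he
    have h1 : ContDiffOn ℝ r (u ∘ e.symm) e.target := by
      rw [← contMDiffOn_iff_contDiffOn]
      exact hu.comp_contMDiffOn ((contMDiffOn_chart_symm (I := 𝓡 d) (n := (⊤ : ℕ∞))).of_le
        (by exact_mod_cast le_top))
    have h2 : ContinuousOn (fun y => iteratedFDeriv ℝ (k : ℕ) (u ∘ e.symm) y) e.target := by
      have h3 := h1.continuousOn_iteratedFDerivWithin (m := k)
        (by exact_mod_cast Nat.lt_succ_iff.1 k.2) e.open_target.uniqueDiffOn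
      exact h3.congr fun y hy => (iteratedFDerivWithin_of_isOpen (k : ℕ) e.open_target hy).symm
    have h4 : ContinuousOn (fun x => iteratedFDeriv ℝ (k : ℕ) (u ∘ e.symm) (e x))
        (cov.piece i) :=
      h2.comp (e.continuousOn.mono (cov.piece_subset i))
        fun x hx => e.map_source (cov.piece_subset i hx)
    obtain ⟨C, hC⟩ := (cov.isCompact_piece i).exists_bound_of_continuousOn h4
    refine ⟨ENNReal.ofReal C, ENNReal.ofReal_lt_top, fun x hx => ?_⟩
    rw [← ofReal_norm]
    exact ENNReal.ofReal_le_ofReal (hC x hx)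
  choose c hc hle using key
  refine lt_of_le_of_lt (b := ∑ i, ∑ k, c i k) ?_ ?_
  · refine iSup_le fun i => iSup_le fun k => iSup₂_le fun x hx => (hle i k x hx).trans ?_
    exact (Finset.single_le_sum (f := fun k => c i k) (fun _ _ => zero_le)
      (Finset.mem_univ k)).trans (Finset.single_le_sum (f := fun i => ∑ k, c i k)
        (fun _ _ => zero_le) (Finset.mem_univ i))
  · exact ENNReal.sum_lt_top.2 fun i _ => ENNReal.sum_lt_top.2 fun k _ => hc i k
end Manifold

/-! ### Random compositions of maps and of operators -/

section Cocycle

variable {Ω M : Type*}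

/-- `T_ω^n = T_{σ^{n-1}ω} ∘ ⋯ ∘ T_ω`. -/
def mapIter (σ : Ω → Ω) (T : Ω → M → M) : ℕ → Ω → M → M
  | 0, _ => id
  | n + 1, ω => T (σ^[n] ω) ∘ mapIter σ T n ω

/-- The skew product `τ (ω, x) = (σ ω, T_ω x)`. -/
def skewProduct (σ : Ω → Ω) (T : Ω → M → M) (p : Ω × M) : Ω × M :=
  (σ p.1, T p.1 p.2)

/-- `L_ω^n = L_{σ^{n-1}ω} ∘ ⋯ ∘ L_ω`. -/
noncomputable def opIter [TopologicalSpace M] [CompactSpace M] (σ : Ω → Ω)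
    (L : Ω → C(M, ℝ) →L[ℝ] C(M, ℝ)) : ℕ → Ω → C(M, ℝ) →L[ℝ] C(M, ℝ)
  | 0, _ => ContinuousLinearMap.id ℝ C(M, ℝ)
  | n + 1, ω => (L (σ^[n] ω)).comp (opIter σ L n ω)

/-- `L` is the transfer operator of the map `T` with respect to `m`, acting on continuous
functions: `∫ (L φ) u dm = ∫ φ (u ∘ T) dm` for all bounded measurable `u`. -/
def IsTransferOperator [TopologicalSpace M] [CompactSpace M] [MeasurableSpace M]
    (m : Measure M) (T : M → M) (L : C(M, ℝ) →L[ℝ] C(M, ℝ)) : Prop :=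
  ∀ (φ : C(M, ℝ)) (u : M → ℝ), Measurable u → (∃ b : ℝ, ∀ x, |u x| ≤ b) →
    ∫ x, L φ x * u x ∂m = ∫ x, φ x * u (T x) ∂m

/-- `S_n^ω f = ∑_{j < n} f_{σ^j ω} ∘ T_ω^j`. -/
def ergodicSum (σ : Ω → Ω) (T : Ω → M → M) (f : Ω → M → ℝ) (n : ℕ) (ω : Ω) (x : M) : ℝ :=
  ∑ j ∈ Finset.range n, f (σ^[j] ω) (mapIter σ T j ω x)

variable [MeasurableSpace M]

/-- The measure `dμ = h dm`. -/
noncomputable def densityMeasure (m : Measure M) (h : M → ℝ) : Measure M :=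
  m.withDensity fun x => ENNReal.ofReal (h x)

/-- The fibrewise centred observable `f_ω - μ_ω(f_ω)`, where `dμ_ω = h_ω dm`. -/
noncomputable def centered (m : Measure M) (h f : Ω → M → ℝ) (ω : Ω) (x : M) : ℝ :=
  f ω x - ∫ y, f ω y ∂(densityMeasure m (h ω))

/-- The `n`-th correlation `∫_Ω ∫_M f̄_ω (f̄_{σ^n ω} ∘ T_ω^n) h_ω dm dP`, where `f̄` is the
fibrewise centred observable; for `n = 0` it is `∫_Ω ∫_M f̄_ω ^ 2 h_ω dm dP`. -/
noncomputable def correlation [MeasurableSpace Ω] (P : Measure Ω) (m : Measure M) (σ : Ω → Ω)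
    (T : Ω → M → M) (h f : Ω → M → ℝ) (n : ℕ) : ℝ :=
  ∫ ω, ∫ x, centered m h f ω x * centered m h f (σ^[n] ω) (mapIter σ T n ω x) * h ω x ∂m ∂P

end Cocycle

end RandomResponse

/-!
The variance is governed by the correlations `c_n(ε)`, which in the fibre over `ω` are the integrals
of `L_{ω,ε}^n (g_{ω,ε})` against the observable over `σ^n ω`, where `g_{ω,ε}` is the centred
observable times the density (`fibreCorr`, `ResponseSystem.fibreCorr_eq`). The polynomial decay of
the transfer operators makes them summable, and the variance of the ergodic sums is a double sum of
correlations along the orbit of `ω` (`ResponseSystem.variance_ergodicSum`). Its normalized limit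
follows from Birkhoff's pointwise theorem (`ae_tendsto_birkhoff`), since the tails lost by truncating
at the time horizon are small on average (`tendsto_avg_truncated`). The densities are nonnegative
because they are limits of `L^n 1` along the past.

For the derivative, the difference quotient of a fibrewise correlation is expanded into the effects
of the perturbations of the single operators (`ResponseSystem.slope_fibreCorr`): those at times
`0 ≤ k < n` enter directly, by telescoping, and those at times `-j - 1 < 0` through the equivariant
density, for which going back in time gives the series `ResponseSystem.hasSum_responseTerm`.
Each effect is small for two reasons: the centred function that carries the perturbation has
decorrelated from the past, and it will decorrelate from the observable at time `n`. Taking a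
geometric mean of the two bounds yields a majorant which is summable over `n` and over the time of
the perturbation (`ResponseSystem.abs_densityTerm_le`, `ResponseSystem.exists_abs_operatorTerm_le`),
so that dominated convergence applies to the sums, to the integral over the base and to the sum over
`n` (`ResponseSystem.exists_hasDerivAt`).

The delicate point is that decay of correlations is known in `C^0` only, while the difference
quotients `ε⁻¹ (L_ε - L_0)` are controlled on `C^3`. By comparison with the difference quotient at a
fixed scale `η`, their `C^0` norm is bounded by `η` times the `C^3` norm plus `η⁻¹` times the `C^0`
norm of the function, up to constants, uniformly in `ε`
(`ResponseSystem.norm_delta_interpolation`). With `η` a power of the time this turns `C^0` decay into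
decay of the perturbation terms, and it also shows that difference quotients of `C^3`-bounded,
`C^0`-convergent families converge (`ResponseSystem.tendsto_delta`).

All random constants are dominated by one function `E` in `L^8`. Every bound involves at most eight
factors `E` at points of the orbit, and such a product is at most the sum of the eighth powers
(`monomial_le_sum_pow`), whose integrals do not depend on the points.
-/

namespace RandomResponse

/-! ### The pointwise ergodic theorem -/

section Birkhoff

variable {Ω : Type*}

/-- The running maximum `max_{0 ≤ k ≤ n} S_k Y` of the Birkhoff sums of `Y`, defined by the
recursion that drives the proof of the ergodic theorem. -/
noncomputable def birkhoffMax (τ : Ω → Ω) (Y : Ω → ℝ) : ℕ → Ω → ℝ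
  | 0, _ => 0
  | n + 1, ω => max 0 (Y ω + birkhoffMax τ Y n (τ ω))

theorem birkhoffMax_nonneg (τ : Ω → Ω) (Y : Ω → ℝ) (n : ℕ) (ω : Ω) :
    0 ≤ birkhoffMax τ Y n ω := by
  cases n with
  | zero => exact le_rfl
  | succ n => exact le_max_left _ _

theorem birkhoffMax_le_succ (τ : Ω → Ω) (Y : Ω → ℝ) (n : ℕ) (ω : Ω) :
    birkhoffMax τ Y n ω ≤ birkhoffMax τ Y (n + 1) ω := by
  induction n generalizing ω with
  | zero => exact le_max_left _ _
  | succ n ih =>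
    simp only [birkhoffMax] at ih ⊢
    gcongr
    exact ih _

theorem birkhoffSum_le_birkhoffMax (τ : Ω → Ω) (Y : Ω → ℝ) (n : ℕ) (ω : Ω) :
    birkhoffSum τ Y n ω ≤ birkhoffMax τ Y n ω := by
  induction n generalizing ω with
  | zero => simp [birkhoffMax]
  | succ n ih =>
    rw [birkhoffSum_succ']
    exact le_max_of_le_right (by gcongr; exact ih _)

variable [MeasurableSpace Ω] {P : Measure Ω} {τ : Ω → Ω} {Y : Ω → ℝ}

theorem measurable_birkhoffMax (hτ : Measurable τ) (hY : Measurable Y) (n : ℕ) :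
    Measurable (birkhoffMax τ Y n) := by
  induction n with
  | zero => exact measurable_const
  | succ n ih => exact measurable_const.max (hY.add (ih.comp hτ))

theorem integrable_birkhoffMax (hτ : MeasurePreserving τ P P) (hY : Integrable Y P) (n : ℕ) :
    Integrable (birkhoffMax τ Y n) P := by
  induction n with
  | zero => exact integrable_zero _ _ _
  | succ n ih => exact (integrable_zero _ _ _).sup (hY.add (hτ.integrable_comp_of_integrable ih))

/-- The Birkhoff sums of a function with negative mean are almost surely bounded above. Otherwise,
by ergodicity, the running maxima `F_n` are almost surely unbounded, so that
`F_{n+1} - F_n ∘ τ = max (-F_n ∘ τ) Y` decreases to `Y`; but its integral `∫ (F_{n+1} - F_n)` is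
nonnegative. -/
theorem ae_bddAbove_birkhoffMax [IsProbabilityMeasure P] (hτ : Ergodic τ P) (hYm : Measurable Y)
    (hY : Integrable Y P) (hneg : ∫ ω, Y ω ∂P < 0) :
    ∀ᵐ ω ∂P, BddAbove (Set.range fun n => birkhoffMax τ Y n ω) := by
  have hmp := hτ.toMeasurePreserving
  have hmeas : MeasurableSet {ω | BddAbove (Set.range fun n => birkhoffMax τ Y n ω)} :=
    measurableSet_bddAbove_range fun n => measurable_birkhoffMax hmp.measurable hYm n
  have hinv : τ ⁻¹' {ω | BddAbove (Set.range fun n => birkhoffMax τ Y n ω)}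
      = {ω | BddAbove (Set.range fun n => birkhoffMax τ Y n ω)} := by
    ext ω
    constructor
    · rintro ⟨b, hb⟩
      refine ⟨max 0 (Y ω + b), ?_⟩
      rintro _ ⟨n, rfl⟩
      cases n with
      | zero => exact le_max_left _ _
      | succ n =>
        have := hb ⟨n, rfl⟩
        exact max_le_max le_rfl (by gcongr)
    · rintro ⟨b, hb⟩
      refine ⟨b - Y ω, ?_⟩
      rintro _ ⟨n, rfl⟩
      have h1 : birkhoffMax τ Y (n + 1) ω ≤ b := hb ⟨n + 1, rfl⟩
      have h2 : Y ω + birkhoffMax τ Y n (τ ω) ≤ birkhoffMax τ Y (n + 1) ω := le_max_right _ _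
      simp only
      linarith
  rcases hτ.ae_mem_or_ae_notMem hmeas hinv with h | h
  · exact h
  exfalso
  have hlim : Tendsto
      (fun n => ∫ ω, (birkhoffMax τ Y (n + 1) ω - birkhoffMax τ Y n (τ ω)) ∂P) atTop
      (𝓝 (∫ ω, Y ω ∂P)) := by
    refine tendsto_integral_of_dominated_convergence (fun ω => |Y ω|) (fun n => ?_) hY.abs
      (fun n => ?_) ?_
    · exact ((measurable_birkhoffMax hmp.measurable hYm _).sub
        ((measurable_birkhoffMax hmp.measurable hYm _).comp hmp.measurable)).aestronglyMeasurable
    · refine Eventually.of_forall fun ω => ?_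
      have h0 := birkhoffMax_nonneg τ Y n (τ ω)
      simp only [birkhoffMax, Real.norm_eq_abs]
      rcases le_total 0 (Y ω + birkhoffMax τ Y n (τ ω)) with h1 | h1
      · rw [max_eq_right h1, add_sub_cancel_right]
      · rw [max_eq_left h1, zero_sub, abs_neg, abs_of_nonneg h0, abs_of_nonpos (by linarith)]
        linarith
    · have h' := hmp.quasiMeasurePreserving.ae h
      filter_upwards [h'] with ω hω
      have hmono : Monotone fun n => birkhoffMax τ Y n (τ ω) :=
        monotone_nat_of_le_succ fun n => birkhoffMax_le_succ τ Y n (τ ω)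
      obtain ⟨N, hN⟩ : ∃ N, -Y ω < birkhoffMax τ Y N (τ ω) := by
        by_contra! hcon
        exact hω ⟨-Y ω, by rintro _ ⟨n, rfl⟩; exact hcon n⟩
      refine tendsto_const_nhds.congr' ?_
      filter_upwards [eventually_ge_atTop N] with n hn
      have h2 : birkhoffMax τ Y N (τ ω) ≤ birkhoffMax τ Y n (τ ω) := hmono hn
      rw [birkhoffMax, max_eq_right (by linarith), add_sub_cancel_right]
  have hnn : ∀ n, 0 ≤ ∫ ω, (birkhoffMax τ Y (n + 1) ω - birkhoffMax τ Y n (τ ω)) ∂P := by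
    intro n
    have hi := integrable_birkhoffMax hmp hY n
    have hi' := integrable_birkhoffMax hmp hY (n + 1)
    have hcomp : ∫ ω, birkhoffMax τ Y n (τ ω) ∂P = ∫ ω, birkhoffMax τ Y n ω ∂P := by
      have := integral_map (μ := P) hmp.measurable.aemeasurable
        (f := birkhoffMax τ Y n) (by rw [hmp.map_eq]; exact hi.aestronglyMeasurable)
      rw [← this, hmp.map_eq]
    have hic : Integrable (fun ω => birkhoffMax τ Y n (τ ω)) P :=
      hmp.integrable_comp_of_integrable hi
    rw [integral_sub hi' hic, hcomp, sub_nonneg]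
    exact integral_mono hi hi' fun ω => birkhoffMax_le_succ τ Y n ω
  exact absurd (ge_of_tendsto' hlim hnn) (not_le.2 hneg)

theorem ae_eventually_birkhoffSum_le [IsProbabilityMeasure P] (hτ : Ergodic τ P)
    (hYm : Measurable Y) (hY : Integrable Y P) :
    ∀ᵐ ω ∂P, ∀ a, ∫ ω, Y ω ∂P < a →
      ∀ᶠ n : ℕ in atTop, (1 / (n : ℝ)) * birkhoffSum τ Y n ω < a := by
  have key : ∀ q : ℚ, ∀ᵐ ω ∂P, ∫ ω, Y ω ∂P < q →
      BddAbove (Set.range fun n => birkhoffMax τ (fun ω => Y ω - q) n ω) := by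
    intro q
    by_cases hq : ∫ ω, Y ω ∂P < q
    · have := ae_bddAbove_birkhoffMax hτ (hYm.sub_const (q : ℝ)) (hY.sub (integrable_const (q : ℝ)))
        (by rw [integral_sub hY (integrable_const _)]; simpa using hq)
      filter_upwards [this] with ω hω _ using hω
    · exact Eventually.of_forall fun ω h => absurd h hq
  filter_upwards [ae_all_iff.2 key] with ω hω a ha
  obtain ⟨q, hq1, hq2⟩ := exists_rat_btwn ha
  obtain ⟨b, hb⟩ := hω q hq1
  have hlim : Tendsto (fun n : ℕ => (q : ℝ) + b * (1 / (n : ℝ))) atTop (𝓝 ((q : ℝ) + b * 0)) :=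
    tendsto_const_nhds.add (tendsto_const_nhds.mul tendsto_one_div_atTop_nhds_zero_nat)
  rw [mul_zero, add_zero] at hlim
  filter_upwards [hlim.eventually_lt_const hq2, eventually_gt_atTop 0] with n hn hn0
  refine lt_of_le_of_lt ?_ hn
  have h1 : birkhoffSum τ (fun ω => Y ω - q) n ω ≤ b :=
    (birkhoffSum_le_birkhoffMax _ _ _ _).trans (hb ⟨n, rfl⟩)
  have h2 : birkhoffSum τ (fun ω => Y ω - q) n ω = birkhoffSum τ Y n ω - n * q := by
    simp [birkhoffSum, Finset.sum_sub_distrib]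
  have hn' : (0 : ℝ) < n := by exact_mod_cast hn0
  rw [h2] at h1
  have h3 : birkhoffSum τ Y n ω ≤ n * q + b := by linarith
  calc (1 / (n : ℝ)) * birkhoffSum τ Y n ω ≤ (1 / (n : ℝ)) * (n * q + b) := by gcongr
    _ = q + b * (1 / (n : ℝ)) := by field_simp

/-- **Birkhoff's ergodic theorem** for an ergodic map of a probability space. -/
theorem ae_tendsto_birkhoff [IsProbabilityMeasure P] (hτ : Ergodic τ P) (hY : Integrable Y P) :
    ∀ᵐ ω ∂P, Tendsto (fun n : ℕ => (1 / (n : ℝ)) * ∑ j ∈ Finset.range n, Y (τ^[j] ω)) atTop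
      (𝓝 (∫ ω, Y ω ∂P)) := by
  obtain ⟨Z, hZm, hYZ⟩ := hY.aestronglyMeasurable
  have hZ : Integrable Z P := hY.congr hYZ
  have hae : ∀ᵐ ω ∂P, ∀ j : ℕ, Y (τ^[j] ω) = Z (τ^[j] ω) := ae_all_iff.2 fun j =>
    ((hτ.toMeasurePreserving.iterate j).quasiMeasurePreserving.ae hYZ)
  filter_upwards [hae, ae_eventually_birkhoffSum_le hτ hZm.measurable hZ,
    ae_eventually_birkhoffSum_le hτ hZm.measurable.neg hZ.neg] with ω h1 h2 h3
  rw [integral_congr_ae hYZ]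
  have heq : ∀ n : ℕ, (1 / (n : ℝ)) * ∑ j ∈ Finset.range n, Y (τ^[j] ω)
      = (1 / (n : ℝ)) * birkhoffSum τ Z n ω := fun n => by
    rw [birkhoffSum, Finset.sum_congr rfl fun j _ => h1 j]
  simp only [heq]
  refine tendsto_order.2 ⟨fun a ha => ?_, fun a ha => h2 a ha⟩
  have h4 := h3 (-a) (by
    have : ∫ ω, (-Z) ω ∂P = -∫ ω, Z ω ∂P := integral_neg _
    rw [this]; linarith)
  filter_upwards [h4] with n hn
  rw [birkhoffSum_neg, mul_neg] at hn
  linarith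

end Birkhoff

/-! ### Calculus of `C^r` bounds -/

section CrLe

variable {d : ℕ} {M : Type*} [TopologicalSpace M] [ChartedSpace (EuclideanSpace ℝ (Fin d)) M]
  {cov : ChartCover d M} {r : ℕ} {u v : M → ℝ} {K K' : ℝ}

/-- The function `u` is of class `C^r`, with `C^r` norm at most `K`. -/
def CrLe (cov : ChartCover d M) (r : ℕ) (u : M → ℝ) (K : ℝ) : Prop :=
  ContMDiff (𝓡 d) 𝓘(ℝ, ℝ) r u ∧ crNorm cov r u ≤ K

theorem CrLe.nonneg (h : CrLe cov r u K) : 0 ≤ K := ENNReal.toReal_nonneg.trans h.2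

theorem CrLe.mono (h : CrLe cov r u K) (hK : K ≤ K') : CrLe cov r u K' := ⟨h.1, h.2.trans hK⟩

variable [IsManifold (𝓡 d) (⊤ : ℕ∞) M]

theorem contDiffAt_comp_chart_symm (hu : ContMDiff (𝓡 d) 𝓘(ℝ, ℝ) r u) (i : Fin cov.N) {x : M}
    (hx : x ∈ cov.piece i) :
    ContDiffAt ℝ r (u ∘ (chartAt (EuclideanSpace ℝ (Fin d)) (cov.center i)).symm)
      (chartAt (EuclideanSpace ℝ (Fin d)) (cov.center i) x) := by
  set e := chartAt (EuclideanSpace ℝ (Fin d)) (cov.center i) with he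
  have h1 : ContDiffOn ℝ r (u ∘ e.symm) e.target := by
    rw [← contMDiffOn_iff_contDiffOn]
    exact hu.comp_contMDiffOn ((contMDiffOn_chart_symm (I := 𝓡 d) (n := (⊤ : ℕ∞))).of_le
      (by exact_mod_cast le_top))
  exact h1.contDiffAt (e.open_target.mem_nhds (e.map_source (cov.piece_subset i hx)))

/-- For a `C^r` function a `C^r` bound is a bound on its derivatives in the charts of the cover. -/
theorem crLe_iff (hu : ContMDiff (𝓡 d) 𝓘(ℝ, ℝ) r u) (hK : 0 ≤ K) :
    CrLe cov r u K ↔ ∀ (i : Fin cov.N) (k : ℕ), k ≤ r → ∀ x ∈ cov.piece i,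
      ‖iteratedFDeriv ℝ k (u ∘ (chartAt (EuclideanSpace ℝ (Fin d)) (cov.center i)).symm)
        (chartAt (EuclideanSpace ℝ (Fin d)) (cov.center i) x)‖ ≤ K := by
  have h1 : CrLe cov r u K ↔ crENorm cov r u ≤ ENNReal.ofReal K := by
    rw [CrLe, and_iff_right hu, crNorm,
      ← ENNReal.ofReal_le_ofReal_iff hK, ENNReal.ofReal_toReal (crENorm_lt_top cov r hu).ne]
  rw [h1, crENorm]
  simp only [iSup_le_iff]
  constructor
  · intro h i k hk x hx
    have := h i ⟨k, Nat.lt_succ_of_le hk⟩ x hx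
    rwa [← ofReal_norm, ENNReal.ofReal_le_ofReal_iff hK] at this
  · intro h i k x hx
    rw [← ofReal_norm]
    exact ENNReal.ofReal_le_ofReal (h i k (Nat.lt_succ_iff.1 k.2) x hx)

theorem CrLe.bound (h : CrLe cov r u K) (i : Fin cov.N) {k : ℕ} (hk : k ≤ r) {x : M}
    (hx : x ∈ cov.piece i) :
    ‖iteratedFDeriv ℝ k (u ∘ (chartAt (EuclideanSpace ℝ (Fin d)) (cov.center i)).symm)
      (chartAt (EuclideanSpace ℝ (Fin d)) (cov.center i) x)‖ ≤ K :=
  (crLe_iff h.1 h.nonneg).1 h i k hk x hx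

theorem CrLe.abs_le (h : CrLe cov r u K) (x : M) : |u x| ≤ K := by
  have hx : x ∈ ⋃ i, cov.piece i := by rw [cov.iUnion_piece]; trivial
  obtain ⟨i, hi⟩ := Set.mem_iUnion.1 hx
  have := h.bound i (Nat.zero_le r) hi
  rwa [norm_iteratedFDeriv_zero, Function.comp_apply,
    OpenPartialHomeomorph.left_inv _ (cov.piece_subset i hi), Real.norm_eq_abs] at this

theorem CrLe.norm_le [CompactSpace M] {φ : C(M, ℝ)} (h : CrLe cov r φ K) : ‖φ‖ ≤ K :=
  (ContinuousMap.norm_le _ h.nonneg).2 fun x => h.abs_le x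

theorem CrLe.of_le {s : ℕ} (h : CrLe cov r u K) (hs : s ≤ r) : CrLe cov s u K :=
  (crLe_iff (h.1.of_le (by exact_mod_cast hs)) h.nonneg).2
    fun i _ hk _ hx => h.bound i (hk.trans hs) hx

theorem CrLe.add (hu : CrLe cov r u K) (hv : CrLe cov r v K') : CrLe cov r (u + v) (K + K') := by
  refine (crLe_iff (hu.1.add hv.1) (add_nonneg hu.nonneg hv.nonneg)).2 fun i k hk x hx => ?_
  have hk' : ((k : ℕ) : WithTop ℕ∞) ≤ r := by exact_mod_cast hk
  have h1 := (contDiffAt_comp_chart_symm hu.1 i hx).of_le hk'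
  have h2 := (contDiffAt_comp_chart_symm hv.1 i hx).of_le hk'
  have h3 := iteratedFDeriv_add_apply h1 h2
  have h4 : (u + v) ∘ (chartAt (EuclideanSpace ℝ (Fin d)) (cov.center i)).symm
    = u ∘ (chartAt (EuclideanSpace ℝ (Fin d)) (cov.center i)).symm
      + v ∘ (chartAt (EuclideanSpace ℝ (Fin d)) (cov.center i)).symm := rfl
  rw [h4, h3]
  exact (norm_add_le _ _).trans (add_le_add (hu.bound i hk hx) (hv.bound i hk hx))

theorem CrLe.smul (hu : CrLe cov r u K) (c : ℝ) : CrLe cov r (c • u) (|c| * K) := by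
  have hcu : ContMDiff (𝓡 d) 𝓘(ℝ, ℝ) r (c • u) := (contMDiff_const (c := c)).mul hu.1
  refine (crLe_iff hcu (mul_nonneg (abs_nonneg c) hu.nonneg)).2
    fun i k hk x hx => ?_
  have hk' : ((k : ℕ) : WithTop ℕ∞) ≤ r := by exact_mod_cast hk
  have h1 := (contDiffAt_comp_chart_symm hu.1 i hx).of_le hk'
  have h4 : (c • u) ∘ (chartAt (EuclideanSpace ℝ (Fin d)) (cov.center i)).symm
    = c • (u ∘ (chartAt (EuclideanSpace ℝ (Fin d)) (cov.center i)).symm) := rfl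
  rw [h4, iteratedFDeriv_const_smul_apply h1, norm_smul, Real.norm_eq_abs]
  exact mul_le_mul_of_nonneg_left (hu.bound i hk hx) (abs_nonneg c)

theorem CrLe.sub (hu : CrLe cov r u K) (hv : CrLe cov r v K') : CrLe cov r (u - v) (K + K') := by
  have := hu.add (hv.smul (-1))
  rwa [neg_one_smul, ← sub_eq_add_neg, abs_neg, abs_one, one_mul] at this

theorem crLe_const (c : ℝ) : CrLe cov r (fun _ : M => c) |c| := by
  refine (crLe_iff contMDiff_const (abs_nonneg c)).2 fun i k hk x hx => ?_
  have h4 : (fun _ : M => c) ∘ (chartAt (EuclideanSpace ℝ (Fin d)) (cov.center i)).symm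
    = fun _ => c := rfl
  rw [h4]
  rcases Nat.eq_zero_or_pos k with rfl | hk0
  · rw [norm_iteratedFDeriv_zero, Real.norm_eq_abs]
  · rw [iteratedFDeriv_const_of_ne hk0.ne']
    simp

theorem norm_iteratedFDeriv_mul_le_of_contDiffAt {E : Type*} [NormedAddCommGroup E]
    [NormedSpace ℝ E] {φ χ : E → ℝ} {x : E} {k : ℕ}
    (hφ : ContDiffAt ℝ k φ x) (hχ : ContDiffAt ℝ k χ x) :
    ‖iteratedFDeriv ℝ k (fun y => φ y * χ y) x‖ ≤ ∑ i ∈ Finset.range (k + 1),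
      (k.choose i : ℝ) * ‖iteratedFDeriv ℝ i φ x‖ * ‖iteratedFDeriv ℝ (k - i) χ x‖ := by
  obtain ⟨s, hs, hφs⟩ := hφ.contDiffOn (m := k) le_rfl (by simp)
  obtain ⟨t, ht, hχt⟩ := hχ.contDiffOn (m := k) le_rfl (by simp)
  obtain ⟨w, hw, hwo, hxw⟩ := mem_nhds_iff.1 (Filter.inter_mem hs ht)
  have key := norm_iteratedFDerivWithin_mul_le (hφs.mono (hw.trans Set.inter_subset_left))
    (hχt.mono (hw.trans Set.inter_subset_right)) hwo.uniqueDiffOn hxw (n := k) le_rfl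
  simpa only [iteratedFDerivWithin_of_isOpen _ hwo hxw] using key

theorem CrLe.mul (hu : CrLe cov r u K) (hv : CrLe cov r v K') :
    CrLe cov r (u * v) (2 ^ r * (K * K')) := by
  have hK := hu.nonneg
  have hK' := hv.nonneg
  refine (crLe_iff (hu.1.mul hv.1) (by positivity)).2 fun i k hk x hx => ?_
  have hk' : ((k : ℕ) : WithTop ℕ∞) ≤ r := by exact_mod_cast hk
  have h1 := (contDiffAt_comp_chart_symm hu.1 i hx).of_le hk'
  have h2 := (contDiffAt_comp_chart_symm hv.1 i hx).of_le hk'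
  refine (norm_iteratedFDeriv_mul_le_of_contDiffAt h1 h2).trans ?_
  calc _ ≤ ∑ j ∈ Finset.range (k + 1), (k.choose j : ℝ) * K * K' := by
        refine Finset.sum_le_sum fun j hj => ?_
        have hj' : j ≤ k := Nat.lt_succ_iff.1 (Finset.mem_range.1 hj)
        have ha := hu.bound i (hj'.trans hk) hx
        have hb := hv.bound i ((Nat.sub_le k j).trans hk) hx
        gcongr
    _ = 2 ^ k * (K * K') := by
        rw [← Finset.sum_mul, ← Finset.sum_mul, mul_assoc]
        congr 1
        exact_mod_cast Nat.sum_range_choose k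
    _ ≤ 2 ^ r * (K * K') := by
        gcongr
        norm_num

end CrLe

/-! ### Cocycles of maps and of transfer operators -/

section Cocycle

variable {Ω M : Type*}

theorem mapIter_add (σ : Ω → Ω) (T : Ω → M → M) (i j : ℕ) (ω : Ω) :
    mapIter σ T (i + j) ω = mapIter σ T i (σ^[j] ω) ∘ mapIter σ T j ω := by
  induction i with
  | zero => simp [mapIter]
  | succ i ih =>
    rw [Nat.succ_add, mapIter, ih, mapIter, ← Function.iterate_add_apply]
    rfl

theorem iterate_skewProduct (σ : Ω → Ω) (T : Ω → M → M) (n : ℕ) (p : Ω × M) :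
    (skewProduct σ T)^[n] p = (σ^[n] p.1, mapIter σ T n p.1 p.2) := by
  induction n with
  | zero => rfl
  | succ n ih =>
    rw [Function.iterate_succ_apply', ih, skewProduct, Function.iterate_succ_apply']
    rfl

theorem measurable_mapIter [MeasurableSpace M] {σ : Ω → Ω} {T : Ω → M → M}
    (hT : ∀ ω, Measurable (T ω)) (n : ℕ) (ω : Ω) : Measurable (mapIter σ T n ω) := by
  induction n with
  | zero => exact measurable_id
  | succ n ih => exact (hT _).comp ih

theorem measurable_iterate_skewProduct [MeasurableSpace Ω] [MeasurableSpace M] {σ : Ω → Ω}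
    (hσ : Measurable σ) {T : Ω → M → M} (hT : Measurable fun p : Ω × M => T p.1 p.2) (n : ℕ) :
    Measurable (skewProduct σ T)^[n] :=
  Measurable.iterate ((hσ.comp measurable_fst).prodMk hT) n

theorem iterate_symm_iterate (σ : Ω ≃ Ω) (ω : Ω) (j : ℕ) : σ^[j] (σ.symm^[j] ω) = ω :=
  (Function.LeftInverse.iterate (f := σ.symm) (g := σ) σ.apply_symm_apply j) ω

variable [TopologicalSpace M] [CompactSpace M]

theorem opIter_add (σ : Ω → Ω) (L : Ω → C(M, ℝ) →L[ℝ] C(M, ℝ)) (i j : ℕ) (ω : Ω) :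
    opIter σ L (i + j) ω = (opIter σ L i (σ^[j] ω)).comp (opIter σ L j ω) := by
  induction i with
  | zero => rw [Nat.zero_add]; rfl
  | succ i ih =>
    rw [Nat.succ_add, opIter, ih, opIter, ← Function.iterate_add_apply]
    rfl

theorem opIter_one (σ : Ω → Ω) (L : Ω → C(M, ℝ) →L[ℝ] C(M, ℝ)) (ω : Ω) :
    opIter σ L 1 ω = L ω := rfl

/-- The telescoping formula comparing two cocycles of operators. -/
theorem opIter_sub_opIter (σ : Ω → Ω) (L L' : Ω → C(M, ℝ) →L[ℝ] C(M, ℝ)) (n : ℕ) (ω : Ω)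
    (φ : C(M, ℝ)) :
    opIter σ L' n ω φ - opIter σ L n ω φ = ∑ k ∈ Finset.range n,
      opIter σ L (n - 1 - k) (σ^[k + 1] ω)
        ((L' (σ^[k] ω) - L (σ^[k] ω)) (opIter σ L' k ω φ)) := by
  induction n with
  | zero => simp [opIter]
  | succ n ih =>
    have h1 : ∀ k ∈ Finset.range n, opIter σ L (n + 1 - 1 - k) (σ^[k + 1] ω)
        ((L' (σ^[k] ω) - L (σ^[k] ω)) (opIter σ L' k ω φ))
        = L (σ^[n] ω) (opIter σ L (n - 1 - k) (σ^[k + 1] ω)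
        ((L' (σ^[k] ω) - L (σ^[k] ω)) (opIter σ L' k ω φ))) := by
      intro k hk
      have hk' := Finset.mem_range.1 hk
      obtain ⟨l, rfl⟩ : ∃ l, n = l + (k + 1) := ⟨n - (k + 1), by omega⟩
      have e1 : l + (k + 1) + 1 - 1 - k = l + 1 := by omega
      have e2 : l + (k + 1) - 1 - k = l := by omega
      rw [e1, e2, Function.iterate_add_apply σ l (k + 1)]
      rfl
    rw [Finset.sum_range_succ, Finset.sum_congr rfl h1, ← map_sum, ← ih]
    have e3 : n + 1 - 1 - n = 0 := by omega
    rw [e3]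
    simp only [opIter, ContinuousLinearMap.comp_apply, ContinuousLinearMap.id_apply, map_sub,
      sub_apply]
    abel

/-- The telescoping formula for the difference of two equivariant families, going `n` steps
back in time. -/
theorem equivariant_sub_eq (σ : Ω ≃ Ω) {L L' : Ω → C(M, ℝ) →L[ℝ] C(M, ℝ)}
    {h h' : Ω → C(M, ℝ)} {ω : Ω} (hh : ∀ n, L (σ.symm^[n] ω) (h (σ.symm^[n] ω))
      = h (σ (σ.symm^[n] ω)))
    (hh' : ∀ n, L' (σ.symm^[n] ω) (h' (σ.symm^[n] ω)) = h' (σ (σ.symm^[n] ω))) (n : ℕ) :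
    h' ω - h ω = opIter σ L n (σ.symm^[n] ω) (h' (σ.symm^[n] ω) - h (σ.symm^[n] ω))
      + ∑ j ∈ Finset.range n, opIter σ L j (σ.symm^[j] ω)
        ((L' (σ.symm^[j + 1] ω) - L (σ.symm^[j + 1] ω)) (h' (σ.symm^[j + 1] ω))) := by
  induction n with
  | zero => simp [opIter]
  | succ n ih =>
    have hs : σ (σ.symm^[n + 1] ω) = σ.symm^[n] ω := by
      rw [Function.iterate_succ_apply', Equiv.apply_symm_apply]
    have h1 := hh (n + 1)
    have h2 := hh' (n + 1)
    rw [hs] at h1 h2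
    rw [ih, Finset.sum_range_succ, opIter_add, Function.iterate_one, hs, opIter_one, ← h1, ← h2]
    simp only [ContinuousLinearMap.comp_apply, map_sub, sub_apply]
    abel

variable [MeasurableSpace M] {m : Measure M}

theorem integral_opIter_mul {σ : Ω → Ω} {T : Ω → M → M} {L : Ω → C(M, ℝ) →L[ℝ] C(M, ℝ)}
    (hT : ∀ ω, Measurable (T ω)) (hL : ∀ ω, IsTransferOperator m (T ω) (L ω)) (n : ℕ) (ω : Ω)
    (φ : C(M, ℝ)) {u : M → ℝ} (hu : Measurable u) (hb : ∃ b : ℝ, ∀ x, |u x| ≤ b) :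
    ∫ x, opIter σ L n ω φ x * u x ∂m = ∫ x, φ x * u (mapIter σ T n ω x) ∂m := by
  induction n generalizing u with
  | zero => rfl
  | succ n ih =>
    have h1 := hL (σ^[n] ω) (opIter σ L n ω φ) u hu hb
    have h2 := ih (hu.comp (hT (σ^[n] ω))) (hb.imp fun b h x => h _)
    exact h1.trans h2

theorem integral_opIter {σ : Ω → Ω} {T : Ω → M → M} {L : Ω → C(M, ℝ) →L[ℝ] C(M, ℝ)}
    (hT : ∀ ω, Measurable (T ω)) (hL : ∀ ω, IsTransferOperator m (T ω) (L ω)) (n : ℕ) (ω : Ω)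
    (φ : C(M, ℝ)) : ∫ x, opIter σ L n ω φ x ∂m = ∫ x, φ x ∂m := by
  simpa using integral_opIter_mul hT hL n ω φ (u := fun _ => 1) measurable_const ⟨1, by simp⟩

end Cocycle

/-! ### Integration of continuous functions -/

section Pairing

variable {M : Type*} [TopologicalSpace M] [CompactSpace M] [MeasurableSpace M] [BorelSpace M]
  {m : Measure M} [IsProbabilityMeasure m]

theorem integrable_continuousMap (φ : C(M, ℝ)) : Integrable φ m :=
  Integrable.of_bound φ.continuous.aestronglyMeasurable ‖φ‖
    (Eventually.of_forall fun x => φ.norm_coe_le_norm x)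

theorem integrable_continuousMap_mul (φ : C(M, ℝ)) {u : M → ℝ} (hu : Measurable u) {b : ℝ}
    (hb : ∀ x, |u x| ≤ b) : Integrable (fun x => φ x * u x) m :=
  (integrable_continuousMap φ).mul_bdd hu.aestronglyMeasurable (c := b)
    (Eventually.of_forall hb)

variable (m) in
/-- The bounded functional `φ ↦ ∫ v φ dm` on `C^0`. -/
noncomputable def pairing (v : C(M, ℝ)) : C(M, ℝ) →L[ℝ] ℝ :=
  LinearMap.mkContinuous
    { toFun := fun φ => ∫ x, v x * φ x ∂m
      map_add' := fun φ χ => by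
        simp only [ContinuousMap.add_apply, mul_add]
        exact integral_add (integrable_continuousMap (v * φ)) (integrable_continuousMap (v * χ))
      map_smul' := fun c φ => by
        simp only [ContinuousMap.smul_apply, smul_eq_mul, RingHom.id_apply]
        rw [← integral_const_mul]
        exact integral_congr_ae (Eventually.of_forall fun x => by simp only; ring) }
    ‖v‖ fun φ => by
      have h := norm_integral_le_of_norm_le_const (μ := m) (f := fun x => v x * φ x)
        (C := ‖v‖ * ‖φ‖) (Eventually.of_forall fun x => by
          rw [norm_mul]
          gcongr
          · exact v.norm_coe_le_norm x
          · exact φ.norm_coe_le_norm x)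
      simpa using h

theorem abs_pairing_le (v φ : C(M, ℝ)) : |pairing m v φ| ≤ ‖v‖ * ‖φ‖ :=
  (pairing m v).le_of_opNorm_le (LinearMap.mkContinuous_norm_le _ (norm_nonneg v) _) φ

end Pairing

/-! ### Elementary inequalities -/

section Inequalities

/-- A monomial of degree at most `8` in four numbers `≥ 1` is at most the sum of their eighth
powers. This reduces all integrability questions to that of a single function. -/
theorem monomial_le_sum_pow {a b c e : ℝ} (ha : 1 ≤ a) (hb : 1 ≤ b) (hc : 1 ≤ c) (he : 1 ≤ e)
    (i j k l : ℕ) (h : i + j + k + l ≤ 8) :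
    a ^ i * b ^ j * c ^ k * e ^ l ≤ a ^ 8 + b ^ 8 + c ^ 8 + e ^ 8 := by
  set s := max (max a b) (max c e) with hs
  have h1 : a ≤ s := (le_max_left _ _).trans (le_max_left _ _)
  have h2 : b ≤ s := (le_max_right _ _).trans (le_max_left _ _)
  have h3 : c ≤ s := (le_max_left _ _).trans (le_max_right _ _)
  have h4 : e ≤ s := (le_max_right _ _).trans (le_max_right _ _)
  have hs1 : 1 ≤ s := ha.trans h1
  calc a ^ i * b ^ j * c ^ k * e ^ l ≤ s ^ i * s ^ j * s ^ k * s ^ l := by gcongr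
    _ = s ^ (i + j + k + l) := by ring
    _ ≤ s ^ 8 := pow_le_pow_right₀ hs1 h
    _ ≤ a ^ 8 + b ^ 8 + c ^ 8 + e ^ 8 := by
        have ha8 : 0 ≤ a ^ 8 := by positivity
        have hb8 : 0 ≤ b ^ 8 := by positivity
        have hc8 : 0 ≤ c ^ 8 := by positivity
        have he8 : 0 ≤ e ^ 8 := by positivity
        rcases max_choice (max a b) (max c e) with h | h <;> rw [hs, h]
        · rcases max_choice a b with h | h <;> rw [h] <;> linarith
        · rcases max_choice c e with h | h <;> rw [h] <;> linarith

/-- Geometric interpolation between two bounds. -/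
theorem le_mul_sq_mul_sq {t C x y : ℝ} (ht : 0 ≤ t) (hC : 0 ≤ C)
    (h1 : t ≤ C * x ^ 6) (h2 : t ≤ C * y ^ 3) : t ≤ C * (x ^ 2 * y ^ 2) := by
  refine le_of_pow_le_pow_left₀ (n := 3) (by norm_num) (by positivity) ?_
  calc t ^ 3 = t * t ^ 2 := by ring
    _ ≤ (C * x ^ 6) * (C * y ^ 3) ^ 2 := by gcongr
    _ = (C * (x ^ 2 * y ^ 2)) ^ 3 := by ring

end Inequalities

/-! ### Linear response of the equivariant densities -/

section Operators

variable {M Ω : Type*} [TopologicalSpace M]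

/-- The difference quotient `ε⁻¹ (L_ε - L_0)` of the transfer operators. -/
noncomputable def deltaOp (L : ℝ → Ω → C(M, ℝ) →L[ℝ] C(M, ℝ)) (ε : ℝ) (ω : Ω) :
    C(M, ℝ) →L[ℝ] C(M, ℝ) :=
  (1 / ε) • (L ε ω - L 0 ω)

theorem deltaOp_apply (L : ℝ → Ω → C(M, ℝ) →L[ℝ] C(M, ℝ)) (ε : ℝ) (ω : Ω) (φ : C(M, ℝ)) :
    deltaOp L ε ω φ = (1 / ε) • (L ε ω φ - L 0 ω φ) := rfl

variable [CompactSpace M]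

/-- The `j`-th term of the linear response series of the densities: the effect at `ω` of the
perturbation of the operator at `σ^{-j-1} ω`. -/
noncomputable def responseTerm (σ : Ω ≃ Ω)
    (L : ℝ → Ω → C(M, ℝ) →L[ℝ] C(M, ℝ)) (h : ℝ → Ω → C(M, ℝ)) (ε : ℝ) (ω : Ω) (j : ℕ) : C(M, ℝ) :=
  opIter σ (L 0) j (σ.symm^[j] ω) (deltaOp L ε (σ.symm^[j + 1] ω) (h ε (σ.symm^[j + 1] ω)))

end Operators

section Response

variable {d : ℕ} {M : Type*} [TopologicalSpace M] [CompactSpace M]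
  [ChartedSpace (EuclideanSpace ℝ (Fin d)) M] [MeasurableSpace M] {Ω : Type*}

/-- The fibrewise hypotheses, on a `σ`-invariant set `G` of base points. All random constants
are replaced by one function `E ≥ 1`, and the weights `w n` are normalized so that `w n ^ 6` is the
rate of decay of correlations. The observable `F` and the densities `h` are viewed as continuous
functions, and `D` extends the derivative operator (arbitrarily) to all continuous functions. -/
structure ResponseSystem (cov : ChartCover d M) (m : Measure M) (σ : Ω ≃ Ω) (I : Set ℝ)
    (T : ℝ → Ω → M → M) (L : ℝ → Ω → C(M, ℝ) →L[ℝ] C(M, ℝ)) (h : ℝ → Ω → C(M, ℝ))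
    (F : Ω → C(M, ℝ)) (D : Ω → C(M, ℝ) → C(M, ℝ)) (E : Ω → ℝ) (w : ℕ → ℝ) (G : Set Ω) : Prop where
  mem_nhds : I ∈ 𝓝 0
  abs_le_one : ∀ ε ∈ I, |ε| ≤ 1
  one_le : ∀ ω, 1 ≤ E ω
  weight_pos : ∀ n, 0 < w n
  weight_le_one : ∀ n, w n ≤ 1
  summable_weight : Summable fun n => w n ^ 2
  map_mem : ∀ ω ∈ G, σ ω ∈ G
  symm_mem : ∀ ω ∈ G, σ.symm ω ∈ G
  summable_past : ∀ ω ∈ G, Summable fun n => w n ^ 2 * E (σ.symm^[n] ω) ^ 8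
  measurable_map : ∀ ε ∈ I, ∀ ω, Measurable (T ε ω)
  isTransferOperator : ∀ ε ∈ I, ∀ ω, IsTransferOperator m (T ε ω) (L ε ω)
  norm_iter : ∀ ω ∈ G, ∀ ε ∈ I, ∀ n φ, ‖opIter σ (L ε) n ω φ‖ ≤ E (σ^[n] ω) * ‖φ‖
  iter_one : ∀ ω ∈ G, ∀ ε ∈ I, ∀ n (φ : C(M, ℝ)) K, CrLe cov 1 φ K →
    CrLe cov 1 (opIter σ (L ε) n ω φ) (E (σ^[n] ω) * K)
  iter_three : ∀ ω ∈ G, ∀ ε ∈ I, ∀ n (φ : C(M, ℝ)) K, CrLe cov 3 φ K →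
    CrLe cov 3 (opIter σ (L ε) n ω φ) (E (σ^[n] ω) * K)
  decay : ∀ ω ∈ G, ∀ ε ∈ I, ∀ n (φ : C(M, ℝ)) K, CrLe cov 1 φ K → ∫ x, φ x ∂m = 0 →
    ‖opIter σ (L ε) n ω φ‖ ≤ E ω * w n ^ 6 * K
  deriv : ∀ ω ∈ G, ∀ ε ∈ I, ε ≠ 0 → ∀ (φ : C(M, ℝ)) K, CrLe cov 3 φ K →
    CrLe cov 1 ((1 / ε) • (L ε ω φ - L 0 ω φ) - D ω φ : C(M, ℝ)) (E ω * |ε| * K)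
  deriv_bound : ∀ ω ∈ G, ∀ (φ : C(M, ℝ)) K, CrLe cov 3 φ K → CrLe cov 1 (D ω φ) (E ω * K)
  equivariant : ∀ ω ∈ G, ∀ ε ∈ I, L ε ω (h ε ω) = h ε (σ ω)
  integral_density : ∀ ω ∈ G, ∀ ε ∈ I, ∫ x, h ε ω x ∂m = 1
  density : ∀ ω ∈ G, ∀ ε ∈ I, CrLe cov 3 (h ε ω) (E ω)
  observable : ∀ ω ∈ G, CrLe cov 3 (F ω) (E ω)

namespace ResponseSystem

variable {cov : ChartCover d M} {m : Measure M} {σ : Ω ≃ Ω} {I : Set ℝ}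
  {T : ℝ → Ω → M → M} {L : ℝ → Ω → C(M, ℝ) →L[ℝ] C(M, ℝ)} {h : ℝ → Ω → C(M, ℝ)}
  {F : Ω → C(M, ℝ)} {D : Ω → C(M, ℝ) → C(M, ℝ)} {E : Ω → ℝ} {w : ℕ → ℝ} {G : Set Ω}
  (S : ResponseSystem cov m σ I T L h F D E w G)
include S

theorem zero_mem : (0 : ℝ) ∈ I := mem_of_mem_nhds S.mem_nhds

theorem iterate_mem {ω : Ω} (hω : ω ∈ G) (n : ℕ) : σ^[n] ω ∈ G := by
  induction n with
  | zero => exact hω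
  | succ n ih => rw [Function.iterate_succ_apply']; exact S.map_mem _ ih

theorem symm_iterate_mem {ω : Ω} (hω : ω ∈ G) (n : ℕ) : σ.symm^[n] ω ∈ G := by
  induction n with
  | zero => exact hω
  | succ n ih => rw [Function.iterate_succ_apply']; exact S.symm_mem _ ih

theorem pos (ω : Ω) : 0 < E ω := one_pos.trans_le (S.one_le ω)

theorem eventually_mem : ∀ᶠ ε in 𝓝[≠] (0 : ℝ), ε ∈ I ∧ ε ≠ 0 :=
  Filter.inter_mem (mem_nhdsWithin_of_mem_nhds S.mem_nhds) self_mem_nhdsWithin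

theorem exists_Ioc_subset : ∃ η > 0, Set.Ioc 0 η ⊆ I := by
  obtain ⟨η, hη, hI⟩ := Metric.mem_nhds_iff.1 S.mem_nhds
  refine ⟨η / 2, by positivity, fun x hx => hI ?_⟩
  rw [Metric.mem_ball, dist_zero_right, Real.norm_eq_abs, abs_of_pos hx.1]
  linarith [hx.2]

theorem integral_iter {ε : ℝ} (hε : ε ∈ I) (n : ℕ) (ω : Ω) (φ : C(M, ℝ)) :
    ∫ x, opIter σ (L ε) n ω φ x ∂m = ∫ x, φ x ∂m :=
  integral_opIter (S.measurable_map ε hε) (S.isTransferOperator ε hε) n ω φ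

theorem iter_density {ε : ℝ} (hε : ε ∈ I) {ω : Ω} (hω : ω ∈ G) (n : ℕ) :
    opIter σ (L ε) n ω (h ε ω) = h ε (σ^[n] ω) := by
  induction n with
  | zero => rfl
  | succ n ih =>
    rw [opIter, ContinuousLinearMap.comp_apply, ih, S.equivariant _ (S.iterate_mem hω n) ε hε,
      Function.iterate_succ_apply']

theorem norm_op {ε : ℝ} (hε : ε ∈ I) {ω : Ω} (hω : ω ∈ G) (φ : C(M, ℝ)) :
    ‖L ε ω φ‖ ≤ E (σ ω) * ‖φ‖ := by
  simpa [opIter] using S.norm_iter ω hω ε hε 1 φ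

theorem norm_delta_le {ε : ℝ} (hε : ε ∈ I) {ω : Ω} (hω : ω ∈ G) (φ : C(M, ℝ)) :
    ‖deltaOp L ε ω φ‖ ≤ 2 * E (σ ω) * ‖φ‖ / |ε| := by
  rw [deltaOp_apply, norm_smul, norm_div, norm_one, Real.norm_eq_abs, div_mul_eq_mul_div, one_mul]
  gcongr
  calc _ ≤ ‖L ε ω φ‖ + ‖L 0 ω φ‖ := norm_sub_le _ _
    _ ≤ E (σ ω) * ‖φ‖ + E (σ ω) * ‖φ‖ :=
      add_le_add (S.norm_op hε hω φ) (S.norm_op S.zero_mem hω φ)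
    _ = 2 * E (σ ω) * ‖φ‖ := by ring

theorem weight_pow_le {a b : ℕ} (hab : a ≤ b) (n : ℕ) : w n ^ b ≤ w n ^ a :=
  pow_le_pow_of_le_one (S.weight_pos n).le (S.weight_le_one n) hab

theorem summable_past_succ {ω : Ω} (hω : ω ∈ G) : Summable fun j => 2 * (w j ^ 2 *
    (E (σ.symm^[j] ω) ^ 8 + E (σ.symm^[j + 1] ω) ^ 8)) := by
  have h1 := S.summable_past ω hω
  have h2 := S.summable_past _ (S.symm_mem ω hω)
  refine ((h1.add h2).mul_left 2).congr fun j => ?_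
  rw [Function.iterate_succ_apply]
  ring

theorem tendsto_past {ω : Ω} (hω : ω ∈ G) :
    Tendsto (fun n => w n ^ 6 * E (σ.symm^[n] ω) ^ 2) atTop (𝓝 0) := by
  refine squeeze_zero (fun n => ?_) (fun n => ?_) (S.summable_past ω hω).tendsto_atTop_zero
  · have := S.weight_pos n
    positivity
  · have h1 := S.weight_pow_le (a := 2) (b := 6) (by norm_num) n
    have h2 := pow_le_pow_right₀ (S.one_le (σ.symm^[n] ω)) (show 2 ≤ 8 by norm_num)
    have := S.weight_pos n
    gcongr

section Integral

variable [BorelSpace M] [IsProbabilityMeasure m]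

theorem integral_delta {ε : ℝ} (hε : ε ∈ I) (ω : Ω) (φ : C(M, ℝ)) :
    ∫ x, deltaOp L ε ω φ x ∂m = 0 := by
  have h1 := S.integral_iter hε 1 ω φ
  have h2 := S.integral_iter S.zero_mem 1 ω φ
  rw [opIter_one] at h1 h2
  simp only [deltaOp_apply, ContinuousMap.smul_apply, ContinuousMap.sub_apply, smul_eq_mul]
  rw [integral_const_mul, integral_sub (integrable_continuousMap _) (integrable_continuousMap _),
    h1, h2, sub_self, mul_zero]

theorem integral_responseTerm {ε : ℝ} (hε : ε ∈ I) (ω : Ω) (j : ℕ) :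
    ∫ x, responseTerm σ L h ε ω j x ∂m = 0 := by
  rw [responseTerm, S.integral_iter S.zero_mem, S.integral_delta hε]

end Integral

variable [IsManifold (𝓡 d) (⊤ : ℕ∞) M]

theorem delta_one {ε : ℝ} (hε : ε ∈ I) (hε0 : ε ≠ 0) {ω : Ω} (hω : ω ∈ G) {φ : C(M, ℝ)} {K : ℝ}
    (hφ : CrLe cov 3 φ K) : CrLe cov 1 (deltaOp L ε ω φ) (2 * E ω * K) := by
  have h1 := (S.deriv ω hω ε hε hε0 φ K hφ).add (S.deriv_bound ω hω φ K hφ)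
  have h2 : ⇑((1 / ε) • (L ε ω φ - L 0 ω φ) - D ω φ : C(M, ℝ)) + ⇑(D ω φ)
      = ⇑(deltaOp L ε ω φ) := by
    rw [← ContinuousMap.coe_add, sub_add_cancel]; rfl
  rw [h2] at h1
  refine h1.mono ?_
  have := mul_le_of_le_one_right (S.pos ω).le (S.abs_le_one ε hε)
  nlinarith [mul_le_mul_of_nonneg_right this hφ.nonneg]

/-- A bound for the difference quotients which trades the `C^0` norm of the function against its
`C^3` norm, uniformly in `ε`: difference quotients at scales below `η` are compared with the one at
scale `η`, through the derivative operator. -/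
theorem norm_delta_interpolation {ε η : ℝ} (hε : ε ∈ I) (hε0 : ε ≠ 0) (hη : η ∈ I) (hη0 : 0 < η)
    {ω : Ω} (hω : ω ∈ G) {φ : C(M, ℝ)} {K : ℝ} (hφ : CrLe cov 3 φ K) :
    ‖deltaOp L ε ω φ‖ ≤ 2 * E ω * η * K + 2 * E (σ ω) * ‖φ‖ / η := by
  have hE := (S.pos ω).le
  have hE' := (S.pos (σ ω)).le
  have hK := hφ.nonneg
  have h0 := S.norm_delta_le hη hω φ
  rw [abs_of_pos hη0] at h0
  rcases le_total η |ε| with hle | hle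
  · calc ‖deltaOp L ε ω φ‖ ≤ 2 * E (σ ω) * ‖φ‖ / |ε| := S.norm_delta_le hε hω φ
      _ ≤ 2 * E (σ ω) * ‖φ‖ / η := by gcongr
      _ ≤ _ := le_add_of_nonneg_left (by positivity)
  · have h1 := (S.deriv ω hω ε hε hε0 φ K hφ).norm_le
    have h2 := (S.deriv ω hω η hη hη0.ne' φ K hφ).norm_le
    rw [← deltaOp_apply] at h1 h2
    rw [abs_of_pos hη0] at h2
    have h3 : deltaOp L ε ω φ = (deltaOp L ε ω φ - D ω φ) - (deltaOp L η ω φ - D ω φ)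
      + deltaOp L η ω φ := by abel
    rw [h3]
    have h4 : E ω * |ε| * K ≤ E ω * η * K := by gcongr
    calc _ ≤ ‖deltaOp L ε ω φ - D ω φ‖ + ‖deltaOp L η ω φ - D ω φ‖ + ‖deltaOp L η ω φ‖ :=
          (norm_add_le _ _).trans (add_le_add_left (norm_sub_le _ _) _)
      _ ≤ _ := by linarith

/-- Difference quotients of `C^3`-bounded families that converge merely in `C^0` converge. -/
theorem tendsto_delta {ω : Ω} (hω : ω ∈ G) {φ : ℝ → C(M, ℝ)} {φ₀ : C(M, ℝ)} {K : ℝ}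
    (hφ : ∀ ε ∈ I, CrLe cov 3 (φ ε) K) (hφ₀ : CrLe cov 3 φ₀ K)
    (hlim : Tendsto φ (𝓝[≠] 0) (𝓝 φ₀)) :
    Tendsto (fun ε => deltaOp L ε ω (φ ε)) (𝓝[≠] 0) (𝓝 (D ω φ₀)) := by
  have hE := (S.pos ω).le
  have hK := hφ₀.nonneg
  have hid : Tendsto (fun ε : ℝ => ε) (𝓝[≠] 0) (𝓝 0) := tendsto_id.mono_left nhdsWithin_le_nhds
  have h1 : Tendsto (fun ε => deltaOp L ε ω φ₀ - D ω φ₀) (𝓝[≠] 0) (𝓝 0) := by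
    have hb : Tendsto (fun ε : ℝ => E ω * |ε| * K) (𝓝[≠] 0) (𝓝 0) := by
      simpa using (hid.abs.const_mul (E ω)).mul_const K
    refine squeeze_zero_norm' ?_ hb
    filter_upwards [S.eventually_mem] with ε hε
    exact (S.deriv ω hω ε hε.1 hε.2 φ₀ K hφ₀).norm_le
  have h2 : Tendsto (fun ε => deltaOp L ε ω (φ ε - φ₀)) (𝓝[≠] 0) (𝓝 0) := by
    rw [NormedAddGroup.tendsto_nhds_zero]
    intro δ hδ
    obtain ⟨η₀, hη₀, hsub⟩ := S.exists_Ioc_subset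
    obtain ⟨η, hη, hηI, hηδ⟩ : ∃ η > 0, η ∈ I ∧ 2 * E ω * η * (K + K) < δ / 2 := by
      have hpos : 0 < 4 * E ω * K + 1 := by positivity
      refine ⟨min η₀ (δ / 2 / (4 * E ω * K + 1)), by positivity,
        hsub ⟨by positivity, min_le_left _ _⟩, ?_⟩
      set η := min η₀ (δ / 2 / (4 * E ω * K + 1)) with hηdef
      have ha : 0 < η := by positivity
      have hb : η * (4 * E ω * K + 1) ≤ δ / 2 :=
        (le_div_iff₀ hpos).1 (min_le_right _ _)
      nlinarith
    have hlim' : Tendsto (fun ε => 2 * E (σ ω) * ‖φ ε - φ₀‖ / η) (𝓝[≠] 0) (𝓝 0) := by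
      have := (tendsto_iff_norm_sub_tendsto_zero.1 hlim).const_mul (2 * E (σ ω))
      simpa using this.div_const η
    filter_upwards [S.eventually_mem, hlim'.eventually_lt_const (half_pos hδ)] with ε hε hlt
    have := S.norm_delta_interpolation hε.1 hε.2 hηI hη hω ((hφ ε hε.1).sub hφ₀)
      (φ := φ ε - φ₀)
    linarith
  have h3 := (h2.add h1).add_const (D ω φ₀)
  rw [add_zero, zero_add] at h3
  refine h3.congr fun ε => ?_
  rw [map_sub]
  abel

theorem responseTerm_one {ε : ℝ} (hε : ε ∈ I) (hε0 : ε ≠ 0) {ω : Ω} (hω : ω ∈ G) (j : ℕ) :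
    CrLe cov 1 (responseTerm σ L h ε ω j) (2 * E ω * E (σ.symm^[j + 1] ω) ^ 2) := by
  have h1 := S.symm_iterate_mem hω (j + 1)
  have := S.iter_one _ (S.symm_iterate_mem hω j) 0 S.zero_mem j _ _
    (S.delta_one hε hε0 h1 (S.density _ h1 ε hε))
  rw [iterate_symm_iterate] at this
  exact this.mono (le_of_eq (by ring))

variable [BorelSpace M] [IsProbabilityMeasure m]

theorem norm_responseTerm {ε : ℝ} (hε : ε ∈ I) (hε0 : ε ≠ 0) {ω : Ω} (hω : ω ∈ G) (j : ℕ) :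
    ‖responseTerm σ L h ε ω j‖
      ≤ 2 * (E (σ.symm^[j] ω) * E (σ.symm^[j + 1] ω) ^ 2) * w j ^ 6 := by
  have h1 := S.symm_iterate_mem hω (j + 1)
  have := S.decay _ (S.symm_iterate_mem hω j) 0 S.zero_mem j _ _
    (S.delta_one hε hε0 h1 (S.density _ h1 ε hε)) (S.integral_delta hε _ _)
  exact this.trans (le_of_eq (by ring))

theorem norm_responseTerm_le {ε : ℝ} (hε : ε ∈ I) (hε0 : ε ≠ 0) {ω : Ω} (hω : ω ∈ G) (j : ℕ) :
    ‖responseTerm σ L h ε ω j‖ ≤ 2 * (w j ^ 2 *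
      (E (σ.symm^[j] ω) ^ 8 + E (σ.symm^[j + 1] ω) ^ 8)) := by
  refine (S.norm_responseTerm hε hε0 hω j).trans ?_
  have h1 := S.weight_pow_le (a := 2) (b := 6) (by norm_num) j
  have h2 := S.one_le (σ.symm^[j] ω)
  have h3 := S.one_le (σ.symm^[j + 1] ω)
  have h4 : E (σ.symm^[j] ω) * E (σ.symm^[j + 1] ω) ^ 2
      ≤ E (σ.symm^[j] ω) ^ 8 + E (σ.symm^[j + 1] ω) ^ 8 := by
    rcases le_total (E (σ.symm^[j] ω)) (E (σ.symm^[j + 1] ω)) with hle | hle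
    · calc _ ≤ E (σ.symm^[j + 1] ω) * E (σ.symm^[j + 1] ω) ^ 2 := by gcongr
        _ = E (σ.symm^[j + 1] ω) ^ 3 := by ring
        _ ≤ E (σ.symm^[j + 1] ω) ^ 8 := pow_le_pow_right₀ h3 (by norm_num)
        _ ≤ _ := le_add_of_nonneg_left (by positivity)
    · calc _ ≤ E (σ.symm^[j] ω) * E (σ.symm^[j] ω) ^ 2 := by gcongr
        _ = E (σ.symm^[j] ω) ^ 3 := by ring
        _ ≤ E (σ.symm^[j] ω) ^ 8 := pow_le_pow_right₀ h2 (by norm_num)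
        _ ≤ _ := le_add_of_nonneg_right (by positivity)
  have h5 : 0 ≤ w j ^ 6 := by have := S.weight_pos j; positivity
  have h6 := mul_le_mul h4 h1 h5 (by positivity)
  linarith

/-- The linear response series of the densities. -/
theorem hasSum_responseTerm {ε : ℝ} (hε : ε ∈ I) (hε0 : ε ≠ 0) {ω : Ω} (hω : ω ∈ G) :
    HasSum (responseTerm σ L h ε ω) ((1 / ε) • (h ε ω - h 0 ω)) := by
  have hsum : Summable (responseTerm σ L h ε ω) :=
    Summable.of_norm_bounded (S.summable_past_succ hω) (S.norm_responseTerm_le hε hε0 hω)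
  rw [hsum.hasSum_iff_tendsto_nat]
  have hrem : Tendsto (fun n => opIter σ (L 0) n (σ.symm^[n] ω)
      (h ε (σ.symm^[n] ω) - h 0 (σ.symm^[n] ω))) atTop (𝓝 0) := by
    have hb := (S.tendsto_past hω).const_mul 2
    rw [mul_zero] at hb
    refine squeeze_zero_norm (fun n => ?_) hb
    have hn := S.symm_iterate_mem hω n
    have h1 := (S.density _ hn ε hε).of_le (show 1 ≤ 3 by norm_num)
    have h2 := (S.density _ hn 0 S.zero_mem).of_le (show 1 ≤ 3 by norm_num)
    have h3 := S.decay _ hn 0 S.zero_mem n (h ε (σ.symm^[n] ω) - h 0 (σ.symm^[n] ω)) _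
      (h1.sub h2) (by
        simp only [ContinuousMap.sub_apply]
        rw [integral_sub (integrable_continuousMap _) (integrable_continuousMap _),
          S.integral_density _ hn ε hε, S.integral_density _ hn 0 S.zero_mem, sub_self])
    exact h3.trans (le_of_eq (by ring))
  have hlim := (hrem.const_sub (h ε ω - h 0 ω)).const_smul (1 / ε)
  rw [sub_zero] at hlim
  refine hlim.congr fun n => ?_
  rw [equivariant_sub_eq σ (fun n => S.equivariant _ (S.symm_iterate_mem hω n) 0 S.zero_mem)
    (fun n => S.equivariant _ (S.symm_iterate_mem hω n) ε hε) n, add_sub_cancel_left,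
    Finset.smul_sum]
  refine Finset.sum_congr rfl fun j _ => ?_
  rw [responseTerm, deltaOp, ← map_smul]
  rfl

theorem tendsto_density {ω : Ω} (hω : ω ∈ G) :
    Tendsto (fun ε => h ε ω) (𝓝[≠] 0) (𝓝 (h 0 ω)) := by
  rw [tendsto_iff_norm_sub_tendsto_zero]
  have hid : Tendsto (fun ε : ℝ => ε) (𝓝[≠] 0) (𝓝 0) := tendsto_id.mono_left nhdsWithin_le_nhds
  have hb := hid.abs.mul_const (∑' j, 2 * (w j ^ 2 *
    (E (σ.symm^[j] ω) ^ 8 + E (σ.symm^[j + 1] ω) ^ 8)))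
  rw [abs_zero, zero_mul] at hb
  refine squeeze_zero' (Eventually.of_forall fun _ => norm_nonneg _) ?_ hb
  filter_upwards [S.eventually_mem] with ε hε
  have h1 := S.hasSum_responseTerm hε.1 hε.2 hω
  have h2 := tsum_of_norm_bounded (S.summable_past_succ hω).hasSum
    (S.norm_responseTerm_le hε.1 hε.2 hω)
  rw [h1.tsum_eq, norm_smul, norm_div, norm_one, Real.norm_eq_abs, div_mul_eq_mul_div, one_mul,
    div_le_iff₀ (abs_pos.2 hε.2)] at h2
  rwa [mul_comm]

theorem tendsto_responseTerm {ω : Ω} (hω : ω ∈ G) (j : ℕ) :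
    Tendsto (fun ε => responseTerm σ L h ε ω j) (𝓝[≠] 0)
      (𝓝 (opIter σ (L 0) j (σ.symm^[j] ω) (D (σ.symm^[j + 1] ω) (h 0 (σ.symm^[j + 1] ω))))) := by
  have h1 := S.symm_iterate_mem hω (j + 1)
  exact ((opIter σ (L 0) j (σ.symm^[j] ω)).continuous.tendsto _).comp
    (S.tendsto_delta h1 (S.density _ h1) (S.density _ h1 0 S.zero_mem) (S.tendsto_density h1))

/-- The equivariant densities are limits of images of the constant `1` under the transfer
operators, hence nonnegative. -/
theorem density_nonneg {ε : ℝ} (hε : ε ∈ I) {ω : Ω} (hω : ω ∈ G) :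
    ∀ᵐ x ∂m, 0 ≤ h ε ω x := by
  refine ae_nonneg_of_forall_setIntegral_nonneg (integrable_continuousMap _) fun s hs _ => ?_
  set u : M → ℝ := s.indicator fun _ => 1 with hu
  have hum : Measurable u := measurable_const.indicator hs
  have hu0 : ∀ x, 0 ≤ u x := fun x => Set.indicator_nonneg (fun _ _ => zero_le_one) x
  have hu1 : ∀ x, |u x| ≤ 1 := fun x => by
    rw [abs_of_nonneg (hu0 x)]
    exact Set.indicator_le_self' (fun _ _ => zero_le_one) x |>.trans le_rfl
  have hint : ∫ x in s, h ε ω x ∂m = ∫ x, h ε ω x * u x ∂m := by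
    rw [← integral_indicator hs]
    refine integral_congr_ae (Eventually.of_forall fun x => ?_)
    by_cases hx : x ∈ s <;> simp [hu, hx]
  rw [hint]
  have hn : ∀ n : ℕ, -(2 * (w n ^ 6 * E (σ.symm^[n] ω) ^ 2)) ≤ ∫ x, h ε ω x * u x ∂m := by
    intro n
    have hGn := S.symm_iterate_mem hω n
    have hE := S.one_le (σ.symm^[n] ω)
    set φ : C(M, ℝ) := h ε (σ.symm^[n] ω) - ContinuousMap.const M 1 with hφ
    have h1 : CrLe cov 1 φ (E (σ.symm^[n] ω) + |1|) :=
      ((S.density _ hGn ε hε).of_le (show 1 ≤ 3 by norm_num)).sub (crLe_const 1)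
    have h2 : ∫ x, φ x ∂m = 0 := by
      simp only [hφ, ContinuousMap.sub_apply, ContinuousMap.const_apply]
      rw [integral_sub (integrable_continuousMap _) (integrable_const _),
        S.integral_density _ hGn ε hε]
      simp
    have h3 := S.decay _ hGn ε hε n φ _ h1 h2
    have h4 : ∫ x, h ε ω x * u x ∂m = ∫ x, opIter σ (L ε) n (σ.symm^[n] ω) φ x * u x ∂m
        + ∫ x, u (mapIter σ (T ε) n (σ.symm^[n] ω) x) ∂m := by
      have h5 : ∫ x, u (mapIter σ (T ε) n (σ.symm^[n] ω) x) ∂m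
          = ∫ x, opIter σ (L ε) n (σ.symm^[n] ω) (ContinuousMap.const M 1) x * u x ∂m := by
        rw [integral_opIter_mul (S.measurable_map ε hε) (S.isTransferOperator ε hε) _ _ _ hum
          ⟨1, hu1⟩]
        simp
      rw [h5, ← integral_add (integrable_continuousMap_mul _ hum hu1)
        (integrable_continuousMap_mul _ hum hu1)]
      refine integral_congr_ae (Eventually.of_forall fun x => ?_)
      simp only
      rw [← add_mul, ← ContinuousMap.add_apply, ← map_add, hφ, sub_add_cancel,
        S.iter_density hε hGn, iterate_symm_iterate]
    have h6 : 0 ≤ ∫ x, u (mapIter σ (T ε) n (σ.symm^[n] ω) x) ∂m :=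
      integral_nonneg fun x => hu0 _
    have h7 : |∫ x, opIter σ (L ε) n (σ.symm^[n] ω) φ x * u x ∂m|
        ≤ ‖opIter σ (L ε) n (σ.symm^[n] ω) φ‖ := by
      have := norm_integral_le_of_norm_le_const (μ := m)
        (f := fun x => opIter σ (L ε) n (σ.symm^[n] ω) φ x * u x)
        (C := ‖opIter σ (L ε) n (σ.symm^[n] ω) φ‖) (Eventually.of_forall fun x => by
          rw [norm_mul]
          exact (mul_le_of_le_one_right (norm_nonneg _) (hu1 x)).trans
            (ContinuousMap.norm_coe_le_norm _ x))
      simpa using this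
    have h8 : E (σ.symm^[n] ω) * w n ^ 6 * (E (σ.symm^[n] ω) + |1|)
        ≤ 2 * (w n ^ 6 * E (σ.symm^[n] ω) ^ 2) := by
      rw [abs_one]
      have := S.weight_pos n
      calc _ ≤ E (σ.symm^[n] ω) * w n ^ 6 * (E (σ.symm^[n] ω) + E (σ.symm^[n] ω)) := by gcongr
        _ = _ := by ring
    have h9 := neg_abs_le (∫ x, opIter σ (L ε) n (σ.symm^[n] ω) φ x * u x ∂m)
    linarith
  have hlim := ((S.tendsto_past hω).const_mul 2).neg
  rw [mul_zero, neg_zero] at hlim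
  exact le_of_tendsto' hlim hn

end ResponseSystem

end Response

/-! ### Linear response of the fibrewise correlations -/

section Correlations

variable {M Ω : Type*} [TopologicalSpace M] [CompactSpace M] [MeasurableSpace M] [BorelSpace M]
  (m : Measure M) [IsProbabilityMeasure m] (σ : Ω ≃ Ω)
  (L : ℝ → Ω → C(M, ℝ) →L[ℝ] C(M, ℝ)) (h : ℝ → Ω → C(M, ℝ)) (F : Ω → C(M, ℝ))

/-- The mean `∫ F_ω h_{ω,ε} dm` of the observable. -/
noncomputable def obsMean (ε : ℝ) (ω : Ω) : ℝ := pairing m (F ω) (h ε ω)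

/-- The centred observable times the density. -/
noncomputable def centredDensity (ε : ℝ) (ω : Ω) : C(M, ℝ) :=
  (F ω - ContinuousMap.const M (obsMean m h F ε ω)) * h ε ω

/-- The correlation at time `n` in the fibre over `ω`, in terms of transfer operators. -/
noncomputable def fibreCorr (ε : ℝ) (n : ℕ) (ω : Ω) : ℝ :=
  pairing m (F (σ^[n] ω)) (opIter σ (L ε) n ω (centredDensity m h F ε ω))

/-- The linear operator which maps the increment of the density to that of the centred density. -/
noncomputable def centredIncrement (ε : ℝ) (ω : Ω) : C(M, ℝ) →L[ℝ] C(M, ℝ) :=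
  ContinuousLinearMap.mul ℝ C(M, ℝ) (F ω - ContinuousMap.const M (obsMean m h F ε ω))
    - (pairing m (F ω)).smulRight (h 0 ω)

/-- The effect on the `n`-th correlation of the perturbation of the operator at time `k < n`. -/
noncomputable def operatorTerm (ε : ℝ) (n : ℕ) (ω : Ω) (k : ℕ) : ℝ :=
  pairing m (F (σ^[n] ω)) (opIter σ (L 0) (n - 1 - k) (σ^[k + 1] ω)
    (deltaOp L ε (σ^[k] ω) (opIter σ (L ε) k ω (centredDensity m h F ε ω))))

/-- The effect on the `n`-th correlation of the perturbation of the operator at time `-j-1`,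
through the initial density. -/
noncomputable def densityTerm (ε : ℝ) (n : ℕ) (ω : Ω) (j : ℕ) : ℝ :=
  pairing m (F (σ^[n] ω)) (opIter σ (L 0) n ω
    (centredIncrement m h F ε ω (responseTerm σ L h ε ω j)))

theorem centredIncrement_apply (ε : ℝ) (ω : Ω) (q : C(M, ℝ)) :
    centredIncrement m h F ε ω q = (F ω - ContinuousMap.const M (obsMean m h F ε ω)) * q
      - pairing m (F ω) q • h 0 ω := rfl

theorem centredIncrement_sub (ε : ℝ) (ω : Ω) :
    centredIncrement m h F ε ω (h ε ω - h 0 ω)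
      = centredDensity m h F ε ω - centredDensity m h F 0 ω := by
  rw [centredIncrement_apply, map_sub, centredDensity, centredDensity]
  ext x
  simp only [ContinuousMap.sub_apply, ContinuousMap.mul_apply, ContinuousMap.smul_apply,
    ContinuousMap.const_apply, smul_eq_mul, obsMean]
  ring

end Correlations

section Bounds

variable {Ω : Type*}

/-- The random factor in the bound for `densityTerm`. -/
noncomputable def densityBound (σ : Ω ≃ Ω) (E : Ω → ℝ) (n : ℕ) (ω : Ω)
    (j : ℕ) : ℝ :=
  E ω ^ 8 + E (σ^[n] ω) ^ 8 + E (σ.symm^[j] ω) ^ 8 + E (σ.symm^[j + 1] ω) ^ 8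

/-- The random factor in the bound for `operatorTerm`. -/
noncomputable def operatorBound (σ : Ω ≃ Ω) (E : Ω → ℝ) (n : ℕ) (ω : Ω)
    (k : ℕ) : ℝ :=
  E ω ^ 8 + E (σ^[n] ω) ^ 8 + E (σ^[k] ω) ^ 8 + E (σ^[k + 1] ω) ^ 8

/-- The majorant of the difference quotients of the `n`-th fibrewise correlation, up to a
constant factor. -/
noncomputable def slopeBound (σ : Ω ≃ Ω) (E : Ω → ℝ) (w : ℕ → ℝ) (n : ℕ)
    (ω : Ω) : ℝ :=
  ∑ k ∈ Finset.range n, operatorBound σ E n ω k * (w (n - 1 - k) ^ 2 * w k ^ 2)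
    + ∑' j, densityBound σ E n ω j * (w n ^ 2 * w j ^ 2)

theorem densityBound_nonneg (σ : Ω ≃ Ω) (E : Ω → ℝ) (n j : ℕ) (ω : Ω) :
    0 ≤ densityBound σ E n ω j := by
  have h : ∀ x : ℝ, 0 ≤ x ^ 8 := fun x => Even.pow_nonneg (by decide) x
  exact add_nonneg (add_nonneg (add_nonneg (h _) (h _)) (h _)) (h _)

theorem operatorBound_nonneg (σ : Ω ≃ Ω) (E : Ω → ℝ) (n k : ℕ) (ω : Ω) :
    0 ≤ operatorBound σ E n ω k := by
  have h : ∀ x : ℝ, 0 ≤ x ^ 8 := fun x => Even.pow_nonneg (by decide) x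
  exact add_nonneg (add_nonneg (add_nonneg (h _) (h _)) (h _)) (h _)

end Bounds

namespace ResponseSystem

variable {d : ℕ} {M : Type*} [TopologicalSpace M] [CompactSpace M]
  [ChartedSpace (EuclideanSpace ℝ (Fin d)) M] [MeasurableSpace M] {Ω : Type*}
  {cov : ChartCover d M} {m : Measure M} {σ : Ω ≃ Ω} {I : Set ℝ}
  {T : ℝ → Ω → M → M} {L : ℝ → Ω → C(M, ℝ) →L[ℝ] C(M, ℝ)} {h : ℝ → Ω → C(M, ℝ)}
  {F : Ω → C(M, ℝ)} {D : Ω → C(M, ℝ) → C(M, ℝ)} {E : Ω → ℝ} {w : ℕ → ℝ} {G : Set Ω}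
  (S : ResponseSystem cov m σ I T L h F D E w G)
include S

theorem summable_densityBound {ω : Ω} (hω : ω ∈ G) (n : ℕ) :
    Summable fun j => densityBound σ E n ω j * (w n ^ 2 * w j ^ 2) := by
  have h1 := S.summable_weight.mul_left (w n ^ 2 * (E ω ^ 8 + E (σ^[n] ω) ^ 8))
  have h2 := (S.summable_past_succ hω).mul_left (w n ^ 2 / 2)
  refine (h1.add h2).congr fun j => ?_
  rw [densityBound]
  ring

variable [BorelSpace M] [IsProbabilityMeasure m]

theorem integral_centredDensity {ε : ℝ} (hε : ε ∈ I) {ω : Ω} (hω : ω ∈ G) :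
    ∫ x, centredDensity m h F ε ω x ∂m = 0 := by
  have h1 : ∀ x, centredDensity m h F ε ω x
      = (F ω * h ε ω) x - obsMean m h F ε ω * h ε ω x := fun x => by
    simp only [centredDensity, ContinuousMap.sub_apply, ContinuousMap.mul_apply,
      ContinuousMap.const_apply]
    ring
  simp only [h1]
  rw [integral_sub (integrable_continuousMap _) ((integrable_continuousMap _).const_mul _),
    integral_const_mul, S.integral_density ω hω ε hε, mul_one, sub_eq_zero]
  rfl

theorem integral_centredIncrement {ε : ℝ} {ω : Ω} (hω : ω ∈ G) {q : C(M, ℝ)}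
    (hq : ∫ x, q x ∂m = 0) : ∫ x, centredIncrement m h F ε ω q x ∂m = 0 := by
  have h1 : ∀ x, centredIncrement m h F ε ω q x
      = (F ω * q) x - obsMean m h F ε ω * q x - pairing m (F ω) q * h 0 ω x := fun x => by
    simp only [centredIncrement_apply, ContinuousMap.sub_apply, ContinuousMap.mul_apply,
      ContinuousMap.const_apply, ContinuousMap.smul_apply, smul_eq_mul]
    ring
  simp only [h1]
  have i1 := integrable_continuousMap (m := m) (F ω * q)
  have i2 := (integrable_continuousMap (m := m) q).const_mul (obsMean m h F ε ω)
  have i3 := (integrable_continuousMap (m := m) (h 0 ω)).const_mul (pairing m (F ω) q)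
  have i4 : Integrable (fun x => (F ω * q) x - obsMean m h F ε ω * q x) m := i1.sub i2
  rw [integral_sub i4 i3, integral_sub i1 i2, integral_const_mul, integral_const_mul,
    S.integral_density ω hω 0 S.zero_mem, hq, mul_zero,
    mul_one, sub_zero, sub_eq_zero]
  rfl

variable [IsManifold (𝓡 d) (⊤ : ℕ∞) M]

theorem abs_obsMean_le {ε : ℝ} (hε : ε ∈ I) {ω : Ω} (hω : ω ∈ G) : |obsMean m h F ε ω| ≤ E ω := by
  have h1 : ∀ᵐ x ∂m, ‖F ω x * h ε ω x‖ ≤ E ω * h ε ω x := by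
    filter_upwards [S.density_nonneg hε hω] with x hx
    rw [norm_mul, Real.norm_of_nonneg hx]
    gcongr
    exact (S.observable ω hω).abs_le x
  have h2 := norm_integral_le_of_norm_le ((integrable_continuousMap (m := m) (h ε ω)).const_mul _)
    h1
  rwa [integral_const_mul, S.integral_density ω hω ε hε, mul_one] at h2

theorem centredObservable {ε : ℝ} (hε : ε ∈ I) {ω : Ω} (hω : ω ∈ G) :
    CrLe cov 3 (F ω - ContinuousMap.const M (obsMean m h F ε ω) : C(M, ℝ)) (2 * E ω) :=
  ((S.observable ω hω).sub (crLe_const (obsMean m h F ε ω))).mono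
    (by linarith [S.abs_obsMean_le hε hω])

theorem centredDensity_three {ε : ℝ} (hε : ε ∈ I) {ω : Ω} (hω : ω ∈ G) :
    CrLe cov 3 (centredDensity m h F ε ω) (16 * E ω ^ 2) :=
  ((S.centredObservable hε hω).mul (S.density ω hω ε hε)).mono (le_of_eq (by ring))

theorem norm_iter_centredDensity {ε : ℝ} (hε : ε ∈ I) {ω : Ω} (hω : ω ∈ G) (n : ℕ) :
    ‖opIter σ (L ε) n ω (centredDensity m h F ε ω)‖ ≤ 16 * E ω ^ 3 * w n ^ 6 :=
  (S.decay ω hω ε hε n _ _ ((S.centredDensity_three hε hω).of_le (by norm_num))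
    (S.integral_centredDensity hε hω)).trans (le_of_eq (by ring))

theorem abs_pairing_observable_le {ω : Ω} (hω : ω ∈ G) (φ : C(M, ℝ)) :
    |pairing m (F ω) φ| ≤ E ω * ‖φ‖ :=
  (abs_pairing_le _ _).trans (by gcongr; exact (S.observable ω hω).norm_le)

/-- Decay of the fibrewise correlations. -/
theorem abs_fibreCorr_le {ε : ℝ} (hε : ε ∈ I) {ω : Ω} (hω : ω ∈ G) (n : ℕ) :
    |fibreCorr m σ L h F ε n ω| ≤ 16 * (w n ^ 2 * (E ω ^ 8 + E (σ^[n] ω) ^ 8)) := by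
  have h0 := S.pos ω
  have hn := S.pos (σ^[n] ω)
  have hw := S.weight_pos n
  calc |fibreCorr m σ L h F ε n ω|
      ≤ E (σ^[n] ω) * (16 * E ω ^ 3 * w n ^ 6) :=
        (S.abs_pairing_observable_le (S.iterate_mem hω n) _).trans
          (by gcongr; exact S.norm_iter_centredDensity hε hω n)
    _ ≤ E (σ^[n] ω) * (16 * E ω ^ 3 * w n ^ 2) := by
        have := S.weight_pow_le (a := 2) (b := 6) (by norm_num) n
        gcongr
    _ = 16 * (w n ^ 2 * (E ω ^ 3 * E (σ^[n] ω))) := by ring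
    _ ≤ 16 * (w n ^ 2 * (E ω ^ 8 + E (σ^[n] ω) ^ 8)) := by
        gcongr
        have h1 := S.one_le ω
        have h2 := S.one_le (σ^[n] ω)
        rcases le_total (E ω) (E (σ^[n] ω)) with hle | hle
        · calc _ ≤ E (σ^[n] ω) ^ 3 * E (σ^[n] ω) := by gcongr
            _ = E (σ^[n] ω) ^ 4 := by ring
            _ ≤ E (σ^[n] ω) ^ 8 := pow_le_pow_right₀ h2 (by norm_num)
            _ ≤ _ := le_add_of_nonneg_left (by positivity)
        · calc _ ≤ E ω ^ 3 * E ω := by gcongr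
            _ = E ω ^ 4 := by ring
            _ ≤ E ω ^ 8 := pow_le_pow_right₀ h1 (by norm_num)
            _ ≤ _ := le_add_of_nonneg_right (by positivity)

/-! ### Bounds for the terms of the response series -/

theorem centredIncrement_one {ε : ℝ} (hε : ε ∈ I) {ω : Ω} (hω : ω ∈ G) {q : C(M, ℝ)} {K : ℝ}
    (hq : CrLe cov 1 q K) : CrLe cov 1 (centredIncrement m h F ε ω q) (5 * E ω ^ 2 * K) := by
  have h1 := ((S.centredObservable hε hω).of_le (show 1 ≤ 3 by norm_num)).mul hq
  have h2 := ((S.density ω hω 0 S.zero_mem).of_le (show 1 ≤ 3 by norm_num)).smul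
    (pairing m (F ω) q)
  have hE := S.one_le ω
  have hK := hq.nonneg
  have h3 : |pairing m (F ω) q| ≤ E ω * K :=
    (S.abs_pairing_observable_le hω q).trans (by gcongr; exact hq.norm_le)
  refine (h1.sub h2).mono ?_
  calc 2 ^ 1 * (2 * E ω * K) + |pairing m (F ω) q| * E ω
      ≤ 2 ^ 1 * (2 * E ω * K) + E ω * K * E ω := by gcongr
    _ = 4 * (E ω * 1) * K + E ω ^ 2 * K := by ring
    _ ≤ 4 * (E ω * E ω) * K + E ω ^ 2 * K := by gcongr
    _ = 5 * E ω ^ 2 * K := by ring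

theorem norm_centredIncrement_le {ε : ℝ} (hε : ε ∈ I) {ω : Ω} (hω : ω ∈ G) (q : C(M, ℝ)) :
    ‖centredIncrement m h F ε ω q‖ ≤ 3 * E ω ^ 2 * ‖q‖ := by
  have hE := S.one_le ω
  have h1 := (S.centredObservable hε hω).norm_le
  have h2 := (S.density ω hω 0 S.zero_mem).norm_le
  have h3 := S.abs_pairing_observable_le hω q
  rw [centredIncrement_apply]
  calc _ ≤ ‖F ω - ContinuousMap.const M (obsMean m h F ε ω)‖ * ‖q‖
        + |pairing m (F ω) q| * ‖h 0 ω‖ := (norm_sub_le _ _).trans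
          (add_le_add (norm_mul_le _ _) (by rw [norm_smul, Real.norm_eq_abs]))
    _ ≤ 2 * E ω * ‖q‖ + E ω * ‖q‖ * E ω := by gcongr
    _ = 2 * (E ω * 1) * ‖q‖ + E ω ^ 2 * ‖q‖ := by ring
    _ ≤ 2 * (E ω * E ω) * ‖q‖ + E ω ^ 2 * ‖q‖ := by gcongr
    _ = 3 * E ω ^ 2 * ‖q‖ := by ring

/-- Each term is bounded in two ways: by decay of correlations from time `0` to `n`, applied to a
`C^1` bound, and by decay from time `-j` to `0`, applied in `C^0`. -/
theorem abs_densityTerm_le {ε : ℝ} (hε : ε ∈ I) (hε0 : ε ≠ 0) {ω : Ω} (hω : ω ∈ G) (n j : ℕ) :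
    |densityTerm m σ L h F ε n ω j|
      ≤ 10 * densityBound σ E n ω j * (w n ^ 2 * w j ^ 2) := by
  have hn := S.iterate_mem hω n
  have p0 := S.one_le ω
  have pn := S.one_le (σ^[n] ω)
  have pj := S.one_le (σ.symm^[j] ω)
  have pj' := S.one_le (σ.symm^[j + 1] ω)
  have hwn := S.weight_pos n
  have hwj := S.weight_pos j
  have hY := densityBound_nonneg σ E n j ω
  have h0 := S.abs_pairing_observable_le hn
    (opIter σ (L 0) n ω (centredIncrement m h F ε ω (responseTerm σ L h ε ω j)))
  refine le_mul_sq_mul_sq (abs_nonneg _) (by positivity) ?_ ?_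
  · have h1 := S.decay ω hω 0 S.zero_mem n _ _
      (S.centredIncrement_one hε hω (S.responseTerm_one hε hε0 hω j))
      (S.integral_centredIncrement hω (S.integral_responseTerm hε ω j))
    have h2 := monomial_le_sum_pow p0 pn pj pj' 4 1 0 2 (by norm_num)
    calc _ ≤ E (σ^[n] ω) * (E ω * w n ^ 6
          * (5 * E ω ^ 2 * (2 * E ω * E (σ.symm^[j + 1] ω) ^ 2))) := h0.trans (by gcongr)
      _ = 10 * (E ω ^ 4 * E (σ^[n] ω) ^ 1 * E (σ.symm^[j] ω) ^ 0 * E (σ.symm^[j + 1] ω) ^ 2)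
          * w n ^ 6 := by ring
      _ ≤ 10 * densityBound σ E n ω j * w n ^ 6 := by unfold densityBound; gcongr
  · have h1 := S.norm_iter ω hω 0 S.zero_mem n
      (centredIncrement m h F ε ω (responseTerm σ L h ε ω j))
    have h2 := S.norm_centredIncrement_le hε hω (responseTerm σ L h ε ω j)
    have h3 := S.norm_responseTerm hε hε0 hω j
    have h4 := monomial_le_sum_pow p0 pn pj pj' 2 2 1 2 (by norm_num)
    calc _ ≤ E (σ^[n] ω) * (E (σ^[n] ω) * (3 * E ω ^ 2 *
          (2 * (E (σ.symm^[j] ω) * E (σ.symm^[j + 1] ω) ^ 2) * w j ^ 6))) :=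
          h0.trans (by gcongr; exact h1.trans (by gcongr; exact h2.trans (by gcongr)))
      _ = 6 * (E ω ^ 2 * E (σ^[n] ω) ^ 2 * E (σ.symm^[j] ω) ^ 1 * E (σ.symm^[j + 1] ω) ^ 2)
          * w j ^ 6 := by ring
      _ ≤ 10 * densityBound σ E n ω j * w j ^ 3 := by
          unfold densityBound
          have := S.weight_pow_le (a := 3) (b := 6) (by norm_num) j
          gcongr
          norm_num

/-- Each term is bounded in two ways: by decay of correlations from time `k + 1` to `n`, applied to
a `C^1` bound, and by decay from time `0` to `k`, which enters through the interpolation bound for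
the difference quotient with `η` proportional to `w k ^ 3`. -/
theorem exists_abs_operatorTerm_le : ∃ C, 0 ≤ C ∧ ∀ ε ∈ I, ε ≠ 0 → ∀ ω ∈ G, ∀ n, ∀ k < n,
    |operatorTerm m σ L h F ε n ω k|
      ≤ C * operatorBound σ E n ω k * (w (n - 1 - k) ^ 2 * w k ^ 2) := by
  obtain ⟨η₀, hη₀, hsub⟩ := S.exists_Ioc_subset
  have hη₁ : η₀ ≤ 1 := (le_abs_self _).trans (S.abs_le_one η₀ (hsub ⟨hη₀, le_rfl⟩))
  have hη₂ : 1 ≤ 1 / η₀ := by rw [le_div_iff₀ hη₀]; linarith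
  refine ⟨64 * (1 / η₀), by positivity, fun ε hε hε0 ω hω n k hk => ?_⟩
  obtain ⟨l, rfl⟩ : ∃ l, n = l + (k + 1) := ⟨n - (k + 1), by omega⟩
  have el : l + (k + 1) - 1 - k = l := by omega
  have hln : σ^[l] (σ^[k + 1] ω) = σ^[l + (k + 1)] ω := (Function.iterate_add_apply _ _ _ _).symm
  have hn := S.iterate_mem hω (l + (k + 1))
  have hk0 := S.iterate_mem hω k
  have hk1 := S.iterate_mem hω (k + 1)
  have hks : σ (σ^[k] ω) = σ^[k + 1] ω := (Function.iterate_succ_apply' _ _ _).symm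
  have p0 := S.one_le ω
  have pn := S.one_le (σ^[l + (k + 1)] ω)
  have pk := S.one_le (σ^[k] ω)
  have pk' := S.one_le (σ^[k + 1] ω)
  have hwl := S.weight_pos l
  have hwk := S.weight_pos k
  have hY := operatorBound_nonneg σ E (l + (k + 1)) k ω
  have hv3 := S.iter_three ω hω ε hε k _ _ (S.centredDensity_three hε hω)
  have hv0 := S.norm_iter_centredDensity hε hω k
  rw [operatorTerm, el]
  set v := opIter σ (L ε) k ω (centredDensity m h F ε ω) with hv
  have h0 := S.abs_pairing_observable_le hn
    (opIter σ (L 0) l (σ^[k + 1] ω) (deltaOp L ε (σ^[k] ω) v))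
  refine le_mul_sq_mul_sq (abs_nonneg _) (by positivity) ?_ ?_
  · have h1 := S.decay _ hk1 0 S.zero_mem l _ _ (S.delta_one hε hε0 hk0 hv3)
      (S.integral_delta hε _ _)
    have h2 := monomial_le_sum_pow p0 pn pk pk' 2 1 2 1 (by norm_num)
    calc _ ≤ E (σ^[l + (k + 1)] ω) * (E (σ^[k + 1] ω) * w l ^ 6
          * (2 * E (σ^[k] ω) * (E (σ^[k] ω) * (16 * E ω ^ 2)))) := h0.trans (by gcongr)
      _ = 32 * 1 * (E ω ^ 2 * E (σ^[l + (k + 1)] ω) ^ 1 * E (σ^[k] ω) ^ 2 * E (σ^[k + 1] ω) ^ 1)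
          * w l ^ 6 := by ring
      _ ≤ 64 * (1 / η₀) * operatorBound σ E (l + (k + 1)) ω k * w l ^ 6 := by
          unfold operatorBound
          gcongr
          norm_num
  · have hη : η₀ * w k ^ 3 ∈ I := hsub ⟨by positivity, mul_le_of_le_one_right hη₀.le
      (pow_le_one₀ hwk.le (S.weight_le_one k))⟩
    have h1 := S.norm_iter _ hk1 0 S.zero_mem l (deltaOp L ε (σ^[k] ω) v)
    have h2 := S.norm_delta_interpolation hε hε0 hη (by positivity) hk0 hv3
    rw [hks] at h2
    rw [hln] at h1
    have h3 := monomial_le_sum_pow p0 pn pk pk' 2 2 2 0 (by norm_num)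
    have h4 := monomial_le_sum_pow p0 pn pk pk' 3 2 0 1 (by norm_num)
    have h5 : 2 * E (σ^[k + 1] ω) * ‖v‖ / (η₀ * w k ^ 3)
        ≤ 1 / η₀ * (32 * E (σ^[k + 1] ω) * E ω ^ 3 * w k ^ 3) := by
      calc _ ≤ 2 * E (σ^[k + 1] ω) * (16 * E ω ^ 3 * w k ^ 6) / (η₀ * w k ^ 3) := by gcongr
        _ = _ := by field_simp; ring
    have h6 : 2 * E (σ^[k] ω) * (η₀ * w k ^ 3) * (E (σ^[k] ω) * (16 * E ω ^ 2))
        ≤ 1 / η₀ * (32 * E (σ^[k] ω) ^ 2 * E ω ^ 2 * w k ^ 3) := by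
      calc _ = η₀ * (32 * E (σ^[k] ω) ^ 2 * E ω ^ 2 * w k ^ 3) := by ring
        _ ≤ _ := by
          gcongr
          exact hη₁.trans hη₂
    calc _ ≤ E (σ^[l + (k + 1)] ω) * (E (σ^[l + (k + 1)] ω) *
          (1 / η₀ * (32 * E (σ^[k] ω) ^ 2 * E ω ^ 2 * w k ^ 3)
            + 1 / η₀ * (32 * E (σ^[k + 1] ω) * E ω ^ 3 * w k ^ 3))) :=
          h0.trans (by gcongr; exact h1.trans (by gcongr; exact h2.trans (add_le_add h6 h5)))
      _ = 32 * (1 / η₀) * (E ω ^ 2 * E (σ^[l + (k + 1)] ω) ^ 2 * E (σ^[k] ω) ^ 2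
            * E (σ^[k + 1] ω) ^ 0) * w k ^ 3
          + 32 * (1 / η₀) * (E ω ^ 3 * E (σ^[l + (k + 1)] ω) ^ 2 * E (σ^[k] ω) ^ 0
            * E (σ^[k + 1] ω) ^ 1) * w k ^ 3 := by ring
      _ ≤ 32 * (1 / η₀) * operatorBound σ E (l + (k + 1)) ω k * w k ^ 3
          + 32 * (1 / η₀) * operatorBound σ E (l + (k + 1)) ω k * w k ^ 3 := by
          unfold operatorBound
          gcongr
      _ = 64 * (1 / η₀) * operatorBound σ E (l + (k + 1)) ω k * w k ^ 3 := by ring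

/-! ### Convergence of the difference quotients in each fibre -/

theorem tendsto_obsMean {ω : Ω} (hω : ω ∈ G) :
    Tendsto (fun ε => obsMean m h F ε ω) (𝓝[≠] 0) (𝓝 (obsMean m h F 0 ω)) :=
  ((pairing m (F ω)).continuous.tendsto _).comp (S.tendsto_density hω)

theorem tendsto_centred {ω : Ω} (hω : ω ∈ G) :
    Tendsto (fun ε => F ω - ContinuousMap.const M (obsMean m h F ε ω)) (𝓝[≠] 0)
      (𝓝 (F ω - ContinuousMap.const M (obsMean m h F 0 ω))) :=
  ((ContinuousMap.continuous_const'.tendsto _).comp (S.tendsto_obsMean hω)).const_sub _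

theorem tendsto_centredDensity {ω : Ω} (hω : ω ∈ G) :
    Tendsto (fun ε => centredDensity m h F ε ω) (𝓝[≠] 0) (𝓝 (centredDensity m h F 0 ω)) :=
  (S.tendsto_centred hω).mul (S.tendsto_density hω)

theorem tendsto_iter_centredDensity {ω : Ω} (hω : ω ∈ G) (k : ℕ) :
    Tendsto (fun ε => opIter σ (L ε) k ω (centredDensity m h F ε ω)) (𝓝[≠] 0)
      (𝓝 (opIter σ (L 0) k ω (centredDensity m h F 0 ω))) := by
  induction k with
  | zero => exact S.tendsto_centredDensity hω
  | succ k ih =>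
    have hid : Tendsto (fun ε : ℝ => ε) (𝓝[≠] 0) (𝓝 0) :=
      tendsto_id.mono_left nhdsWithin_le_nhds
    have h1 := S.tendsto_delta (S.iterate_mem hω k)
      (fun ε hε => S.iter_three ω hω ε hε k _ _ (S.centredDensity_three hε hω))
      (S.iter_three ω hω 0 S.zero_mem k _ _ (S.centredDensity_three S.zero_mem hω)) ih
    have h2 := (((L 0 (σ^[k] ω)).continuous.tendsto _).comp ih).add (hid.smul h1)
    rw [zero_smul, add_zero] at h2
    refine h2.congr' ?_
    filter_upwards [self_mem_nhdsWithin] with ε hε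
    have hε' : ε ≠ 0 := hε
    simp only [opIter, ContinuousLinearMap.comp_apply, Function.comp_apply, deltaOp_apply,
      smul_smul]
    rw [mul_one_div_cancel hε', one_smul]
    abel

theorem exists_tendsto_operatorTerm {ω : Ω} (hω : ω ∈ G) (n k : ℕ) :
    ∃ l, Tendsto (fun ε => operatorTerm m σ L h F ε n ω k) (𝓝[≠] 0) (𝓝 l) := by
  have h1 := S.tendsto_delta (S.iterate_mem hω k)
    (fun ε hε => S.iter_three ω hω ε hε k _ _ (S.centredDensity_three hε hω))
    (S.iter_three ω hω 0 S.zero_mem k _ _ (S.centredDensity_three S.zero_mem hω))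
    (S.tendsto_iter_centredDensity hω k)
  exact ⟨_, (((pairing m (F (σ^[n] ω))).continuous.comp
    (opIter σ (L 0) (n - 1 - k) (σ^[k + 1] ω)).continuous).tendsto _).comp h1⟩

theorem exists_tendsto_densityTerm {ω : Ω} (hω : ω ∈ G) (n j : ℕ) :
    ∃ l, Tendsto (fun ε => densityTerm m σ L h F ε n ω j) (𝓝[≠] 0) (𝓝 l) := by
  have h1 := S.tendsto_responseTerm hω j
  have h2 := ((S.tendsto_centred hω).mul h1).sub
    ((((pairing m (F ω)).continuous.tendsto _).comp h1).smul_const (h 0 ω))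
  exact ⟨_, (((pairing m (F (σ^[n] ω))).continuous.comp
    (opIter σ (L 0) n ω).continuous).tendsto _).comp h2⟩

theorem hasSum_densityTerm {ε : ℝ} (hε : ε ∈ I) (hε0 : ε ≠ 0) {ω : Ω} (hω : ω ∈ G) (n : ℕ) :
    HasSum (densityTerm m σ L h F ε n ω) ((1 / ε) * pairing m (F (σ^[n] ω))
      (opIter σ (L 0) n ω (centredDensity m h F ε ω - centredDensity m h F 0 ω))) := by
  have h1 := ((pairing m (F (σ^[n] ω))).comp ((opIter σ (L 0) n ω).comp
    (centredIncrement m h F ε ω))).hasSum (S.hasSum_responseTerm hε hε0 hω)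
  rw [map_smul, ContinuousLinearMap.comp_apply, ContinuousLinearMap.comp_apply,
    centredIncrement_sub] at h1
  exact h1

/-- The difference quotient of a fibrewise correlation, as the sum of the effects of the
perturbations at all times before `n`. -/
theorem slope_fibreCorr {ε : ℝ} (hε : ε ∈ I) (hε0 : ε ≠ 0) {ω : Ω} (hω : ω ∈ G) (n : ℕ) :
    (1 / ε) * (fibreCorr m σ L h F ε n ω - fibreCorr m σ L h F 0 n ω)
      = ∑ k ∈ Finset.range n, operatorTerm m σ L h F ε n ω k
        + ∑' j, densityTerm m σ L h F ε n ω j := by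
  have h1 : ∑ k ∈ Finset.range n, operatorTerm m σ L h F ε n ω k
      = (1 / ε) * pairing m (F (σ^[n] ω)) (opIter σ (L ε) n ω (centredDensity m h F ε ω)
        - opIter σ (L 0) n ω (centredDensity m h F ε ω)) := by
    rw [opIter_sub_opIter, map_sum, Finset.mul_sum]
    refine Finset.sum_congr rfl fun k _ => ?_
    rw [operatorTerm, deltaOp, smul_apply, map_smul, map_smul, smul_eq_mul]
  rw [(S.hasSum_densityTerm hε hε0 hω n).tsum_eq, h1, ← mul_add, ← map_add, fibreCorr, fibreCorr,
    ← map_sub, map_sub (opIter σ (L 0) n ω), sub_add_sub_cancel]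

theorem exists_abs_slope_fibreCorr_le : ∃ C, ∀ ε ∈ I, ε ≠ 0 → ∀ ω ∈ G, ∀ n,
    |(1 / ε) * (fibreCorr m σ L h F ε n ω - fibreCorr m σ L h F 0 n ω)|
      ≤ C * slopeBound σ E w n ω := by
  obtain ⟨C, hC, hbound⟩ := S.exists_abs_operatorTerm_le
  refine ⟨C + 10, fun ε hε hε0 ω hω n => ?_⟩
  rw [S.slope_fibreCorr hε hε0 hω, slopeBound, mul_add]
  refine (abs_add_le _ _).trans (add_le_add ?_ ?_)
  · rw [Finset.mul_sum]
    refine (Finset.abs_sum_le_sum_abs _ _).trans (Finset.sum_le_sum fun k hk => ?_)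
    refine (hbound ε hε hε0 ω hω n k (Finset.mem_range.1 hk)).trans ?_
    rw [← mul_assoc (C + 10)]
    have := operatorBound_nonneg σ E n k ω
    gcongr
    linarith
  · have hs := (S.summable_densityBound hω n).mul_left (C + 10)
    rw [← tsum_mul_left, ← Real.norm_eq_abs]
    refine tsum_of_norm_bounded hs.hasSum fun j => ?_
    refine (S.abs_densityTerm_le hε hε0 hω n j).trans ?_
    rw [← mul_assoc (C + 10)]
    have := densityBound_nonneg σ E n j ω
    gcongr
    linarith

theorem exists_tendsto_slope_fibreCorr {ω : Ω} (hω : ω ∈ G) (n : ℕ) :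
    ∃ l, Tendsto (fun ε => (1 / ε) * (fibreCorr m σ L h F ε n ω - fibreCorr m σ L h F 0 n ω))
      (𝓝[≠] 0) (𝓝 l) := by
  choose a ha using S.exists_tendsto_operatorTerm hω n
  choose b hb using S.exists_tendsto_densityTerm hω n
  have h1 : Tendsto (fun ε => ∑' j, densityTerm m σ L h F ε n ω j) (𝓝[≠] 0) (𝓝 (∑' j, b j)) := by
    refine tendsto_tsum_of_dominated_convergence ((S.summable_densityBound hω n).mul_left 10) hb ?_
    filter_upwards [S.eventually_mem] with ε hε j
    rw [← mul_assoc]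
    exact S.abs_densityTerm_le hε.1 hε.2 hω n j
  refine ⟨_, ((tendsto_finsetSum (Finset.range n) fun k _ => ha k).add h1).congr' ?_⟩
  filter_upwards [S.eventually_mem] with ε hε
  exact (S.slope_fibreCorr hε.1 hε.2 hω n).symm

end ResponseSystem

/-! ### Integration over the base -/

section SummableIntegrals

variable {Ω : Type*} [MeasurableSpace Ω] {P : Measure Ω} {f : ℕ → Ω → ℝ}

theorem tsum_lintegral_enorm_lt_top (hf : ∀ n, Integrable (f n) P)
    (hs : Summable fun n => ∫ ω, ‖f n ω‖ ∂P) : ∫⁻ ω, ∑' n, ‖f n ω‖ₑ ∂P < ⊤ := by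
  rw [lintegral_tsum fun n => (hf n).1.enorm]
  simp only [← ofReal_integral_norm_eq_lintegral_enorm (hf _)]
  exact hs.tsum_ofReal_lt_top

theorem ae_summable_of_summable_integral (hf : ∀ n, Integrable (f n) P)
    (hs : Summable fun n => ∫ ω, ‖f n ω‖ ∂P) : ∀ᵐ ω ∂P, Summable fun n => ‖f n ω‖ := by
  filter_upwards [ae_lt_top' (AEMeasurable.tsum fun n => (hf n).1.enorm)
    (tsum_lintegral_enorm_lt_top hf hs).ne] with ω hω
  have := ENNReal.tsum_coe_ne_top_iff_summable.1 hω.ne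
  exact NNReal.summable_coe.2 this

theorem integrable_tsum_of_summable_integral (hf : ∀ n, Integrable (f n) P)
    (hs : Summable fun n => ∫ ω, ‖f n ω‖ ∂P) : Integrable (fun ω => ∑' n, f n ω) P := by
  have hae := ae_summable_of_summable_integral hf hs
  refine ⟨aestronglyMeasurable_of_tendsto_ae (u := atTop)
    (f := fun N ω => ∑ n ∈ Finset.range N, f n ω)
    (fun N => (integrable_finsetSum _ fun n _ => hf n).1) ?_, ?_⟩
  · filter_upwards [hae] with ω hω
    exact hω.of_norm.hasSum.tendsto_sum_nat
  · exact lt_of_le_of_lt (lintegral_mono fun ω => enorm_tsum_le_tsum_enorm)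
      (tsum_lintegral_enorm_lt_top hf hs)

end SummableIntegrals

/-! ### Averages of correlation sums -/

section Averages

/-- The average along `n` steps of a sequence. -/
noncomputable def avg (u : ℕ → ℝ) (n : ℕ) : ℝ := (1 / (n : ℝ)) * ∑ i ∈ Finset.range n, u i

theorem sum_sum_eq_of_symm {Q : ℕ → ℕ → ℝ} (hQ : ∀ i j, Q i j = Q j i) (n : ℕ) :
    ∑ i ∈ Finset.range n, ∑ j ∈ Finset.range n, Q i j
      = ∑ i ∈ Finset.range n, (Q i i + 2 * ∑ k ∈ Finset.range (n - 1 - i), Q i (i + (k + 1))) := by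
  induction n with
  | zero => simp
  | succ n ih =>
    have h1 : ∀ i ∈ Finset.range n,
        Q i i + 2 * ∑ k ∈ Finset.range (n + 1 - 1 - i), Q i (i + (k + 1))
        = (Q i i + 2 * ∑ k ∈ Finset.range (n - 1 - i), Q i (i + (k + 1))) + 2 * Q i n := by
      intro i hi
      have hi' := Finset.mem_range.1 hi
      have e1 : n + 1 - 1 - i = (n - 1 - i) + 1 := by omega
      have e2 : i + (n - 1 - i + 1) = n := by omega
      rw [e1, Finset.sum_range_succ, e2]
      ring
    have e3 : n + 1 - 1 - n = 0 := by omega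
    rw [Finset.sum_range_succ, Finset.sum_range_succ
      (fun i => Q i i + 2 * ∑ k ∈ Finset.range (n + 1 - 1 - i), Q i (i + (k + 1))) n,
      Finset.sum_congr rfl h1, e3,
      Finset.sum_add_distrib, ← ih, ← Finset.mul_sum]
    simp only [Finset.sum_range_succ _ n, Finset.sum_add_distrib, Finset.range_zero,
      Finset.sum_empty]
    rw [Finset.sum_congr rfl fun j _ => hQ n j]
    ring

theorem tendsto_avg_shift {u : ℕ → ℝ} {c : ℝ} (hu : Tendsto (avg u) atTop (𝓝 c)) (N : ℕ) :
    Tendsto (fun n : ℕ => (1 / (n : ℝ)) * ∑ i ∈ Finset.range (n - N), u i) atTop (𝓝 c) := by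
  rw [← tendsto_add_atTop_iff_nat N]
  have h1 := (tendsto_natCast_div_add_atTop (𝕜 := ℝ) (N : ℝ)).mul hu
  rw [one_mul] at h1
  refine h1.congr' ?_
  filter_upwards [eventually_gt_atTop 0] with n hn
  have hn' : (n : ℝ) ≠ 0 := by exact_mod_cast hn.ne'
  rw [avg, Nat.add_sub_cancel, Nat.cast_add]
  field_simp

/-- Truncating the inner sums at the time horizon `n` does not change the limit of the averages:
the truncation error at time `i` is at most the tail of order `n - i`, which is small on average
except for the last few `i`. -/
theorem tendsto_avg_truncated {b : ℕ → ℕ → ℝ} (hb : ∀ i, Summable fun k => |b k i|) {c : ℝ}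
    (hc : Tendsto (avg fun i => b 0 i + 2 * ∑' k, b (k + 1) i) atTop (𝓝 c)) {ρ : ℕ → ℝ}
    (hρ : ∀ N, Tendsto (avg fun i => ∑' k, |b (k + N) i|) atTop (𝓝 (ρ N)))
    (hρ0 : Tendsto ρ atTop (𝓝 0)) :
    Tendsto (fun n : ℕ => (1 / (n : ℝ)) * ∑ i ∈ Finset.range n,
      (b 0 i + 2 * ∑ k ∈ Finset.range (n - 1 - i), b (k + 1) i)) atTop (𝓝 c) := by
  set R : ℕ → ℕ → ℝ := fun N i => ∑' k, |b (k + N) i| with hR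
  have hsum : ∀ N i, Summable fun k => |b (k + N) i| := fun N i =>
    (summable_nat_add_iff N).2 (hb i)
  have hRnn : ∀ N i, 0 ≤ R N i := fun N i => tsum_nonneg fun k => abs_nonneg _
  have hRanti : ∀ i N N', N ≤ N' → R N' i ≤ R N i := by
    intro i N N' hNN'
    obtain ⟨l, rfl⟩ := Nat.exists_eq_add_of_le hNN'
    have := (hsum N i).sum_add_tsum_nat_add l
    have h1 : R (N + l) i = ∑' k, |b (k + l + N) i| := tsum_congr fun k => by
      rw [show k + (N + l) = k + l + N by ring]
    rw [h1, hR]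
    simp only
    rw [← this]
    exact le_add_of_nonneg_left (Finset.sum_nonneg fun _ _ => abs_nonneg _)
  have herr : ∀ n i, i < n →
      |(b 0 i + 2 * ∑' k, b (k + 1) i)
        - (b 0 i + 2 * ∑ k ∈ Finset.range (n - 1 - i), b (k + 1) i)| ≤ 2 * R (n - i) i := by
    intro n i hi
    have h1 : Summable fun k => b (k + 1) i := (hsum 1 i).of_abs
    rw [← h1.sum_add_tsum_nat_add (n - 1 - i)]
    have h2 : ∀ x y z : ℝ, x + 2 * (y + z) - (x + 2 * y) = 2 * z := fun x y z => by ring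
    rw [h2, abs_mul, abs_two]
    gcongr
    rw [← Real.norm_eq_abs]
    refine tsum_of_norm_bounded (hsum (n - i) i).hasSum fun k => ?_
    rw [show k + (n - i) = k + (n - 1 - i) + 1 by omega, Real.norm_eq_abs]
  have hdiff : Tendsto (fun n : ℕ => avg (fun i => b 0 i + 2 * ∑' k, b (k + 1) i) n
      - (1 / (n : ℝ)) * ∑ i ∈ Finset.range n,
      (b 0 i + 2 * ∑ k ∈ Finset.range (n - 1 - i), b (k + 1) i)) atTop (𝓝 0) := by
    rw [NormedAddGroup.tendsto_nhds_zero]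
    intro δ hδ
    obtain ⟨N, hN⟩ := (hρ0.eventually_lt_const (half_pos hδ)).exists
    have hlim : Tendsto (fun n : ℕ => 2 * (avg (R N) n + (avg (R 1) n
        - (1 / (n : ℝ)) * ∑ i ∈ Finset.range (n - N), R 1 i))) atTop
        (𝓝 (2 * (ρ N + (ρ 1 - ρ 1)))) :=
      ((hρ N).add ((hρ 1).sub (tendsto_avg_shift (hρ 1) N))).const_mul 2
    filter_upwards [hlim.eventually_lt_const (show 2 * (ρ N + (ρ 1 - ρ 1)) < δ by linarith)]
      with n hn
    refine lt_of_le_of_lt ?_ hn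
    rw [avg, ← mul_sub, ← Finset.sum_sub_distrib, norm_mul, Real.norm_of_nonneg (by positivity),
      avg, avg, ← mul_sub, ← mul_add, mul_left_comm]
    gcongr
    have hsplit : ∑ i ∈ Finset.range n, R 1 i - ∑ i ∈ Finset.range (n - N), R 1 i
        = ∑ i ∈ Finset.Ico (n - N) n, R 1 i :=
      (Finset.sum_Ico_eq_sub _ (Nat.sub_le n N)).symm
    rw [hsplit, Real.norm_eq_abs]
    calc _ ≤ ∑ i ∈ Finset.range n, 2 * R (n - i) i :=
          (Finset.abs_sum_le_sum_abs _ _).trans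
            (Finset.sum_le_sum fun i hi => herr n i (Finset.mem_range.1 hi))
      _ = 2 * ∑ i ∈ Finset.range n, R (n - i) i := (Finset.mul_sum _ _ _).symm
      _ ≤ _ := by
        gcongr
        rw [← Finset.sum_range_add_sum_Ico _ (Nat.sub_le n N)]
        refine add_le_add ?_ (Finset.sum_le_sum fun i hi => ?_)
        · calc _ ≤ ∑ i ∈ Finset.range (n - N), R N i := Finset.sum_le_sum fun i hi =>
                hRanti i _ _ (by have := Finset.mem_range.1 hi; omega)
            _ ≤ ∑ i ∈ Finset.range n, R N i :=
                Finset.sum_le_sum_of_subset_of_nonneg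
                  (Finset.range_mono (Nat.sub_le n N)) fun i _ _ => hRnn N i
        · exact hRanti i _ _ (by have := Finset.mem_Ico.1 hi; omega)
  have := hc.sub hdiff
  rw [sub_zero] at this
  exact this.congr fun n => sub_sub_cancel _ _

variable {Ω : Type*} [MeasurableSpace Ω] {P : Measure Ω} [IsProbabilityMeasure P] {τ : Ω → Ω}

/-- Almost sure convergence of averages of correlation sums, by Birkhoff's theorem. -/
theorem ae_tendsto_correlation_sums (hτ : Ergodic τ P) {a : ℕ → Ω → ℝ}
    (ha : ∀ k, Integrable (a k) P) (hs : Summable fun k => ∫ ω, ‖a k ω‖ ∂P) :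
    ∀ᵐ ω ∂P, Tendsto (fun n : ℕ => (1 / (n : ℝ)) * ∑ i ∈ Finset.range n,
      (a 0 (τ^[i] ω) + 2 * ∑ k ∈ Finset.range (n - 1 - i), a (k + 1) (τ^[i] ω))) atTop
      (𝓝 (∫ ω, a 0 ω ∂P + 2 * ∑' k, ∫ ω, a (k + 1) ω ∂P)) := by
  have hs1 : ∀ N, Summable fun k => ∫ ω, ‖a (k + N) ω‖ ∂P := fun N =>
    (summable_nat_add_iff N).2 hs
  have hs1' : ∀ N, Summable fun k => ∫ ω, ‖|a (k + N) ω|‖ ∂P := fun N => by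
    simpa only [Real.norm_eq_abs, abs_abs] using hs1 N
  have hΦ := integrable_tsum_of_summable_integral (fun k => ha (k + 1)) (hs1 1)
  have hR := fun N => integrable_tsum_of_summable_integral (fun k => (ha (k + N)).abs) (hs1' N)
  have hIΦ : ∫ ω, (a 0 ω + 2 * ∑' k, a (k + 1) ω) ∂P
      = ∫ ω, a 0 ω ∂P + 2 * ∑' k, ∫ ω, a (k + 1) ω ∂P := by
    rw [integral_add (ha 0) (hΦ.const_mul 2), integral_const_mul,
      integral_tsum_of_summable_integral_norm (fun k => ha (k + 1)) (hs1 1)]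
  have hae : ∀ᵐ ω ∂P, ∀ i : ℕ, Summable fun k => |a k (τ^[i] ω)| := ae_all_iff.2 fun i =>
    (hτ.toMeasurePreserving.iterate i).quasiMeasurePreserving.ae
      (ae_summable_of_summable_integral ha hs)
  filter_upwards [hae, ae_tendsto_birkhoff hτ ((ha 0).add (hΦ.const_mul 2)),
    ae_all_iff.2 fun N => ae_tendsto_birkhoff hτ (hR N)] with ω h1 h2 h3
  rw [← hIΦ]
  refine tendsto_avg_truncated (b := fun k i => a k (τ^[i] ω)) h1 h2 h3 ?_
  have h4 : ∀ N, ∫ ω, ∑' k, |a (k + N) ω| ∂P = ∑' k, ∫ ω, ‖a (k + N) ω‖ ∂P := fun N =>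
    (integral_tsum_of_summable_integral_norm (fun k => (ha (k + N)).abs) (hs1' N)).symm
  simp only [h4]
  exact tendsto_sum_nat_add fun k => ∫ ω, ‖a k ω‖ ∂P

end Averages

/-! ### Linear response of the integrated correlations -/

section IntegratedBounds

variable {Ω : Type*} [MeasurableSpace Ω] {P : Measure Ω} {σ : Ω ≃ Ω} {E : Ω → ℝ} {w : ℕ → ℝ}

theorem _root_.MeasureTheory.MeasurePreserving.integral_comp_of_integrable {τ : Ω → Ω}
    (hτ : MeasurePreserving τ P P) {f : Ω → ℝ} (hf : Integrable f P) :
    ∫ ω, f (τ ω) ∂P = ∫ ω, f ω ∂P := by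
  have h := integral_map (μ := P) hτ.measurable.aemeasurable (f := f)
    (by rw [hτ.map_eq]; exact hf.aestronglyMeasurable)
  rw [← h, hτ.map_eq]

theorem integrable_four {f : Ω → ℝ} (hf : Integrable f P) {τ₁ τ₂ τ₃ : Ω → Ω}
    (h₁ : MeasurePreserving τ₁ P P) (h₂ : MeasurePreserving τ₂ P P)
    (h₃ : MeasurePreserving τ₃ P P) :
    Integrable (fun ω => f ω + f (τ₁ ω) + f (τ₂ ω) + f (τ₃ ω)) P :=
  ((hf.add (h₁.integrable_comp_of_integrable hf)).add
    (h₂.integrable_comp_of_integrable hf)).add (h₃.integrable_comp_of_integrable hf)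

theorem integral_four {f : Ω → ℝ} (hf : Integrable f P) {τ₁ τ₂ τ₃ : Ω → Ω}
    (h₁ : MeasurePreserving τ₁ P P) (h₂ : MeasurePreserving τ₂ P P)
    (h₃ : MeasurePreserving τ₃ P P) :
    ∫ ω, (f ω + f (τ₁ ω) + f (τ₂ ω) + f (τ₃ ω)) ∂P = 4 * ∫ ω, f ω ∂P := by
  have i₁ : Integrable (fun ω => f (τ₁ ω)) P := h₁.integrable_comp_of_integrable hf
  have i₂ : Integrable (fun ω => f (τ₂ ω)) P := h₂.integrable_comp_of_integrable hf
  have i₃ : Integrable (fun ω => f (τ₃ ω)) P := h₃.integrable_comp_of_integrable hf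
  have i₁₂ : Integrable (fun ω => f ω + f (τ₁ ω)) P := hf.add i₁
  have i₁₂₃ : Integrable (fun ω => f ω + f (τ₁ ω) + f (τ₂ ω)) P := i₁₂.add i₂
  rw [integral_add i₁₂₃ i₃, integral_add i₁₂ i₂, integral_add hf i₁,
    h₁.integral_comp_of_integrable hf, h₂.integral_comp_of_integrable hf,
    h₃.integral_comp_of_integrable hf]
  ring

variable (hσ : MeasurePreserving σ P P) (hσ' : MeasurePreserving σ.symm P P)
  (hE : Integrable (fun ω => E ω ^ 8) P)
include hσ hE

theorem integrable_operatorBound (n k : ℕ) : Integrable (fun ω => operatorBound σ E n ω k) P :=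
  integrable_four hE (hσ.iterate n) (hσ.iterate k) (hσ.iterate (k + 1))

theorem integral_operatorBound (n k : ℕ) :
    ∫ ω, operatorBound σ E n ω k ∂P = 4 * ∫ ω, E ω ^ 8 ∂P :=
  integral_four hE (hσ.iterate n) (hσ.iterate k) (hσ.iterate (k + 1))

include hσ'

theorem integrable_densityBound (n j : ℕ) : Integrable (fun ω => densityBound σ E n ω j) P :=
  integrable_four hE (hσ.iterate n) (hσ'.iterate j) (hσ'.iterate (j + 1))

theorem integral_densityBound (n j : ℕ) :
    ∫ ω, densityBound σ E n ω j ∂P = 4 * ∫ ω, E ω ^ 8 ∂P :=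
  integral_four hE (hσ.iterate n) (hσ'.iterate j) (hσ'.iterate (j + 1))

theorem summable_integral_densityBound (hw : Summable fun n => w n ^ 2) (n : ℕ) :
    Summable fun j => ∫ ω, ‖densityBound σ E n ω j * (w n ^ 2 * w j ^ 2)‖ ∂P := by
  refine ((hw.mul_left (w n ^ 2)).mul_left (4 * ∫ ω, E ω ^ 8 ∂P)).congr fun j => ?_
  rw [← integral_densityBound hσ hσ' hE n j, ← integral_mul_const]
  refine integral_congr_ae (Eventually.of_forall fun ω => ?_)
  exact (Real.norm_of_nonneg (mul_nonneg (densityBound_nonneg σ E n j ω) (by positivity))).symm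

theorem integrable_slopeBound (hw : Summable fun n => w n ^ 2) (n : ℕ) :
    Integrable (slopeBound σ E w n) P :=
  (integrable_finsetSum _ fun k _ => (integrable_operatorBound hσ hE n k).mul_const _).add
    (integrable_tsum_of_summable_integral
      (fun j => (integrable_densityBound hσ hσ' hE n j).mul_const _)
      (summable_integral_densityBound hσ hσ' hE hw n))

theorem integral_slopeBound (hw : Summable fun n => w n ^ 2) (n : ℕ) :
    ∫ ω, slopeBound σ E w n ω ∂P = 4 * (∫ ω, E ω ^ 8 ∂P)
      * (∑ k ∈ Finset.range n, w k ^ 2 * w (n - 1 - k) ^ 2 + w n ^ 2 * ∑' j, w j ^ 2) := by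
  have h1 : ∀ k ∈ Finset.range n, Integrable (fun ω =>
      operatorBound σ E n ω k * (w (n - 1 - k) ^ 2 * w k ^ 2)) P := fun k _ =>
    (integrable_operatorBound hσ hE n k).mul_const _
  have h2 : ∀ j, Integrable (fun ω => densityBound σ E n ω j * (w n ^ 2 * w j ^ 2)) P := fun j =>
    (integrable_densityBound hσ hσ' hE n j).mul_const _
  have h3 := summable_integral_densityBound hσ hσ' hE hw n
  unfold slopeBound
  rw [integral_add (integrable_finsetSum _ h1) (integrable_tsum_of_summable_integral h2 h3),
    integral_finsetSum _ h1, ← integral_tsum_of_summable_integral_norm h2 h3]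
  simp only [integral_mul_const, integral_operatorBound hσ hE, integral_densityBound hσ hσ' hE]
  rw [← Finset.mul_sum, tsum_mul_left, tsum_mul_left, ← mul_add]
  congr 2
  exact Finset.sum_congr rfl fun k _ => mul_comm _ _

theorem summable_integral_slopeBound (hw : Summable fun n => w n ^ 2) :
    Summable fun n => ∫ ω, slopeBound σ E w n ω ∂P := by
  simp only [integral_slopeBound hσ hσ' hE hw]
  refine (Summable.add ?_ (hw.mul_right _)).mul_left _
  rw [← summable_nat_add_iff 1]
  have hw' : Summable fun n => ‖w n ^ 2‖ := hw.norm
  exact (summable_norm_sum_mul_range_of_summable_norm hw' hw').of_norm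

end IntegratedBounds

namespace ResponseSystem

variable {d : ℕ} {M : Type*} [TopologicalSpace M] [CompactSpace M]
  [ChartedSpace (EuclideanSpace ℝ (Fin d)) M] [IsManifold (𝓡 d) (⊤ : ℕ∞) M]
  [MeasurableSpace M] [BorelSpace M] {Ω : Type*} [MeasurableSpace Ω] {P : Measure Ω}
  {cov : ChartCover d M} {m : Measure M} [IsProbabilityMeasure m] {σ : Ω ≃ Ω} {I : Set ℝ}
  {T : ℝ → Ω → M → M} {L : ℝ → Ω → C(M, ℝ) →L[ℝ] C(M, ℝ)} {h : ℝ → Ω → C(M, ℝ)}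
  {F : Ω → C(M, ℝ)} {D : Ω → C(M, ℝ) → C(M, ℝ)} {E : Ω → ℝ} {w : ℕ → ℝ} {G : Set Ω}
  (S : ResponseSystem cov m σ I T L h F D E w G)
  (hG : ∀ᵐ ω ∂P, ω ∈ G) (hσ : MeasurePreserving σ P P) (hE : Integrable (fun ω => E ω ^ 8) P)
  (hmeas : ∀ ε ∈ I, ∀ n, AEStronglyMeasurable (fibreCorr m σ L h F ε n) P)
include S hG hσ hE hmeas

theorem integrable_fibreCorr {ε : ℝ} (hε : ε ∈ I) (n : ℕ) :
    Integrable (fibreCorr m σ L h F ε n) P := by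
  have h1 := ((hE.add ((hσ.iterate n).integrable_comp_of_integrable hE)).const_mul
    (w n ^ 2)).const_mul 16
  refine h1.mono' (hmeas ε hε n) ?_
  filter_upwards [hG] with ω hω
  exact S.abs_fibreCorr_le hε hω n

theorem summable_integral_norm_fibreCorr {ε : ℝ} (hε : ε ∈ I) :
    Summable fun n => ∫ ω, ‖fibreCorr m σ L h F ε n ω‖ ∂P := by
  refine Summable.of_nonneg_of_le (fun n => integral_nonneg fun ω => norm_nonneg _) (fun n => ?_)
    (S.summable_weight.mul_left (32 * ∫ ω, E ω ^ 8 ∂P))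
  have h0 : Integrable (fun ω => E (σ^[n] ω) ^ 8) P :=
    (hσ.iterate n).integrable_comp_of_integrable hE
  have h1 := ((hE.add h0).const_mul (w n ^ 2)).const_mul 16
  calc ∫ ω, ‖fibreCorr m σ L h F ε n ω‖ ∂P
      ≤ ∫ ω, 16 * (w n ^ 2 * (E ω ^ 8 + E (σ^[n] ω) ^ 8)) ∂P := by
        refine integral_mono_ae (S.integrable_fibreCorr hG hσ hE hmeas hε n).norm h1 ?_
        filter_upwards [hG] with ω hω
        exact S.abs_fibreCorr_le hε hω n
    _ = 32 * (∫ ω, E ω ^ 8 ∂P) * w n ^ 2 := by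
        rw [integral_const_mul, integral_const_mul, integral_add hE h0,
          (hσ.iterate n).integral_comp_of_integrable hE]
        ring

theorem summable_integral_fibreCorr {ε : ℝ} (hε : ε ∈ I) :
    Summable fun n => ∫ ω, fibreCorr m σ L h F ε n ω ∂P :=
  (S.summable_integral_norm_fibreCorr hG hσ hE hmeas hε).of_norm_bounded
    fun _ => norm_integral_le_integral_norm _

/-- Linear response of the integrated correlations and of their sum. -/
theorem exists_hasDerivAt (hσ' : MeasurePreserving σ.symm P P) : ∃ c' : ℕ → ℝ,
    (∀ n, HasDerivAt (fun ε => ∫ ω, fibreCorr m σ L h F ε n ω ∂P) (c' n) 0) ∧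
    Summable c' ∧
    HasDerivAt (fun ε => ∑' n, ∫ ω, fibreCorr m σ L h F ε (n + 1) ω ∂P)
      (∑' n, c' (n + 1)) 0 := by
  have hslope : ∀ ε ∈ I, ∀ n, (1 / ε) * (∫ ω, fibreCorr m σ L h F ε n ω ∂P
      - ∫ ω, fibreCorr m σ L h F 0 n ω ∂P)
      = ∫ ω, (1 / ε) * (fibreCorr m σ L h F ε n ω - fibreCorr m σ L h F 0 n ω) ∂P :=
    fun ε hε n => by
      rw [integral_const_mul, integral_sub (S.integrable_fibreCorr hG hσ hE hmeas hε n)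
        (S.integrable_fibreCorr hG hσ hE hmeas S.zero_mem n)]
  obtain ⟨C, hC⟩ := S.exists_abs_slope_fibreCorr_le
  have hlim : ∀ n, ∃ l, Tendsto (fun ε => (1 / ε) * (∫ ω, fibreCorr m σ L h F ε n ω ∂P
      - ∫ ω, fibreCorr m σ L h F 0 n ω ∂P)) (𝓝[≠] 0) (𝓝 l) := by
    intro n
    have hex : ∀ ω, ∃ l, ω ∈ G → Tendsto (fun ε => (1 / ε) * (fibreCorr m σ L h F ε n ω
        - fibreCorr m σ L h F 0 n ω)) (𝓝[≠] 0) (𝓝 l) := fun ω => by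
      by_cases hω : ω ∈ G
      · exact (S.exists_tendsto_slope_fibreCorr hω n).imp fun l hl _ => hl
      · exact ⟨0, fun h => absurd h hω⟩
    choose l hl using hex
    refine ⟨∫ ω, l ω ∂P, ?_⟩
    have := tendsto_integral_filter_of_dominated_convergence (μ := P) (l := 𝓝[≠] (0 : ℝ))
      (F := fun ε ω => (1 / ε) * (fibreCorr m σ L h F ε n ω - fibreCorr m σ L h F 0 n ω))
      (f := l) (fun ω => C * slopeBound σ E w n ω) ?_ ?_
      ((integrable_slopeBound hσ hσ' hE S.summable_weight n).const_mul C) ?_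
    · refine this.congr' ?_
      filter_upwards [S.eventually_mem] with ε hε
      exact (hslope ε hε.1 n).symm
    · filter_upwards [S.eventually_mem] with ε hε
      exact ((hmeas ε hε.1 n).sub (hmeas 0 S.zero_mem n)).const_mul _
    · filter_upwards [S.eventually_mem] with ε hε
      filter_upwards [hG] with ω hω
      exact hC ε hε.1 hε.2 ω hω n
    · filter_upwards [hG] with ω hω
      exact hl ω hω
  have hbound : ∀ ε ∈ I, ε ≠ 0 → ∀ n, ‖(1 / ε) * (∫ ω, fibreCorr m σ L h F ε n ω ∂P
      - ∫ ω, fibreCorr m σ L h F 0 n ω ∂P)‖ ≤ C * ∫ ω, slopeBound σ E w n ω ∂P := by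
    intro ε hε hε0 n
    rw [hslope ε hε n, ← integral_const_mul]
    refine norm_integral_le_of_norm_le
      ((integrable_slopeBound hσ hσ' hE S.summable_weight n).const_mul C) ?_
    filter_upwards [hG] with ω hω
    exact hC ε hε hε0 ω hω n
  have hsum := (summable_integral_slopeBound hσ hσ' hE S.summable_weight).mul_left C
  choose c' hc' using hlim
  refine ⟨c', fun n => ?_, ?_, ?_⟩
  · rw [hasDerivAt_iff_tendsto_slope_zero]
    simpa only [zero_add, smul_eq_mul, one_div] using hc' n
  · refine Summable.of_norm_bounded hsum fun n => ?_
    refine le_of_tendsto (hc' n).norm ?_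
    filter_upwards [S.eventually_mem] with ε hε
    exact hbound ε hε.1 hε.2 n
  · rw [hasDerivAt_iff_tendsto_slope_zero]
    have := tendsto_tsum_of_dominated_convergence ((summable_nat_add_iff 1).2 hsum)
      (fun n => hc' (n + 1)) (by
        filter_upwards [S.eventually_mem] with ε hε n
        exact hbound ε hε.1 hε.2 (n + 1))
    refine this.congr' ?_
    filter_upwards [S.eventually_mem] with ε hε
    have s1 := S.summable_integral_fibreCorr hG hσ hE hmeas hε.1
    have s0 := S.summable_integral_fibreCorr hG hσ hE hmeas S.zero_mem
    rw [tsum_mul_left, ((summable_nat_add_iff 1).2 s1).tsum_sub ((summable_nat_add_iff 1).2 s0),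
      zero_add, smul_eq_mul, one_div]

end ResponseSystem

/-! ### Equivariant measures and quenched variance -/

section DensityMeasure

variable {M : Type*} [MeasurableSpace M] {m : Measure M} {h : M → ℝ}

theorem integral_densityMeasure (hm : Measurable h) (u : M → ℝ) :
    ∫ x, u x ∂(densityMeasure m h) = ∫ x, (ENNReal.ofReal (h x)).toReal * u x ∂m := by
  rw [densityMeasure, integral_withDensity_eq_integral_toReal_smul hm.ennreal_ofReal
    (Eventually.of_forall fun x => ENNReal.ofReal_lt_top)]
  rfl

theorem integral_densityMeasure_of_nonneg (hm : Measurable h) (h0 : ∀ᵐ x ∂m, 0 ≤ h x)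
    (u : M → ℝ) : ∫ x, u x ∂(densityMeasure m h) = ∫ x, h x * u x ∂m := by
  rw [integral_densityMeasure hm]
  refine integral_congr_ae ?_
  filter_upwards [h0] with x hx
  rw [ENNReal.toReal_ofReal hx]

theorem isProbabilityMeasure_densityMeasure (hi : Integrable h m) (h0 : ∀ᵐ x ∂m, 0 ≤ h x)
    (h1 : ∫ x, h x ∂m = 1) : IsProbabilityMeasure (densityMeasure m h) := by
  refine ⟨?_⟩
  rw [densityMeasure, withDensity_apply _ MeasurableSet.univ, Measure.restrict_univ,
    ← ofReal_integral_eq_lintegral_ofReal hi h0, h1, ENNReal.ofReal_one]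

theorem measurable_centered {Ω : Type*} [MeasurableSpace Ω] [SFinite m] {h f : Ω → M → ℝ}
    (hh : Measurable fun p : Ω × M => h p.1 p.2) (hf : Measurable fun p : Ω × M => f p.1 p.2) :
    Measurable (Function.uncurry (centered m h f)) := by
  have h1 : Measurable fun ω => ∫ y, f ω y ∂(densityMeasure m (h ω)) := by
    have h2 : ∀ ω, ∫ y, f ω y ∂(densityMeasure m (h ω))
        = ∫ y, (ENNReal.ofReal (h ω y)).toReal * f ω y ∂m := fun ω =>
      integral_densityMeasure (hh.comp measurable_prodMk_left) _
    simp only [h2]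
    have h3 : Measurable fun p : Ω × M => (ENNReal.ofReal (h p.1 p.2)).toReal * f p.1 p.2 :=
      hh.ennreal_ofReal.ennreal_toReal.mul hf
    exact h3.stronglyMeasurable.integral_prod_right.measurable
  exact hf.sub (h1.comp measurable_fst)

theorem measurable_correlation_integrand {Ω : Type*} [MeasurableSpace Ω] [SFinite m]
    {σ : Ω → Ω} (hσ : Measurable σ) {T : Ω → M → M} (hT : Measurable fun p : Ω × M => T p.1 p.2)
    {h f : Ω → M → ℝ} (hh : Measurable fun p : Ω × M => h p.1 p.2)
    (hf : Measurable fun p : Ω × M => f p.1 p.2) (n : ℕ) :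
    Measurable fun p : Ω × M => h p.1 p.2 * centered m h f p.1 p.2
      * Function.uncurry (centered m h f) ((skewProduct σ T)^[n] p) := by
  have hc := measurable_centered (m := m) hh hf
  exact (hh.mul hc).mul (hc.comp (measurable_iterate_skewProduct hσ hT n))

end DensityMeasure

/-- The fibrewise centred observable, as a continuous function. -/
noncomputable def centredObs {M Ω : Type*} [TopologicalSpace M] [CompactSpace M]
    [MeasurableSpace M] [BorelSpace M] (m : Measure M) [IsProbabilityMeasure m]
    (h : ℝ → Ω → C(M, ℝ)) (F : Ω → C(M, ℝ)) (ε : ℝ) (ω : Ω) : C(M, ℝ) :=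
  F ω - ContinuousMap.const M (obsMean m h F ε ω)

namespace ResponseSystem

variable {d : ℕ} {M : Type*} [TopologicalSpace M] [CompactSpace M]
  [ChartedSpace (EuclideanSpace ℝ (Fin d)) M] [MeasurableSpace M] {Ω : Type*}
  {cov : ChartCover d M} {m : Measure M} {σ : Ω ≃ Ω} {I : Set ℝ}
  {T : ℝ → Ω → M → M} {L : ℝ → Ω → C(M, ℝ) →L[ℝ] C(M, ℝ)} {h : ℝ → Ω → C(M, ℝ)}
  {F : Ω → C(M, ℝ)} {D : Ω → C(M, ℝ) → C(M, ℝ)} {E : Ω → ℝ} {w : ℕ → ℝ} {G : Set Ω}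
  (S : ResponseSystem cov m σ I T L h F D E w G)
include S

/-- Equivariance of the measures `h_{ω,ε} dm`. -/
theorem integral_density_mul_comp {ε : ℝ} (hε : ε ∈ I) {ω : Ω} (hω : ω ∈ G) (i : ℕ) {u : M → ℝ}
    (hu : Measurable u) (hb : ∃ b : ℝ, ∀ x, |u x| ≤ b) :
    ∫ x, h ε ω x * u (mapIter σ (T ε) i ω x) ∂m = ∫ x, h ε (σ^[i] ω) x * u x ∂m := by
  rw [← integral_opIter_mul (S.measurable_map ε hε) (S.isTransferOperator ε hε) i ω _ hu hb,
    S.iter_density hε hω]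

variable [BorelSpace M] [IsProbabilityMeasure m]

theorem integral_density_mul_centredObs {ε : ℝ} (hε : ε ∈ I) {ω : Ω} (hω : ω ∈ G) :
    ∫ x, h ε ω x * centredObs m h F ε ω x ∂m = 0 := by
  rw [← S.integral_centredDensity hε hω]
  exact integral_congr_ae (Eventually.of_forall fun x => mul_comm _ _)

variable [IsManifold (𝓡 d) (⊤ : ℕ∞) M]

theorem isProbabilityMeasure {ε : ℝ} (hε : ε ∈ I) {ω : Ω} (hω : ω ∈ G) :
    IsProbabilityMeasure (densityMeasure m (h ε ω)) :=
  isProbabilityMeasure_densityMeasure (integrable_continuousMap _) (S.density_nonneg hε hω)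
    (S.integral_density ω hω ε hε)

theorem integral_density_mul {ε : ℝ} (hε : ε ∈ I) {ω : Ω} (hω : ω ∈ G) (u : M → ℝ) :
    ∫ x, u x ∂(densityMeasure m (h ε ω)) = ∫ x, h ε ω x * u x ∂m :=
  integral_densityMeasure_of_nonneg (h ε ω).continuous.measurable (S.density_nonneg hε hω) u

theorem abs_centredObs_le {ε : ℝ} (hε : ε ∈ I) {ω : Ω} (hω : ω ∈ G) (x : M) :
    |centredObs m h F ε ω x| ≤ 2 * E ω :=
  (S.centredObservable hε hω).abs_le x

/-- The correlation in terms of maps agrees with the one in terms of transfer operators. -/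
theorem fibreCorr_eq {ε : ℝ} (hε : ε ∈ I) {ω : Ω} (hω : ω ∈ G) (n : ℕ) :
    fibreCorr m σ L h F ε n ω = ∫ x, h ε ω x * (centredObs m h F ε ω x
      * centredObs m h F ε (σ^[n] ω) (mapIter σ (T ε) n ω x)) ∂m := by
  have h1 := integral_opIter_mul (σ := σ) (S.measurable_map ε hε) (S.isTransferOperator ε hε) n ω
    (centredDensity m h F ε ω) (centredObs m h F ε (σ^[n] ω)).continuous.measurable
    ⟨_, S.abs_centredObs_le hε (S.iterate_mem hω n)⟩
  have h2 : ∀ x, opIter σ (L ε) n ω (centredDensity m h F ε ω) x * centredObs m h F ε (σ^[n] ω) x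
      = (F (σ^[n] ω) * opIter σ (L ε) n ω (centredDensity m h F ε ω)) x
        - obsMean m h F ε (σ^[n] ω) * opIter σ (L ε) n ω (centredDensity m h F ε ω) x := fun x => by
    simp only [centredObs, ContinuousMap.sub_apply, ContinuousMap.const_apply,
      ContinuousMap.mul_apply]
    ring
  simp only [h2] at h1
  rw [integral_sub (integrable_continuousMap _) ((integrable_continuousMap _).const_mul _),
    integral_const_mul, S.integral_iter hε, S.integral_centredDensity hε hω, mul_zero,
    sub_zero] at h1
  refine Eq.trans h1 (integral_congr_ae (Eventually.of_forall fun x => ?_))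
  simp only [centredDensity, centredObs, ContinuousMap.mul_apply]
  ring

section Observable

variable {f : Ω → M → ℝ} (hfF : ∀ ω ∈ G, f ω = F ω)
include hfF

theorem centered_eq {ε : ℝ} (hε : ε ∈ I) {ω : Ω} (hω : ω ∈ G) :
    centered m (fun ω x => h ε ω x) f ω = centredObs m h F ε ω := by
  funext x
  have h1 : ∫ y, f ω y ∂(densityMeasure m (h ε ω)) = obsMean m h F ε ω := by
    rw [hfF ω hω, S.integral_density_mul hε hω]
    exact integral_congr_ae (Eventually.of_forall fun x => mul_comm _ _)
  rw [centered, h1, hfF ω hω]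
  rfl

/-- The variance of the ergodic sums, as a double sum of correlations. -/
theorem variance_ergodicSum {ε : ℝ} (hε : ε ∈ I) {ω : Ω} (hω : ω ∈ G) (n : ℕ) :
    Var[ergodicSum σ (T ε) f n ω; densityMeasure m (h ε ω)] = ∑ i ∈ Finset.range n,
      (fibreCorr m σ L h F ε 0 (σ^[i] ω)
        + 2 * ∑ k ∈ Finset.range (n - 1 - i), fibreCorr m σ L h F ε (k + 1) (σ^[i] ω)) := by
  have hμ := S.isProbabilityMeasure hε hω
  have hTm := fun i => measurable_mapIter (σ := σ) (S.measurable_map ε hε) i ω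
  set v : ℕ → M → ℝ := fun i x => centredObs m h F ε (σ^[i] ω) (mapIter σ (T ε) i ω x) with hv
  have hvm : ∀ i, Measurable (v i) := fun i =>
    (centredObs m h F ε (σ^[i] ω)).continuous.measurable.comp (hTm i)
  have hvb : ∀ i x, |v i x| ≤ 2 * E (σ^[i] ω) := fun i x =>
    S.abs_centredObs_le hε (S.iterate_mem hω i) _
  have hvi : ∀ i, Integrable (v i) (densityMeasure m (h ε ω)) := fun i =>
    Integrable.of_bound (hvm i).aestronglyMeasurable _ (Eventually.of_forall (hvb i))
  have hvvi : ∀ i j, Integrable (fun x => v i x * v j x) (densityMeasure m (h ε ω)) := fun i j =>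
    (hvi i).mul_bdd (hvm j).aestronglyMeasurable (Eventually.of_forall (hvb j))
  have hv0 : ∀ i, ∫ x, v i x ∂(densityMeasure m (h ε ω)) = 0 := fun i => by
    rw [S.integral_density_mul hε hω, S.integral_density_mul_comp hε hω i
      (centredObs m h F ε (σ^[i] ω)).continuous.measurable
      ⟨_, S.abs_centredObs_le hε (S.iterate_mem hω i)⟩,
      S.integral_density_mul_centredObs hε (S.iterate_mem hω i)]
  have hsum : ∀ x, ergodicSum σ (T ε) f n ω x = ∑ i ∈ Finset.range n, v i x
      + ∑ i ∈ Finset.range n, obsMean m h F ε (σ^[i] ω) := fun x => by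
    rw [ergodicSum, ← Finset.sum_add_distrib]
    refine Finset.sum_congr rfl fun i _ => ?_
    rw [hfF _ (S.iterate_mem hω i)]
    simp [hv, centredObs]
  have hmeas : Measurable (ergodicSum σ (T ε) f n ω) := by
    rw [funext hsum]
    exact (Finset.measurable_fun_sum _ fun i _ => hvm i).add_const _
  have hmean : ∫ x, ergodicSum σ (T ε) f n ω x ∂(densityMeasure m (h ε ω))
      = ∑ i ∈ Finset.range n, obsMean m h F ε (σ^[i] ω) := by
    simp only [hsum]
    rw [integral_add (integrable_finsetSum _ fun i _ => hvi i) (integrable_const _),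
      integral_finsetSum _ fun i _ => hvi i]
    simp [hv0]
  rw [variance_eq_integral hmeas.aemeasurable, hmean]
  have hsq : ∀ x, (ergodicSum σ (T ε) f n ω x - ∑ i ∈ Finset.range n, obsMean m h F ε (σ^[i] ω)) ^ 2
      = ∑ i ∈ Finset.range n, ∑ j ∈ Finset.range n, v i x * v j x := fun x => by
    rw [hsum, add_sub_cancel_right, sq, Finset.sum_mul_sum]
  simp only [hsq]
  rw [integral_finsetSum _ fun i _ => integrable_finsetSum _ fun j _ => hvvi i j]
  simp only [integral_finsetSum _ fun j _ => hvvi _ j]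
  rw [sum_sum_eq_of_symm (Q := fun i j => ∫ x, v i x * v j x ∂(densityMeasure m (h ε ω)))
    (fun i j => integral_congr_ae (Eventually.of_forall fun x => mul_comm _ _))]
  have hQ : ∀ i k, ∫ x, v i x * v (i + k) x ∂(densityMeasure m (h ε ω))
      = fibreCorr m σ L h F ε k (σ^[i] ω) := by
    intro i k
    have hi := S.iterate_mem hω i
    have hk := S.iterate_mem hi k
    set u : M → ℝ := fun x => centredObs m h F ε (σ^[i] ω) x
      * centredObs m h F ε (σ^[k] (σ^[i] ω)) (mapIter σ (T ε) k (σ^[i] ω) x) with hu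
    have hum : Measurable u := (centredObs m h F ε (σ^[i] ω)).continuous.measurable.mul
      ((centredObs m h F ε (σ^[k] (σ^[i] ω))).continuous.measurable.comp
        (measurable_mapIter (S.measurable_map ε hε) k _))
    have hub : ∀ x, |u x| ≤ 2 * E (σ^[i] ω) * (2 * E (σ^[k] (σ^[i] ω))) := fun x => by
      have := S.pos (σ^[i] ω)
      rw [hu, abs_mul]
      gcongr
      · exact S.abs_centredObs_le hε hi _
      · exact S.abs_centredObs_le hε hk _
    rw [S.fibreCorr_eq hε hi, ← S.integral_density_mul_comp hε hω i hum ⟨_, hub⟩,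
      S.integral_density_mul hε hω]
    refine integral_congr_ae (Eventually.of_forall fun x => ?_)
    simp only [hv, hu]
    rw [add_comm i k, mapIter_add, Function.iterate_add_apply]
    rfl
  refine Finset.sum_congr rfl fun i _ => ?_
  congr 1
  · exact hQ i 0
  · congr 1
    exact Finset.sum_congr rfl fun k _ => hQ i (k + 1)

theorem integral_correlation {ε : ℝ} (hε : ε ∈ I) {ω : Ω} (hω : ω ∈ G) (n : ℕ) :
    ∫ x, centered m (fun ω x => h ε ω x) f ω x
      * centered m (fun ω x => h ε ω x) f (σ^[n] ω) (mapIter σ (T ε) n ω x) * h ε ω x ∂m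
      = fibreCorr m σ L h F ε n ω := by
  rw [S.fibreCorr_eq hε hω, S.centered_eq hfF hε hω, S.centered_eq hfF hε (S.iterate_mem hω n)]
  exact integral_congr_ae (Eventually.of_forall fun x => mul_comm _ _)

variable [MeasurableSpace Ω] {P : Measure Ω} (hG : ∀ᵐ ω ∂P, ω ∈ G)

section
include hG

theorem correlation_eq {ε : ℝ} (hε : ε ∈ I) (n : ℕ) :
    correlation P m σ (T ε) (fun ω x => h ε ω x) f n = ∫ ω, fibreCorr m σ L h F ε n ω ∂P := by
  refine integral_congr_ae ?_
  filter_upwards [hG] with ω hω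
  exact S.integral_correlation hfF hε hω n

variable [IsProbabilityMeasure P]

/-- The quenched variance exists almost surely, and is given by the sum of the correlations. -/
theorem ae_tendsto_variance (hσ : Ergodic σ P) (hE : Integrable (fun ω => E ω ^ 8) P)
    (hmeas : ∀ ε ∈ I, ∀ n, AEStronglyMeasurable (fibreCorr m σ L h F ε n) P)
    {ε : ℝ} (hε : ε ∈ I) :
    ∀ᵐ ω ∂P, Tendsto (fun n : ℕ => (1 / (n : ℝ)) *
      Var[ergodicSum σ (T ε) f n ω; densityMeasure m (h ε ω)]) atTop
      (𝓝 (∫ ω, fibreCorr m σ L h F ε 0 ω ∂P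
        + 2 * ∑' k, ∫ ω, fibreCorr m σ L h F ε (k + 1) ω ∂P)) := by
  have hmp := hσ.toMeasurePreserving
  filter_upwards [hG, ae_tendsto_correlation_sums hσ
    (S.integrable_fibreCorr hG hmp hE hmeas hε)
    (S.summable_integral_norm_fibreCorr hG hmp hE hmeas hε)] with ω hω hlim
  exact hlim.congr fun n => by rw [S.variance_ergodicSum hfF hε hω]

end

variable (hf : Measurable fun p : Ω × M => f p.1 p.2)
  (hh : ∀ ε ∈ I, Measurable fun p : Ω × M => h ε p.1 p.2)
  (hT : ∀ ε ∈ I, Measurable fun p : Ω × M => T ε p.1 p.2) (hσ : MeasurePreserving σ P P)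
include hG hf hh hT hσ

theorem aestronglyMeasurable_fibreCorr {ε : ℝ} (hε : ε ∈ I) (n : ℕ) :
    AEStronglyMeasurable (fibreCorr m σ L h F ε n) P := by
  have h1 := (measurable_correlation_integrand (m := m) (h := fun ω x => h ε ω x) hσ.measurable
    (hT ε hε) (hh ε hε) hf n).stronglyMeasurable.integral_prod_right' (ν := m)
  refine h1.aestronglyMeasurable.congr ?_
  filter_upwards [hG] with ω hω
  rw [← S.integral_correlation hfF hε hω n]
  refine integral_congr_ae (Eventually.of_forall fun x => ?_)
  simp only [iterate_skewProduct, Function.uncurry]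
  ring

theorem integrable_correlation_integrand [IsProbabilityMeasure P]
    (hE : Integrable (fun ω => E ω ^ 8) P) {ε : ℝ} (hε : ε ∈ I) (n : ℕ) :
    Integrable (fun p : Ω × M => h ε p.1 p.2 * centered m (fun ω x => h ε ω x) f p.1 p.2
      * Function.uncurry (centered m (fun ω x => h ε ω x) f) ((skewProduct σ (T ε))^[n] p))
      (P.prod m) := by
  have h0 : Integrable (fun ω => E (σ^[n] ω) ^ 8) P :=
    (hσ.iterate n).integrable_comp_of_integrable hE
  have h1 : Integrable (fun p : Ω × M =>
      4 * (E p.1 ^ 8 + E (σ^[n] p.1) ^ 8 + 1 + 1)) (P.prod m) :=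
    ((((hE.add h0).add (integrable_const 1)).add (integrable_const 1)).const_mul 4).comp_fst m
  refine h1.mono' (measurable_correlation_integrand (m := m) (h := fun ω x => h ε ω x)
    hσ.measurable (hT ε hε) (hh ε hε) hf n).aestronglyMeasurable ?_
  filter_upwards [Measure.quasiMeasurePreserving_fst.ae hG] with p hp
  have hn := S.iterate_mem hp n
  have p0 := S.one_le p.1
  have pn := S.one_le (σ^[n] p.1)
  rw [iterate_skewProduct]
  simp only [Function.uncurry]
  rw [S.centered_eq hfF hε hp, S.centered_eq hfF hε hn, norm_mul, norm_mul]
  simp only [Real.norm_eq_abs]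
  calc _ ≤ E p.1 * (2 * E p.1) * (2 * E (σ^[n] p.1)) := by
        gcongr
        · exact (S.density _ hp ε hε).abs_le _
        · exact S.abs_centredObs_le hε hp _
        · exact S.abs_centredObs_le hε hn _
    _ = 4 * (E p.1 ^ 2 * E (σ^[n] p.1) ^ 1 * 1 ^ 0 * 1 ^ 0) := by ring
    _ ≤ 4 * (E p.1 ^ 8 + E (σ^[n] p.1) ^ 8 + 1 ^ 8 + 1 ^ 8) := by
        gcongr
        exact monomial_le_sum_pow p0 pn le_rfl le_rfl 2 1 0 0 (by norm_num)
    _ = _ := by norm_num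

theorem correlation_eq_integral_prod [IsProbabilityMeasure P]
    (hE : Integrable (fun ω => E ω ^ 8) P) {ε : ℝ} (hε : ε ∈ I) (n : ℕ) :
    correlation P m σ (T ε) (fun ω x => h ε ω x) f n
      = ∫ p : Ω × M, h ε p.1 p.2 * centered m (fun ω x => h ε ω x) f p.1 p.2
        * Function.uncurry (centered m (fun ω x => h ε ω x) f) ((skewProduct σ (T ε))^[n] p)
        ∂(P.prod m) := by
  rw [integral_prod _ (S.integrable_correlation_integrand hfF hG hf hh hT hσ hE hε n)]
  refine integral_congr_ae (Eventually.of_forall fun ω =>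
    integral_congr_ae (Eventually.of_forall fun x => ?_))
  simp only [iterate_skewProduct, Function.uncurry]
  ring

end Observable

end ResponseSystem

/-! ### Reduction to a response system -/

section Reduction

/-- A property that holds almost surely holds on an invariant set of full measure. -/
theorem exists_invariant_set {Ω : Type*} [MeasurableSpace Ω] {P : Measure Ω} {σ : Ω ≃ Ω}
    (hσ : MeasurePreserving σ P P) (hσ' : MeasurePreserving σ.symm P P) {p : Ω → Prop}
    (hp : ∀ᵐ ω ∂P, p ω) : ∃ G : Set Ω, (∀ᵐ ω ∂P, ω ∈ G) ∧ (∀ ω ∈ G, p ω) ∧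
      (∀ ω ∈ G, σ ω ∈ G) ∧ (∀ ω ∈ G, σ.symm ω ∈ G) := by
  refine ⟨{ω | ∀ n, p (σ^[n] ω) ∧ p (σ.symm^[n] ω)}, ?_, fun ω hω => (hω 0).1,
    fun ω hω n => ⟨?_, ?_⟩, fun ω hω n => ⟨?_, ?_⟩⟩
  · exact ae_all_iff.2 fun n => ((hσ.iterate n).quasiMeasurePreserving.ae hp).and
      ((hσ'.iterate n).quasiMeasurePreserving.ae hp)
  · exact (hω (n + 1)).1
  · cases n with
    | zero => exact (hω 1).1
    | succ n => simpa using (hω n).2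
  · cases n with
    | zero => exact (hω 1).2
    | succ n => simpa using (hω n).1
  · exact (hω (n + 1)).2

/-- The weight `(n + 1) ^ (-β / 6)`, whose sixth power is the rate of decay of correlations and
whose square is summable for `β > 3`. -/
noncomputable def decayWeight (β : ℝ) (n : ℕ) : ℝ := ((n : ℝ) + 1) ^ (-(β / 6))

theorem decayWeight_pos (β : ℝ) (n : ℕ) : 0 < decayWeight β n :=
  Real.rpow_pos_of_pos (by positivity) _

theorem decayWeight_le_one {β : ℝ} (hβ : 0 ≤ β) (n : ℕ) : decayWeight β n ≤ 1 :=
  Real.rpow_le_one_of_one_le_of_nonpos (by linarith [(Nat.cast_nonneg n : (0 : ℝ) ≤ n)])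
    (by linarith)

theorem decayWeight_pow (β : ℝ) (n k : ℕ) :
    decayWeight β n ^ k = ((n : ℝ) + 1) ^ (-(β / 6) * k) := by
  rw [decayWeight, Real.rpow_mul_natCast (by positivity)]

theorem summable_decayWeight {β : ℝ} (hβ : 3 < β) : Summable fun n => decayWeight β n ^ 2 := by
  have h1 : Summable fun n : ℕ => (n : ℝ) ^ (-(β / 3)) :=
    Real.summable_nat_rpow.2 (by linarith)
  refine ((summable_nat_add_iff 1).2 h1).congr fun n => ?_
  rw [decayWeight_pow]
  push_cast
  congr 1
  ring

theorem rpow_neg_le_decayWeight {β : ℝ} (hβ : 0 ≤ β) {n : ℕ} (hn : 1 ≤ n) :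
    (n : ℝ) ^ (-β) ≤ 2 ^ β * decayWeight β n ^ 6 := by
  have hn' : (1 : ℝ) ≤ n := by exact_mod_cast hn
  have h1 : -(β / 6) * ((6 : ℕ) : ℝ) = -β := by push_cast; ring
  rw [decayWeight_pow, h1, Real.rpow_neg (by positivity), Real.rpow_neg (by positivity),
    ← div_eq_mul_inv, inv_eq_one_div, div_le_div_iff₀ (by positivity) (by positivity), one_mul,
    ← Real.mul_rpow (by norm_num) (by positivity)]
  exact Real.rpow_le_rpow (by positivity) (by linarith) hβ

theorem CrBound.crLe {d : ℕ} {M : Type*} [TopologicalSpace M] [CompactSpace M]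
    [ChartedSpace (EuclideanSpace ℝ (Fin d)) M] {cov : ChartCover d M} {r : ℕ}
    {L : C(M, ℝ) →L[ℝ] C(M, ℝ)} {K K' E : ℝ} (h : CrBound cov r L K') (hK' : K' ≤ E) (hE : 0 ≤ E)
    {φ : C(M, ℝ)} (hφ : CrLe cov r φ K) : CrLe cov r (L φ) (E * K) := by
  have h1 := h φ hφ.1
  refine ⟨h1.1, h1.2.trans ?_⟩
  have h2 : 0 ≤ crNorm cov r φ := ENNReal.toReal_nonneg
  exact mul_le_mul hK' hφ.2 h2 hE

theorem integrable_pow_eight {Ω : Type*} [MeasurableSpace Ω] {P : Measure Ω} {E : Ω → ℝ}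
    (hE : MemLp E 8 P) : Integrable (fun ω => E ω ^ 8) P := by
  have h1 := hE.integrable_norm_pow (p := 8) (by norm_num)
  refine h1.congr (Eventually.of_forall fun ω => ?_)
  simp only [Real.norm_eq_abs]
  exact Even.pow_abs (by decide) _

/-- Finitely many functions in `L^8` are dominated by one function in `L^8` which is at least `1`. -/
theorem exists_dominating {Ω : Type*} [MeasurableSpace Ω] {P : Measure Ω} [IsFiniteMeasure P]
    {ι : Type*} [Fintype ι] {C : ι → Ω → ℝ} (hC : ∀ i, MemLp (C i) 8 P) :
    ∃ E : Ω → ℝ, MemLp E 8 P ∧ (∀ ω, 1 ≤ E ω) ∧ ∀ i ω, C i ω ≤ E ω := by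
  refine ⟨fun ω => 1 + ∑ i, |C i ω|, ?_, fun ω => ?_, fun i ω => ?_⟩
  · have h1 : MemLp (fun _ : Ω => (1 : ℝ)) 8 P := memLp_const 1
    have h2 : MemLp (fun ω => ∑ i, |C i ω|) 8 P := memLp_finsetSum _ fun i _ => (hC i).abs
    exact h1.add h2
  · exact le_add_of_nonneg_right (Finset.sum_nonneg fun i _ => abs_nonneg _)
  · have h1 : |C i ω| ≤ ∑ i, |C i ω| :=
      Finset.single_le_sum (f := fun i => |C i ω|) (fun i _ => abs_nonneg _) (Finset.mem_univ i)
    linarith [le_abs_self (C i ω)]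

end Reduction

end RandomResponse

open RandomResponse in
theorem theorem4p1
    -- the compact Riemannian manifold `M` and its normalized volume `m`
    {d : ℕ} {M : Type*} [TopologicalSpace M] [T2Space M] [CompactSpace M]
    [ChartedSpace (EuclideanSpace ℝ (Fin d)) M] [IsManifold (𝓡 d) (⊤ : ℕ∞) M]
    [MeasurableSpace M] [BorelSpace M]
    (g : Bundle.ContMDiffRiemannianMetric (𝓡 d) (⊤ : ℕ∞) (EuclideanSpace ℝ (Fin d))
      (fun x : M => TangentSpace (𝓡 d) x))
    (m : Measure M) (hm : IsNormalizedVolume g m)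
    (cov : ChartCover d M)
    -- the invertible ergodic base
    {Ω : Type*} [MeasurableSpace Ω] (P : Measure Ω) [IsProbabilityMeasure P]
    (σ : Ω ≃ᵐ Ω) (hσ : Ergodic σ P)
    -- the parameter interval
    (I : Set ℝ) (hI_open : IsOpen I) (hI_conn : I.OrdConnected) (hI_zero : (0 : ℝ) ∈ I)
    (hI_sub : I ⊆ Set.Ioo (-1) 1)
    -- the maps and their transfer operators on `C^0`, `C^1`, `C^3`
    (T : ℝ → Ω → M → M)
    (hT : ∀ ε ∈ I, Measurable fun p : Ω × M => T ε p.1 p.2)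
    (L : ℝ → Ω → C(M, ℝ) →L[ℝ] C(M, ℝ))
    (hL : ∀ ε ∈ I, ∀ ω, IsTransferOperator m (T ε ω) (L ε ω))
    (hL1 : ∀ ε ∈ I, ∀ ω, ∃ K : ℝ, CrBound cov 1 (L ε ω) K)
    (hL3 : ∀ ε ∈ I, ∀ ω, ∃ K : ℝ, CrBound cov 3 (L ε ω) K)
    -- exponents
    (p₀ p₁ p₂ p₃ p₄ p₅ p₆ β r δ a : ℝ) (hp₀ : 0 < p₀)
    (hp₁ : 30 ≤ p₁) (hp₂ : 30 ≤ p₂) (hp₃ : 30 ≤ p₃) (hp₄ : 30 ≤ p₄) (hp₅ : 30 ≤ p₅)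
    (hp₆ : 8 ≤ p₆) (hr : 0 < r) (hβr : 1 < β - r)
    (hpr₁ : 1 < p₁ * r / 3) (hpr₂ : 1 < p₂ * r / 3) (hpr₃ : 1 < p₃ * r / 3)
    (hpr₄ : 1 < p₄ * r / 3) (hδ : 0 < δ)
    (ha : a = (β - 1 - r) /
      (β + 1 - r + (1 / p₀ + 1 / p₁ + 2 / p₅ + 1 / p₄ + 1 / min p₂ p₃) + δ))
    (hβ : 4 < β) (hβa : 1 + 1 / a < β)
    -- random constants
    (C₀ C₁ C₂ C₃ C₄ A B : Ω → ℝ)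
    (hC₀ : MemLp C₀ (ENNReal.ofReal p₀) P) (hC₁ : MemLp C₁ (ENNReal.ofReal p₁) P)
    (hC₂ : MemLp C₂ (ENNReal.ofReal p₂) P) (hC₃ : MemLp C₃ (ENNReal.ofReal p₃) P)
    (hC₄ : MemLp C₄ (ENNReal.ofReal p₄) P) (hA : MemLp A (ENNReal.ofReal p₅) P)
    (hB : MemLp B (ENNReal.ofReal p₅) P)
    -- (1) bounds in the weak norm
    (h_weak : ∀ᵐ ω ∂P, ∀ ε ∈ I, ∀ n : ℕ, 1 ≤ n →
      ‖opIter σ (L ε) n (σ.symm^[n] ω)‖ ≤ C₀ ω)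
    -- (2) polynomial decay
    (h_decay : ∀ᵐ ω ∂P, ∀ ε ∈ I, ∀ n : ℕ, 1 ≤ n → ∀ φ : C(M, ℝ),
      ContMDiff (𝓡 d) 𝓘(ℝ, ℝ) 1 φ → ∫ x, φ x ∂m = 0 →
      ‖opIter σ (L ε) n ω φ‖ ≤ C₁ ω * (n : ℝ) ^ (-β) * crNorm cov 1 φ)
    -- (3) Lipschitz dependence on `ε` from `C^1` to `C^0`
    (h_lip : ∀ᵐ ω ∂P, ∀ ε ∈ I, ∀ φ : C(M, ℝ), ContMDiff (𝓡 d) 𝓘(ℝ, ℝ) 1 φ →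
      ‖L ε ω φ - L 0 ω φ‖ ≤ C₂ ω * |ε| * crNorm cov 1 φ)
    -- (4) the derivative operators `C^3 → V_s`
    (Lhat : Ω → C^3⟮𝓡 d, M; ℝ⟯ →ₗ[ℝ] C^1⟮𝓡 d, M; ℝ⟯)
    (h_hat_zero : ∀ᵐ ω ∂P, ∀ φ, ∫ x, Lhat ω φ x ∂m = 0)
    (h_deriv : ∀ᵐ ω ∂P, ∀ ε ∈ I, ε ≠ 0 → ∀ φ : C^3⟮𝓡 d, M; ℝ⟯,
      crNorm cov 1 (fun x => (1 / ε) * (L ε ω φ x - L 0 ω φ x) - Lhat ω φ x)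
        ≤ C₃ ω * |ε| * crNorm cov 3 φ)
    (h_hat : ∀ᵐ ω ∂P, ∀ φ : C^3⟮𝓡 d, M; ℝ⟯,
      crNorm cov 1 (Lhat ω φ) ≤ C₃ ω * crNorm cov 3 φ)
    -- (5) the equivariant densities
    (h : ℝ → Ω → C^3⟮𝓡 d, M; ℝ⟯)
    (h_meas : ∀ ε ∈ I, Measurable fun p : Ω × M => h ε p.1 p.2)
    (h_equiv : ∀ᵐ ω ∂P, ∀ ε ∈ I, L ε ω (h ε ω) = (h ε (σ ω) : C(M, ℝ)))
    (h_norm : ∀ᵐ ω ∂P, ∀ ε ∈ I, ∫ x, h ε ω x ∂m = 1)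
    (h_bound : ∀ᵐ ω ∂P, ∀ ε ∈ I, crNorm cov 3 (h ε ω) ≤ C₄ ω)
    -- (6) bounds in the strong norm for the unperturbed cocycle
    (h_strong : ∀ᵐ ω ∂P, ∀ n : ℕ, 1 ≤ n → ∀ j ≤ n,
      CrBound cov 1 (opIter σ (L 0) j (σ.symm^[n] ω))
        (A (σ.symm^[n] ω) * B (σ^[j] (σ.symm^[n] ω))))
    -- the additional bounds on `C^0`, `C^1`, `C^2`, `C^3` and on `Lhat` from `C^2` to `C^1`
    (A₀ A₁ A₂ A₃ Chat : Ω → ℝ) (hA₀ : MemLp A₀ 8 P) (hA₁ : MemLp A₁ 8 P)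
    (hA₂ : MemLp A₂ 8 P) (hA₃ : MemLp A₃ 8 P) (hChat : MemLp Chat 8 P)
    (h_top₀ : ∀ᵐ ω ∂P, ∀ ε ∈ I, ∀ j : ℕ, 1 ≤ j → ‖opIter σ (L ε) j ω‖ ≤ A₀ (σ^[j] ω))
    (h_top₁ : ∀ᵐ ω ∂P, ∀ ε ∈ I, ∀ j : ℕ, 1 ≤ j →
      CrBound cov 1 (opIter σ (L ε) j ω) (A₁ (σ^[j] ω)))
    (h_top₂ : ∀ᵐ ω ∂P, ∀ ε ∈ I, ∀ j : ℕ, 1 ≤ j →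
      CrBound cov 2 (opIter σ (L ε) j ω) (A₂ (σ^[j] ω)))
    (h_top₃ : ∀ᵐ ω ∂P, ∀ ε ∈ I, ∀ j : ℕ, 1 ≤ j →
      CrBound cov 3 (opIter σ (L ε) j ω) (A₃ (σ^[j] ω)))
    (h_hat₂ : ∀ᵐ ω ∂P, ∀ φ : C^3⟮𝓡 d, M; ℝ⟯,
      crNorm cov 1 (Lhat ω φ) ≤ Chat ω * crNorm cov 2 φ)
    -- the observable
    (f : Ω → M → ℝ) (hf : Measurable fun p : Ω × M => f p.1 p.2)
    (hf_smooth : ∀ᵐ ω ∂P, ContMDiff (𝓡 d) 𝓘(ℝ, ℝ) 3 (f ω))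
    (hf_mem : MemLp (fun ω => crNorm cov 3 (f ω)) (ENNReal.ofReal p₆) P) :
    -- the `μ_{ω,ε}` are probability measures
    (∀ ε ∈ I, ∀ᵐ ω ∂P, IsProbabilityMeasure (densityMeasure m (h ε ω))) ∧
    ∃ S2 : ℝ → ℝ,
      (∀ ε ∈ I,
        0 ≤ S2 ε ∧
        -- existence of the quenched variance
        (∀ᵐ ω ∂P, Tendsto (fun n : ℕ => (1 / (n : ℝ)) *
            Var[ergodicSum σ (T ε) f n ω; densityMeasure m (h ε ω)]) atTop (𝓝 (S2 ε))) ∧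
        -- the formula for the variance, with iterated integrals
        Summable (fun n : ℕ => correlation P m σ (T ε) (fun ω x => h ε ω x) f (n + 1)) ∧
        S2 ε = correlation P m σ (T ε) (fun ω x => h ε ω x) f 0
          + 2 * ∑' n : ℕ, correlation P m σ (T ε) (fun ω x => h ε ω x) f (n + 1) ∧
        -- and with integrals over the product
        (∀ n : ℕ,
          Integrable (fun p : Ω × M => h ε p.1 p.2
            * centered m (fun ω x => h ε ω x) f p.1 p.2
            * Function.uncurry (centered m (fun ω x => h ε ω x) f)
                ((skewProduct σ (T ε))^[n] p)) (P.prod m) ∧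
          correlation P m σ (T ε) (fun ω x => h ε ω x) f n
            = ∫ p : Ω × M, h ε p.1 p.2
                * centered m (fun ω x => h ε ω x) f p.1 p.2
                * Function.uncurry (centered m (fun ω x => h ε ω x) f)
                    ((skewProduct σ (T ε))^[n] p) ∂(P.prod m))) ∧
      -- differentiability at `0`, term by term
      (∀ n : ℕ, DifferentiableAt ℝ
        (fun ε => correlation P m σ (T ε) (fun ω x => h ε ω x) f n) 0) ∧
      Summable (fun n : ℕ =>
        deriv (fun ε => correlation P m σ (T ε) (fun ω x => h ε ω x) f (n + 1)) 0) ∧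
      HasDerivAt S2
        (deriv (fun ε => correlation P m σ (T ε) (fun ω x => h ε ω x) f 0) 0
          + 2 * ∑' n : ℕ,
            deriv (fun ε => correlation P m σ (T ε) (fun ω x => h ε ω x) f (n + 1)) 0) 0 := by
  classical
  have hmP := hm.isProbabilityMeasure
  have hmp : MeasurePreserving σ.toEquiv P P := hσ.toMeasurePreserving
  have hmp' : MeasurePreserving σ.toEquiv.symm P P := hσ.symm.toMeasurePreserving
  -- Products of at most eight values of the random constants along an orbit have to be
  -- integrable, so `L^8` is the only integrability that is needed.
  have hmemLp : ∀ {p : ℝ} {C : Ω → ℝ}, 8 ≤ p → MemLp C (ENNReal.ofReal p) P →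
      MemLp C 8 P := fun {p C} hp hC => by
    refine hC.mono_exponent ?_
    rw [show (8 : ℝ≥0∞) = ENNReal.ofReal 8 by simp]
    exact ENNReal.ofReal_le_ofReal hp
  -- The factor `2 ^ β` accounts for the passage from `n ^ (-β)` to `(n + 1) ^ (-β)`.
  obtain ⟨E, hEmem, hE1, hEle⟩ := exists_dominating (P := P)
    (C := ![fun ω => 2 ^ β * |C₁ ω|, C₃, C₄, A₀, A₁, A₃, fun ω => crNorm cov 3 (f ω)]) (by
      have h1 : MemLp (fun ω => 2 ^ β * |C₁ ω|) 8 P :=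
        (hmemLp (by linarith) hC₁).abs.const_mul (2 ^ β)
      intro i
      fin_cases i
      · exact h1
      · exact hmemLp (by linarith) hC₃
      · exact hmemLp (by linarith) hC₄
      · exact hA₀
      · exact hA₁
      · exact hA₃
      · exact hmemLp hp₆ hf_mem)
  have hEC₁ : ∀ ω, 2 ^ β * |C₁ ω| ≤ E ω := hEle 0
  have hEC₃ : ∀ ω, C₃ ω ≤ E ω := hEle 1
  have hEC₄ : ∀ ω, C₄ ω ≤ E ω := hEle 2
  have hEA₀ : ∀ ω, A₀ ω ≤ E ω := hEle 3
  have hEA₁ : ∀ ω, A₁ ω ≤ E ω := hEle 4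
  have hEA₃ : ∀ ω, A₃ ω ≤ E ω := hEle 5
  have hEf : ∀ ω, crNorm cov 3 (f ω) ≤ E ω := hEle 6
  have hE8 : Integrable (fun ω => E ω ^ 8) P := integrable_pow_eight hEmem
  have hEpos : ∀ ω, 0 ≤ E ω := fun ω => zero_le_one.trans (hE1 ω)
  have hβ0 : 0 ≤ β := by linarith
  have hpast : ∀ᵐ ω ∂P, Summable fun n =>
      decayWeight β n ^ 2 * E (σ.toEquiv.symm^[n] ω) ^ 8 := by
    have hi : ∀ n, Integrable (fun ω => E (σ.toEquiv.symm^[n] ω) ^ 8) P := fun n =>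
      (hmp'.iterate n).integrable_comp_of_integrable hE8
    filter_upwards [ae_summable_of_summable_integral
      (fun n => (hi n).const_mul (decayWeight β n ^ 2)) (by
        refine ((summable_decayWeight (by linarith : (3 : ℝ) < β)).mul_right
          (∫ ω, E ω ^ 8 ∂P)).congr fun n => ?_
        rw [← (hmp'.iterate n).integral_comp_of_integrable hE8, ← integral_const_mul]
        refine integral_congr_ae (Eventually.of_forall fun ω => ?_)
        have := hEpos (σ.toEquiv.symm^[n] ω)
        exact (Real.norm_of_nonneg (by positivity)).symm)] with ω hω
    exact hω.of_norm
  have hgood := hpast.and (h_decay.and (h_deriv.and (h_hat.and (h_equiv.and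
    (h_norm.and (h_bound.and (h_top₀.and (h_top₁.and (h_top₃.and hf_smooth)))))))))
  obtain ⟨G, hGae, hG, hGσ, hGσ'⟩ := exists_invariant_set hmp hmp' hgood
  set h' : ℝ → Ω → C(M, ℝ) := fun ε ω => (h ε ω : C(M, ℝ)) with hh'
  set F : Ω → C(M, ℝ) := fun ω =>
    if hω : ContMDiff (𝓡 d) 𝓘(ℝ, ℝ) 3 (f ω) then ⟨f ω, hω.continuous⟩ else 0 with hF
  set D : Ω → C(M, ℝ) → C(M, ℝ) := fun ω φ =>
    if hφ : ContMDiff (𝓡 d) 𝓘(ℝ, ℝ) 3 φ then (Lhat ω ⟨φ, hφ⟩ : C(M, ℝ)) else 0 with hD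
  have hfF : ∀ ω ∈ G, f ω = F ω := fun ω hω => by
    obtain ⟨-, -, -, -, -, -, -, -, -, -, hs⟩ := hG ω hω
    simp only [hF]
    rw [dif_pos hs]
    rfl
  have hcast : ∀ {u : M → ℝ} {K : ℝ}, CrLe cov 3 u K → ContMDiff (𝓡 d) 𝓘(ℝ, ℝ) 3 u :=
    fun hu => by simpa using hu.1
  have S : ResponseSystem cov m σ.toEquiv I T L h' F D E (decayWeight β) G :=
    { mem_nhds := hI_open.mem_nhds hI_zero
      abs_le_one := fun ε hε => abs_le.2 ⟨(hI_sub hε).1.le, (hI_sub hε).2.le⟩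
      one_le := hE1
      weight_pos := decayWeight_pos β
      weight_le_one := decayWeight_le_one hβ0
      summable_weight := summable_decayWeight (by linarith)
      map_mem := hGσ
      symm_mem := hGσ'
      summable_past := fun ω hω => (hG ω hω).1
      measurable_map := fun ε hε ω => (hT ε hε).comp measurable_prodMk_left
      isTransferOperator := hL
      norm_iter := fun ω hω ε hε n φ => by
        obtain ⟨-, -, -, -, -, -, -, h0, -, -, -⟩ := hG ω hω
        rcases Nat.eq_zero_or_pos n with rfl | hn
        · exact le_mul_of_one_le_left (norm_nonneg φ) (hE1 _)
        · exact (ContinuousLinearMap.le_opNorm _ _).trans (by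
            gcongr
            exact (h0 ε hε n hn).trans (hEA₀ _))
      iter_one := fun ω hω ε hε n φ K hφ => by
        obtain ⟨-, -, -, -, -, -, -, -, h1, -, -⟩ := hG ω hω
        rcases Nat.eq_zero_or_pos n with rfl | hn
        · exact hφ.mono (le_mul_of_one_le_left hφ.nonneg (hE1 _))
        · exact (h1 ε hε n hn).crLe (hEA₁ _) (hEpos _) hφ
      iter_three := fun ω hω ε hε n φ K hφ => by
        obtain ⟨-, -, -, -, -, -, -, -, -, h3, -⟩ := hG ω hω
        rcases Nat.eq_zero_or_pos n with rfl | hn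
        · exact hφ.mono (le_mul_of_one_le_left hφ.nonneg (hE1 _))
        · exact (h3 ε hε n hn).crLe (hEA₃ _) (hEpos _) hφ
      decay := fun ω hω ε hε n φ K hφ hφ0 => by
        obtain ⟨-, hd, -, -, -, -, -, -, -, -, -⟩ := hG ω hω
        rcases Nat.eq_zero_or_pos n with rfl | hn
        · have hw : decayWeight β 0 = 1 := by simp [decayWeight]
          rw [hw, one_pow, mul_one]
          exact hφ.norm_le.trans (le_mul_of_one_le_left hφ.nonneg (hE1 _))
        · have hw := decayWeight_pos β n
          have hN : 0 ≤ crNorm cov 1 φ := ENNReal.toReal_nonneg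
          calc _ ≤ C₁ ω * (n : ℝ) ^ (-β) * crNorm cov 1 φ :=
                hd ε hε n hn φ (by simpa using hφ.1) hφ0
            _ ≤ |C₁ ω| * (2 ^ β * decayWeight β n ^ 6) * K := by
                gcongr
                · exact le_abs_self _
                · exact rpow_neg_le_decayWeight hβ0 hn
                · exact hφ.2
            _ = 2 ^ β * |C₁ ω| * decayWeight β n ^ 6 * K := by ring
            _ ≤ E ω * decayWeight β n ^ 6 * K := by
                have := hφ.nonneg
                gcongr
                exact hEC₁ ω
      deriv := fun ω hω ε hε hε0 φ K hφ => by
        obtain ⟨-, -, hd, -, -, -, -, -, -, -, -⟩ := hG ω hω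
        have hφ3 := hcast hφ
        obtain ⟨K₁, hK₁⟩ := hL3 ε hε ω
        obtain ⟨K₀, hK₀⟩ := hL3 0 hI_zero ω
        have hDφ : D ω φ = (Lhat ω ⟨φ, hφ3⟩ : C(M, ℝ)) := by
          simp only [hD]
          rw [dif_pos hφ3]
        have h1 : ContMDiff (𝓡 d) 𝓘(ℝ, ℝ) 1 (L ε ω φ) := (hK₁ φ hφ.1).1.of_le (by norm_num)
        have h2 : ContMDiff (𝓡 d) 𝓘(ℝ, ℝ) 1 (L 0 ω φ) := (hK₀ φ hφ.1).1.of_le (by norm_num)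
        have h3 : ContMDiff (𝓡 d) 𝓘(ℝ, ℝ) 1
            (fun x => (1 / ε) * (L ε ω φ x - L 0 ω φ x) - Lhat ω ⟨φ, hφ3⟩ x) :=
          (contMDiff_const.mul (h1.sub h2)).sub (Lhat ω ⟨φ, hφ3⟩).contMDiff
        rw [hDφ]
        refine ⟨h3.of_le (by norm_num), ?_⟩
        have hN : 0 ≤ crNorm cov 3 φ := ENNReal.toReal_nonneg
        calc _ ≤ C₃ ω * |ε| * crNorm cov 3 φ := hd ε hε hε0 ⟨φ, hφ3⟩
          _ ≤ E ω * |ε| * K := by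
            have := hEpos ω
            gcongr
            · exact hEC₃ ω
            · exact hφ.2
      deriv_bound := fun ω hω φ K hφ => by
        obtain ⟨-, -, -, hd, -, -, -, -, -, -, -⟩ := hG ω hω
        have hφ3 := hcast hφ
        have hDφ : D ω φ = (Lhat ω ⟨φ, hφ3⟩ : C(M, ℝ)) := by
          simp only [hD]
          rw [dif_pos hφ3]
        rw [hDφ]
        refine ⟨by simpa using (Lhat ω ⟨φ, hφ3⟩).contMDiff, (hd ⟨φ, hφ3⟩).trans ?_⟩
        exact mul_le_mul (hEC₃ ω) hφ.2 ENNReal.toReal_nonneg (hEpos ω)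
      equivariant := fun ω hω ε hε => by
        obtain ⟨-, -, -, -, he, -, -, -, -, -, -⟩ := hG ω hω
        exact he ε hε
      integral_density := fun ω hω ε hε => by
        obtain ⟨-, -, -, -, -, hn, -, -, -, -, -⟩ := hG ω hω
        exact hn ε hε
      density := fun ω hω ε hε => by
        obtain ⟨-, -, -, -, -, -, hb, -, -, -, -⟩ := hG ω hω
        exact ⟨(h ε ω).contMDiff.of_le (by norm_num), (hb ε hε).trans (hEC₄ ω)⟩
      observable := fun ω hω => by
        obtain ⟨-, -, -, -, -, -, -, -, -, -, hs⟩ := hG ω hω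
        rw [← hfF ω hω]
        exact ⟨by simpa using hs, hEf ω⟩ }
  have hmeas : ∀ ε ∈ I, ∀ n,
      AEStronglyMeasurable (fibreCorr m σ.toEquiv L h' F ε n) P := fun ε hε n =>
    S.aestronglyMeasurable_fibreCorr hfF hGae hf h_meas hT hmp hε n
  have hcorr : ∀ ε ∈ I, ∀ n, correlation P m σ (T ε) (fun ω x => h ε ω x) f n
      = ∫ ω, fibreCorr m σ.toEquiv L h' F ε n ω ∂P := fun ε hε n =>
    S.correlation_eq hfF hGae hε n
  refine ⟨fun ε hε => ?_, fun ε => correlation P m σ (T ε) (fun ω x => h ε ω x) f 0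
    + 2 * ∑' n : ℕ, correlation P m σ (T ε) (fun ω x => h ε ω x) f (n + 1),
    fun ε hε => ?_, ?_⟩
  · filter_upwards [hGae] with ω hω
    exact S.isProbabilityMeasure hε hω
  · have hvar : ∀ᵐ ω ∂P, Tendsto (fun n : ℕ => (1 / (n : ℝ)) *
        Var[ergodicSum σ (T ε) f n ω; densityMeasure m (h ε ω)]) atTop
        (𝓝 (correlation P m σ (T ε) (fun ω x => h ε ω x) f 0
          + 2 * ∑' n : ℕ, correlation P m σ (T ε) (fun ω x => h ε ω x) f (n + 1))) := by
      simp only [hcorr ε hε]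
      exact S.ae_tendsto_variance hfF hGae hσ hE8 hmeas hε
    refine ⟨?_, hvar, ?_, rfl, fun n => ⟨?_, ?_⟩⟩
    · obtain ⟨ω, hω⟩ := hvar.exists
      exact ge_of_tendsto' hω fun n => mul_nonneg (by positivity) (variance_nonneg _ _)
    · simp only [hcorr ε hε]
      exact (summable_nat_add_iff 1).2 (S.summable_integral_fibreCorr hGae hmp hE8 hmeas hε)
    · exact S.integrable_correlation_integrand hfF hGae hf h_meas hT hmp hE8 hε n
    · exact S.correlation_eq_integral_prod hfF hGae hf h_meas hT hmp hE8 hε n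
  · obtain ⟨c', hc', hsum, hder⟩ := S.exists_hasDerivAt hGae hmp hE8 hmeas hmp'
    have hI : ∀ᶠ ε in 𝓝 (0 : ℝ), ε ∈ I := hI_open.mem_nhds hI_zero
    have hc : ∀ n, HasDerivAt (fun ε => correlation P m σ (T ε) (fun ω x => h ε ω x) f n)
        (c' n) 0 := fun n => (hc' n).congr_of_eventuallyEq (hI.mono fun ε hε => hcorr ε hε n)
    have hderiv : ∀ n, deriv (fun ε => correlation P m σ (T ε) (fun ω x => h ε ω x) f n) 0
        = c' n := fun n => (hc n).deriv
    refine ⟨fun n => (hc n).differentiableAt, ?_, ?_⟩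
    · simp only [hderiv]
      exact (summable_nat_add_iff 1).2 hsum
    · simp only [hderiv]
      refine (hc 0).add (HasDerivAt.const_mul 2 (hder.congr_of_eventuallyEq ?_))
      filter_upwards [hI] with ε hε
      exact tsum_congr fun n => hcorr ε hε (n + 1)
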